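/- **Setting.** Let $k_1,k_2,k_3\in\mathbb R$. For $i=1,2,3$ let $R_i$ be the reflection $x_i\mapsto -x_i$, let $T_i f=\partial f/\partial x_i+k_i\,(f-R_if)/x_i$ be the Dunkl operator, and let $t_i=-2k_i$ if $2k_i$ is an odd negative integer and $t_i=\infty$ otherwise. Let $e_1=\begin{pmatrix}0&1\\1&0\end{pmatrix}$, $e_2=\begin{pmatrix}0&-\mathrm i\\ \mathrm i&0\end{pmatrix}$, $e_3=\begin{pmatrix}1&0\\0&-1\end{pmatrix}$. For $n\ge 0$ let $\mathscr M_n$ be the kernel of $\mathbf D=\sum_i e_i\otimes T_i$ on $\mathbb C^2\otimes_{\mathbb R}\mathbb R[x_1,x_2,x_3]_n$ (homogeneous polynomials of degree $n$). The universal Bannai–Ito algebra $\mathfrak{BI}$ is the unital associative $\mathbb C$-algebra generated by $X,Y,Z$ subject to the relations that $\kappa=\{X,Y\}-Z$, $\lambda=\{Y,Z\}-X$, $\mu=\{Z,X\}-Y$ commute with $X,Y,Z$, where $\{u,v\}=uv+vu$. It acts on $\mathscr M_n$ as follows: for $(i,j,l)=(1,2,3),(2,3,1),(3,1,2)$ respectively,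 $X,Y,Z$ act as $$\mathrm i\,e_i\otimes(x_lT_j-x_jT_l)R_jR_l+\tfrac12R_jR_l+k_jR_l+k_lR_j .$$ The submodule $\mathscr M_n(x_i)$ consists of the elements of $\mathscr M_n$ all of whose monomials have exponent at least $t_i$ in $x_i$ (it is $0$ if $n<t_i$). For even $d\ge 0$ and $a,b,c\in\mathbb C$, $O_d(a,b,c)$ is the $\mathfrak{BI}$-module with basis $v_0,\dots,v_d$ and $$Xv_i=\theta_iv_i+v_{i+1},\qquad Yv_i=\theta^*_iv_i+\varphi_iv_{i-1}\qquad(v_{-1}=v_{d+1}=0),$$ on which $\kappa$ acts as $2ab-c(d+1)$ (so that $Z=\{X,Y\}-2ab+c(d+1)$), where $\theta_i=\frac{(-1)^i(2a-d+2i)}2$, $\theta^*_i=\frac{(-1)^i(2b-d+2i)}2$, and $\varphi_i=\frac{i(d+1-2i-2a-2b-2c)}2$ for even $i$, $\varphi_i=\frac{(i-d-1)(d+1-2i-2a-2b+2c)}2$ for odd $i$. For $g\in\{\pm1\}^2$ and $\sigma\in\mathfrak S_3$, writing $X_1,X_2,X_3=X,Y,Z$, let $(g,\sigma)$ act on $\mathfrak{BI}$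 as the algebra automorphism $X_i\mapsto g(X_{\sigma(i)})$, where $g=(g_1,g_2)$ sends $X,Y,Z$ to $g_1X,\,g_2Y,\,g_1g_2Z$. For an automorphism $\varepsilon$, $V^{\varepsilon}$ is the space $V$ on which $u\in\mathfrak{BI}$ acts as $\varepsilon(u)$ acts on $V$. Permutations are composed as functions, so $(1\,2\,3)$ sends $1\mapsto2\mapsto3\mapsto1$. Write $2W=W\oplus W$, $K=k_1+k_2+k_3+n+1$, $h=\frac{n+1}2$. **Theorem.** Let $n\ge 0$ be an even integer. All isomorphisms are of $\mathfrak{BI}$-modules. **(A)** Suppose $t_1+t_3\le n<t_2$. Put $P=O_{n-t_1-t_3}(k_1+k_2+h,\,-k_2-k_3-h,\,-h)^{((-1,1),(2\,3))}$, $Q=O_{t_3-1}(k_2,-K,-k_1)^{((1,-1),(2\,3))}$, $S=O_{t_1-1}(k_2,-K,-k_3)^{((1,-1),(1\,2\,3))}$. 1. $\mathscr M_n(x_1)\cap\mathscr M_n(x_3)\cong 2P$. 2. $\mathscr M_n(x_1)/(\mathscr M_n(x_1)\cap\mathscr M_n(x_3))\cong\mathscr M_n/\mathscr M_n(x_3)\cong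 2Q$. 3. $\mathscr M_n(x_3)/(\mathscr M_n(x_1)\cap\mathscr M_n(x_3))\cong\mathscr M_n/\mathscr M_n(x_1)\cong 2S$. If moreover $k_2\ge0$, then $P,Q,S$ are irreducible and isomorphic to $O_{n-t_1-t_3}(-k_1-k_2-h,\,h,\,-k_2-k_3-h)$, $O_{t_3-1}(k_2,k_1,K)$, $O_{t_1-1}(K,k_3,k_2)$, respectively. **(B)** Suppose $t_1+t_2\le n<t_3$. Put $P=O_{n-t_1-t_2}(k_2+k_3+h,\,-k_1-k_3-h,\,-h)^{((-1,1),(1\,2))}$, $Q=O_{t_1-1}(k_3,-K,-k_2)^{((1,-1),(1\,2))}$, $S=O_{t_2-1}(k_3,-K,-k_1)^{(1,-1)}$. 1. $\mathscr M_n(x_1)\cap\mathscr M_n(x_2)\cong 2P$. 2. $\mathscr M_n(x_2)/(\mathscr M_n(x_1)\cap\mathscr M_n(x_2))\cong\mathscr M_n/\mathscr M_n(x_1)\cong 2Q$. 3. $\mathscr M_n(x_1)/(\mathscr M_n(x_1)\cap\mathscr M_n(x_2))\cong\mathscr M_n/\mathscr M_n(x_2)\cong 2S$. If moreover $k_3\ge0$,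 then $P,Q,S$ are irreducible and isomorphic to $O_{n-t_1-t_2}(-k_1-k_3-h,\,-k_2-k_3-h,\,h)$, $O_{t_1-1}(K,k_3,k_2)$, $O_{t_2-1}(k_3,K,k_1)$, respectively. **(C)** Suppose $t_2+t_3\le n<t_1$. Put $P=O_{n-t_2-t_3}(k_1+k_3+h,\,-k_1-k_2-h,\,-h)^{((-1,1),(1\,3))}$, $Q=O_{t_2-1}(k_1,-K,-k_3)^{((1,-1),(1\,3))}$, $S=O_{t_3-1}(k_1,-K,-k_2)^{((1,-1),(1\,3\,2))}$. 1. $\mathscr M_n(x_2)\cap\mathscr M_n(x_3)\cong 2P$. 2. $\mathscr M_n(x_3)/(\mathscr M_n(x_2)\cap\mathscr M_n(x_3))\cong\mathscr M_n/\mathscr M_n(x_2)\cong 2Q$. 3. $\mathscr M_n(x_2)/(\mathscr M_n(x_2)\cap\mathscr M_n(x_3))\cong\mathscr M_n/\mathscr M_n(x_3)\cong 2S$. If moreover $k_1\ge0$, then $P,Q,S$ are irreducible and isomorphic to $O_{n-t_2-t_3}(h,\,-k_1-k_2-h,\,-k_1-k_3-h)$, $O_{t_2-1}(k_3,K,k_1)$,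 $O_{t_3-1}(k_2,k_1,K)$, respectively. -/

import Mathlib

set_option linter.unusedSimpArgs false

noncomputable section

namespace BannaiIto

open MvPolynomial

/-- The reflection `f ↦ f(…, -x_i, …)` on complex polynomials in the three variables `x_0, x_1, x_2`
(indices are shifted by one: `x_0, x_1, x_2` stand for the usual `x_1, x_2, x_3`, and likewise for `k`). -/
def reflect (i : Fin 3) : MvPolynomial (Fin 3) ℂ →ₐ[ℂ] MvPolynomial (Fin 3) ℂ :=
  aeval (fun j => if j = i then -X j else X j)

/-- The Dunkl operator `T_i f = ∂f/∂x_i + k_i (f - f(…, -x_i, …)) / x_i`. The division is exact, because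
`f - f(…, -x_i, …)` is odd in `x_i`. -/
def dunkl (k : Fin 3 → ℝ) (i : Fin 3) :
    MvPolynomial (Fin 3) ℂ →ₗ[ℂ] MvPolynomial (Fin 3) ℂ where
  toFun f := pderiv i f + (k i : ℂ) • (f - reflect i f).divMonomial (Finsupp.single i 1)
  map_add' f g := by
    rw [map_add, map_add, add_sub_add_comm, add_divMonomial, smul_add]
    abel
  map_smul' c f := by
    have h : ∀ p : MvPolynomial (Fin 3) ℂ, (c • p).divMonomial (Finsupp.single i 1)
        = c • p.divMonomial (Finsupp.single i 1) := by
      intro p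
      ext d
      simp [coeff_divMonomial]
    rw [Derivation.map_smul, map_smul, ← smul_sub, h, RingHom.id_apply, smul_add, smul_comm c]

lemma coeff_refl (i : Fin 3) (f : MvPolynomial (Fin 3) ℂ) (d : Fin 3 →₀ ℕ) :
    coeff d (reflect i f) = (-1) ^ d i * coeff d f := by
  induction f using MvPolynomial.induction_on'' generalizing d with
  | C a =>
    rw [reflect, aeval_C]
    simp only [algebraMap_eq, coeff_C]
    split_ifs with h
    · subst h; simp
    · simp
  | monomial_add a b f _ _ h1 h2 => simp only [map_add, coeff_add, h1, h2]; ring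
  | mul_X p j h =>
    rw [map_mul]
    have : reflect i (X j) = if j = i then -X j else X j := by simp [reflect]
    rw [this]
    have key : ∀ c : ℂ, coeff d (reflect i p * X j) = (if j ∈ d.support then
        (-1) ^ ((d - Finsupp.single j 1 : Fin 3 →₀ ℕ) i) * coeff (d - Finsupp.single j 1) p else 0) := by
      intro c
      rw [coeff_mul_X']
      split_ifs <;> simp [h]
    split_ifs with hj
    · subst hj
      rw [mul_neg, coeff_neg, key 0, coeff_mul_X']
      split_ifs with hd
      · have : d j ≠ 0 := by simpa using hd
        obtain ⟨m, hm⟩ := Nat.exists_eq_succ_of_ne_zero this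
        simp [hm, pow_succ]
      · simp
    · rw [key 0, coeff_mul_X']
      split_ifs with hd
      · simp [hj]
      · simp

lemma coeff_dunkl (k : Fin 3 → ℝ) (i : Fin 3) (f : MvPolynomial (Fin 3) ℂ) (d : Fin 3 →₀ ℕ) :
    coeff d (dunkl k i f) =
      (d i + 1 + (1 + (-1) ^ d i) * k i) * coeff (d + Finsupp.single i 1) f := by
  simp only [dunkl, LinearMap.coe_mk, AddHom.coe_mk, coeff_add, coeff_pderiv, coeff_smul,
    coeff_divMonomial, coeff_sub, coeff_refl, smul_eq_mul, add_comm (Finsupp.single i 1) d]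
  simp [pow_succ]
  ring

lemma refl_X_self (i : Fin 3) : reflect i (X i) = -X i := by simp [reflect]
lemma refl_X_ne {i j : Fin 3} (h : j ≠ i) : reflect i (X j) = X j := by simp [reflect, h]
lemma refl_refl (i : Fin 3) (f : MvPolynomial (Fin 3) ℂ) : reflect i (reflect i f) = f := by
  ext d
  rw [coeff_refl, coeff_refl, ← mul_assoc, ← mul_pow]; simp
lemma refl_comm (i j : Fin 3) (f : MvPolynomial (Fin 3) ℂ) :
    reflect i (reflect j f) = reflect j (reflect i f) := by
  ext d
  simp only [coeff_refl]; ring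
lemma dunkl_comm (k : Fin 3 → ℝ) (i j : Fin 3) (f : MvPolynomial (Fin 3) ℂ) :
    dunkl k i (dunkl k j f) = dunkl k j (dunkl k i f) := by
  rcases eq_or_ne i j with rfl | h
  · rfl
  ext d
  simp only [coeff_dunkl, Finsupp.add_apply, Finsupp.single_apply, h, h.symm, if_false, add_zero,
    add_right_comm d]
  ring
lemma dunkl_refl_self (k : Fin 3 → ℝ) (i : Fin 3) (f : MvPolynomial (Fin 3) ℂ) :
    dunkl k i (reflect i f) = -reflect i (dunkl k i f) := by
  ext d
  simp [coeff_dunkl, coeff_refl, pow_succ]; ring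
lemma dunkl_refl_ne (k : Fin 3 → ℝ) {i j : Fin 3} (h : j ≠ i) (f : MvPolynomial (Fin 3) ℂ) :
    dunkl k i (reflect j f) = reflect j (dunkl k i f) := by
  ext d
  simp [coeff_dunkl, coeff_refl, h.symm]; ring
lemma dunkl_X_self (k : Fin 3 → ℝ) (i : Fin 3) (f : MvPolynomial (Fin 3) ℂ) :
    dunkl k i (X i * f) = X i * dunkl k i f + f + C (2 * k i : ℂ) * reflect i f := by
  ext d
  simp only [coeff_dunkl, coeff_X_mul', coeff_add, coeff_C_mul, coeff_refl, Finsupp.mem_support_iff]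
  by_cases h : d i = 0
  · simp [h]; ring
  · obtain ⟨m, hm⟩ := Nat.exists_eq_succ_of_ne_zero h
    have : d - Finsupp.single i 1 + Finsupp.single i 1 = d := by
      ext j
      by_cases hj : i = j
      · subst hj; simp [hm]
      · simp [hj]
    simp [this, hm, pow_succ]; ring
lemma dunkl_X_ne (k : Fin 3 → ℝ) {i j : Fin 3} (h : j ≠ i) (f : MvPolynomial (Fin 3) ℂ) :
    dunkl k i (X j * f) = X j * dunkl k i f := by
  ext d
  simp only [coeff_dunkl, coeff_X_mul', Finsupp.mem_support_iff]
  have e : (d + Finsupp.single i 1 : Fin 3 →₀ ℕ) j = d j := by simp [h.symm]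
  rw [e]
  split_ifs with hd
  · have : d + Finsupp.single i 1 - Finsupp.single j 1
        = d - Finsupp.single j 1 + Finsupp.single i 1 := by
      ext l
      simp only [Finsupp.tsub_apply, Finsupp.add_apply, Finsupp.single_apply]
      grind
    rw [this]
    simp [h]
  · simp
lemma dunkl_C_mul (k : Fin 3 → ℝ) (i : Fin 3) (c : ℂ) (f : MvPolynomial (Fin 3) ℂ) :
    dunkl k i (C c * f) = C c * dunkl k i f := by
  rw [← smul_eq_C_mul, map_smul, smul_eq_C_mul]
lemma X_mul_dunkl (k : Fin 3 → ℝ) (i : Fin 3) (f : MvPolynomial (Fin 3) ℂ) :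
    X i * dunkl k i f = X i * pderiv i f + C (k i : ℂ) * (f - reflect i f) := by
  ext d
  simp only [coeff_add, coeff_X_mul', coeff_C_mul, coeff_sub, coeff_refl, coeff_dunkl, coeff_pderiv,
    Finsupp.mem_support_iff]
  by_cases h : d i = 0
  · simp [h]
  · obtain ⟨m, hm⟩ := Nat.exists_eq_succ_of_ne_zero h
    have : d - Finsupp.single i 1 + Finsupp.single i 1 = d := by
      ext j
      by_cases hj : i = j
      · subst hj; simp [hm]
      · simp [hj]
    simp [this, hm, pow_succ]; ring

/-- `ℂ² ⊗_ℝ ℝ[x_0, x_1, x_2]`, realised as pairs of complex polynomials. -/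
abbrev Spinor : Type := Fin 2 → MvPolynomial (Fin 3) ℂ

/-- The Pauli matrices, by which the Clifford generators `e_1, e_2, e_3` act on `ℂ²`. -/
def pauli (i : Fin 3) : Matrix (Fin 2) (Fin 2) ℂ :=
  (![!![0, 1; 1, 0], !![0, -Complex.I; Complex.I, 0], !![1, 0; 0, -1]] :
    Fin 3 → Matrix (Fin 2) (Fin 2) ℂ) i

/-- The operator `A ⊗ T` on `ℂ²`-valued polynomials. -/
def tensorOp (A : Matrix (Fin 2) (Fin 2) ℂ)
    (T : MvPolynomial (Fin 3) ℂ →ₗ[ℂ] MvPolynomial (Fin 3) ℂ) : Spinor →ₗ[ℂ] Spinor :=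
  LinearMap.pi fun r => ∑ s, A r s • T ∘ₗ LinearMap.proj s

/-- The Dirac-Dunkl operator `D = ∑ e_i ⊗ T_i`. -/
def diracDunkl (k : Fin 3 → ℝ) : Spinor →ₗ[ℂ] Spinor :=
  ∑ i, tensorOp (pauli i) (dunkl k i)

/-- Multiplication by the variable `x_i`. -/
def mulX (i : Fin 3) : MvPolynomial (Fin 3) ℂ →ₗ[ℂ] MvPolynomial (Fin 3) ℂ :=
  LinearMap.mulLeft ℂ (X i)

/-- The operators `X, Y, Z` (for `i = 0, 1, 2`). With `j = i + 1` and `l = i + 2` modulo 3, and `R_j` the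
reflection in `x_j`, the `i`-th one is
`√-1 e_i ⊗ (x_l T_j - x_j T_l) R_j R_l + (1/2) R_j R_l + k_j R_l + k_l R_j`. -/
def biOp (k : Fin 3 → ℝ) (i : Fin 3) : Spinor →ₗ[ℂ] Spinor :=
  (Complex.I • tensorOp (pauli i)
      (mulX (i + 2) ∘ₗ dunkl k (i + 1) - mulX (i + 1) ∘ₗ dunkl k (i + 2)))
      ∘ₗ tensorOp 1 ((reflect (i + 1)).toLinearMap ∘ₗ (reflect (i + 2)).toLinearMap)
    + (1 / 2 : ℂ) • tensorOp 1 ((reflect (i + 1)).toLinearMap ∘ₗ (reflect (i + 2)).toLinearMap)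
    + (k (i + 1) : ℂ) • tensorOp 1 (reflect (i + 2)).toLinearMap
    + (k (i + 2) : ℂ) • tensorOp 1 (reflect (i + 1)).toLinearMap

/-- The space of Dunkl monogenics of degree `n`: the kernel of the Dirac-Dunkl operator on
`ℂ²`-valued homogeneous polynomials of degree `n`. -/
def monogenic (k : Fin 3 → ℝ) (n : ℕ) : Submodule ℂ Spinor where
  carrier := {f | (∀ s, (f s).IsHomogeneous n) ∧ diracDunkl k f = 0}
  add_mem' hf hg := ⟨fun s => (hf.1 s).add (hg.1 s), by rw [map_add, hf.2, hg.2, add_zero]⟩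
  zero_mem' := ⟨fun _ => isHomogeneous_zero _ _ _, map_zero _⟩
  smul_mem' c f hf := ⟨fun s => (homogeneousSubmodule (Fin 3) ℂ n).smul_mem c (hf.1 s),
    by rw [map_smul, hf.2, smul_zero]⟩

lemma act0 (k : Fin 3 → ℝ) (f : Spinor) : biOp k 0 f =
   ![C Complex.I * (X 2 * dunkl k 1 (reflect 1 (reflect 2 (f 1))) - X 1 * dunkl k 2 (reflect 1 (reflect 2 (f 1))))
      + C (1/2) * reflect 1 (reflect 2 (f 0)) + C (k 1 : ℂ) * reflect 2 (f 0) + C (k 2 : ℂ) * reflect 1 (f 0),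
     C Complex.I * (X 2 * dunkl k 1 (reflect 1 (reflect 2 (f 0))) - X 1 * dunkl k 2 (reflect 1 (reflect 2 (f 0))))
      + C (1/2) * reflect 1 (reflect 2 (f 1)) + C (k 1 : ℂ) * reflect 2 (f 1) + C (k 2 : ℂ) * reflect 1 (f 1)] := by
  ext1 s
  fin_cases s <;>
  simp [-Complex.coe_smul, biOp, tensorOp, pauli, mulX, MvPolynomial.smul_eq_C_mul]

lemma act1 (k : Fin 3 → ℝ) (f : Spinor) : biOp k 1 f =
   ![(X 0 * dunkl k 2 (reflect 2 (reflect 0 (f 1))) - X 2 * dunkl k 0 (reflect 2 (reflect 0 (f 1))))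
      + C (1/2) * reflect 2 (reflect 0 (f 0)) + C (k 2 : ℂ) * reflect 0 (f 0) + C (k 0 : ℂ) * reflect 2 (f 0),
     -(X 0 * dunkl k 2 (reflect 2 (reflect 0 (f 0))) - X 2 * dunkl k 0 (reflect 2 (reflect 0 (f 0))))
      + C (1/2) * reflect 2 (reflect 0 (f 1)) + C (k 2 : ℂ) * reflect 0 (f 1) + C (k 0 : ℂ) * reflect 2 (f 1)] := by
  have e1 : (1 : Fin 3) + 1 = 2 := rfl
  have e2 : (1 : Fin 3) + 2 = 0 := rfl
  have hI : (C Complex.I : MvPolynomial (Fin 3) ℂ) * C Complex.I = -1 := by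
    rw [← C_mul, Complex.I_mul_I]; simp
  ext1 s
  fin_cases s
  · simp [-Complex.coe_smul, biOp, tensorOp, pauli, mulX, MvPolynomial.smul_eq_C_mul, e1, e2]
    linear_combination (-(X 0 * dunkl k 2 (reflect 2 (reflect 0 (f 1))) - X 2 * dunkl k 0 (reflect 2 (reflect 0 (f 1))))) * hI
  · simp [-Complex.coe_smul, biOp, tensorOp, pauli, mulX, MvPolynomial.smul_eq_C_mul, e1, e2]
    linear_combination ((X 0 * dunkl k 2 (reflect 2 (reflect 0 (f 0))) - X 2 * dunkl k 0 (reflect 2 (reflect 0 (f 0))))) * hI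

lemma act2 (k : Fin 3 → ℝ) (f : Spinor) : biOp k 2 f =
   ![C Complex.I * (X 1 * dunkl k 0 (reflect 0 (reflect 1 (f 0))) - X 0 * dunkl k 1 (reflect 0 (reflect 1 (f 0))))
      + C (1/2) * reflect 0 (reflect 1 (f 0)) + C (k 0 : ℂ) * reflect 1 (f 0) + C (k 1 : ℂ) * reflect 0 (f 0),
     C Complex.I * (X 0 * dunkl k 1 (reflect 0 (reflect 1 (f 1))) - X 1 * dunkl k 0 (reflect 0 (reflect 1 (f 1))))
      + C (1/2) * reflect 0 (reflect 1 (f 1)) + C (k 0 : ℂ) * reflect 1 (f 1) + C (k 1 : ℂ) * reflect 0 (f 1)] := by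
  have e1 : (2 : Fin 3) + 1 = 0 := rfl
  have e2 : (2 : Fin 3) + 2 = 1 := rfl
  ext1 s
  fin_cases s
  · simp [-Complex.coe_smul, biOp, tensorOp, pauli, mulX, MvPolynomial.smul_eq_C_mul, e1, e2]
  · simp [-Complex.coe_smul, biOp, tensorOp, pauli, mulX, MvPolynomial.smul_eq_C_mul, e1, e2]

lemma dirac_apply (k : Fin 3 → ℝ) (f : Spinor) : diracDunkl k f =
   ![dunkl k 0 (f 1) - C Complex.I * dunkl k 1 (f 1) + dunkl k 2 (f 0),
     dunkl k 0 (f 0) + C Complex.I * dunkl k 1 (f 0) - dunkl k 2 (f 1)] := by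
  ext1 s
  fin_cases s <;>
  simp [diracDunkl, tensorOp, pauli, Fin.sum_univ_three, MvPolynomial.smul_eq_C_mul] <;> ring

lemma Csq : (C Complex.I : MvPolynomial (Fin 3) ℂ) * C Complex.I = -1 := by
  rw [← C_mul, Complex.I_mul_I]; simp

lemma refl_C (i : Fin 3) (c : ℂ) : reflect i (C c) = C c := by simp [reflect]

lemma two_half : (2 : MvPolynomial (Fin 3) ℂ) * C (1/2) = 1 := by
  have : (2 : MvPolynomial (Fin 3) ℂ) = C 2 := (map_ofNat C 2).symm
  rw [this, ← C_mul]; simp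

lemma dunkl_X (k : Fin 3 → ℝ) (i : Fin 3) (f : MvPolynomial (Fin 3) ℂ) :
    dunkl k i (X i * f) = X i * dunkl k i f + 2 * C (1/2) * f + 2 * C (k i : ℂ) * reflect i f := by
  have : (2 : MvPolynomial (Fin 3) ℂ) = C 2 := (map_ofNat C 2).symm
  rw [dunkl_X_self, two_half, C_mul, this]; ring

lemma dirac_act0 (k : Fin 3 → ℝ) (f : Spinor) :
    diracDunkl k (biOp k 0 f) = biOp k 0 (diracDunkl k f) := by
  have hI : (C Complex.I : MvPolynomial (Fin 3) ℂ) ^ 2 = -1 := by rw [sq, Csq]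
  simp only [act0, dirac_apply, Matrix.cons_val_zero, Matrix.cons_val_one]
  congr 1
  · simp only [map_add, map_sub, map_neg, map_mul, dunkl_C_mul, dunkl_X,
      dunkl_X_ne, refl_X_self, refl_X_ne, refl_C, dunkl_refl_self, dunkl_refl_ne, refl_refl,
      refl_comm, dunkl_comm, neg_neg, mul_neg, neg_mul, ne_eq, Fin.isValue, Fin.reduceEq, not_false_eq_true]
    ring_nf
    try simp only [hI]
    try ring
  · congr 1
    simp only [map_add, map_sub, map_neg, map_mul, dunkl_C_mul, dunkl_X,
      dunkl_X_ne, refl_X_self, refl_X_ne, refl_C, dunkl_refl_self, dunkl_refl_ne, refl_refl,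
      refl_comm, dunkl_comm, neg_neg, mul_neg, neg_mul, ne_eq, Fin.isValue, Fin.reduceEq, not_false_eq_true]
    ring_nf
    try simp only [hI]
    try ring

lemma dirac_act1 (k : Fin 3 → ℝ) (f : Spinor) :
    diracDunkl k (biOp k 1 f) = biOp k 1 (diracDunkl k f) := by
  have hI : (C Complex.I : MvPolynomial (Fin 3) ℂ) ^ 2 = -1 := by rw [sq, Csq]
  simp only [act1, dirac_apply, Matrix.cons_val_zero, Matrix.cons_val_one]
  congr 1
  · simp only [map_add, map_sub, map_neg, map_mul, dunkl_C_mul, dunkl_X,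
      dunkl_X_ne, refl_X_self, refl_X_ne, refl_C, dunkl_refl_self, dunkl_refl_ne, refl_refl,
      refl_comm, dunkl_comm, neg_neg, mul_neg, neg_mul, ne_eq, Fin.isValue, Fin.reduceEq, not_false_eq_true]
    ring_nf
    try simp only [hI]
    try ring
  · congr 1
    simp only [map_add, map_sub, map_neg, map_mul, dunkl_C_mul, dunkl_X,
      dunkl_X_ne, refl_X_self, refl_X_ne, refl_C, dunkl_refl_self, dunkl_refl_ne, refl_refl,
      refl_comm, dunkl_comm, neg_neg, mul_neg, neg_mul, ne_eq, Fin.isValue, Fin.reduceEq, not_false_eq_true]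
    ring_nf
    try simp only [hI]
    try ring

lemma dirac_act2 (k : Fin 3 → ℝ) (f : Spinor) :
    diracDunkl k (biOp k 2 f) = biOp k 2 (diracDunkl k f) := by
  have hI : (C Complex.I : MvPolynomial (Fin 3) ℂ) ^ 2 = -1 := by rw [sq, Csq]
  simp only [act2, dirac_apply, Matrix.cons_val_zero, Matrix.cons_val_one]
  congr 1
  · simp only [map_add, map_sub, map_neg, map_mul, dunkl_C_mul, dunkl_X,
      dunkl_X_ne, refl_X_self, refl_X_ne, refl_C, dunkl_refl_self, dunkl_refl_ne, refl_refl,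
      refl_comm, dunkl_comm, neg_neg, mul_neg, neg_mul, ne_eq, Fin.isValue, Fin.reduceEq, not_false_eq_true]
    ring_nf
    try simp only [hI]
    try ring
  · congr 1
    simp only [map_add, map_sub, map_neg, map_mul, dunkl_C_mul, dunkl_X,
      dunkl_X_ne, refl_X_self, refl_X_ne, refl_C, dunkl_refl_self, dunkl_refl_ne, refl_refl,
      refl_comm, dunkl_comm, neg_neg, mul_neg, neg_mul, ne_eq, Fin.isValue, Fin.reduceEq, not_false_eq_true]
    ring_nf
    try simp only [hI]
    try ring

lemma fin3_cases (i : Fin 3) : i = 0 ∨ i = 1 ∨ i = 2 := by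
  revert i; decide

lemma dirac_act (k : Fin 3 → ℝ) (i : Fin 3) (f : Spinor) :
    diracDunkl k (biOp k i f) = biOp k i (diracDunkl k f) := by
  rcases fin3_cases i with rfl | rfl | rfl
  · exact dirac_act0 k f
  · exact dirac_act1 k f
  · exact dirac_act2 k f

/-- The operator `∑ x_i T_i + ∑ k_i R_i + 1`. -/
def angular (k : Fin 3 → ℝ) (p : MvPolynomial (Fin 3) ℂ) : MvPolynomial (Fin 3) ℂ :=
  X 0 * dunkl k 0 p + X 1 * dunkl k 1 p + X 2 * dunkl k 2 p
    + C (k 0 : ℂ) * reflect 0 p + C (k 1 : ℂ) * reflect 1 p + C (k 2 : ℂ) * reflect 2 p + 2 * C (1/2) * p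

lemma anticomm0 (k : Fin 3 → ℝ) (f g : Spinor) (hg : diracDunkl k f = g) :
    biOp k 0 (biOp k 1 f) + biOp k 1 (biOp k 0 f) - (fun s => 2 * C (1/2) * biOp k 2 f s) =
      ![2 * C (k 0 : ℂ) * C (k 1 : ℂ) * f 0 + 2 * C (k 2 : ℂ) * reflect 0 (reflect 1 (reflect 2
          (angular k (f 0) - (X 0 * g 1 - C Complex.I * (X 1 * g 1) + X 2 * g 0)))),
        2 * C (k 0 : ℂ) * C (k 1 : ℂ) * f 1 + 2 * C (k 2 : ℂ) * reflect 0 (reflect 1 (reflect 2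
          (angular k (f 1) - (X 0 * g 0 + C Complex.I * (X 1 * g 0) - X 2 * g 1))))] := by
  have hI : (C Complex.I : MvPolynomial (Fin 3) ℂ) ^ 2 = -1 := by rw [sq, Csq]
  subst hg
  ext1 s
  fin_cases s
  · simp only [act0, act1, act2, dirac_apply, Matrix.cons_val_zero, Matrix.cons_val_one,
      Pi.add_apply, Pi.sub_apply, angular, Fin.zero_eta, Fin.mk_one]
    simp only [map_add, map_sub, map_neg, map_mul, dunkl_C_mul, dunkl_X,
      dunkl_X_ne, refl_X_self, refl_X_ne, refl_C, dunkl_refl_self, dunkl_refl_ne, refl_refl,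
      refl_comm, dunkl_comm, neg_neg, mul_neg, neg_mul, ne_eq, Fin.isValue, Fin.reduceEq, not_false_eq_true, map_ofNat]
    ring_nf
    try simp only [hI]
    try ring
  · simp only [act0, act1, act2, dirac_apply, Matrix.cons_val_zero, Matrix.cons_val_one,
      Pi.add_apply, Pi.sub_apply, angular, Fin.zero_eta, Fin.mk_one]
    simp only [map_add, map_sub, map_neg, map_mul, dunkl_C_mul, dunkl_X,
      dunkl_X_ne, refl_X_self, refl_X_ne, refl_C, dunkl_refl_self, dunkl_refl_ne, refl_refl,
      refl_comm, dunkl_comm, neg_neg, mul_neg, neg_mul, ne_eq, Fin.isValue, Fin.reduceEq, not_false_eq_true, map_ofNat]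
    ring_nf
    try simp only [hI]
    try ring

lemma anticomm1 (k : Fin 3 → ℝ) (f g : Spinor) (hg : diracDunkl k f = g) :
    biOp k 1 (biOp k 2 f) + biOp k 2 (biOp k 1 f) - (fun s => 2 * C (1/2) * biOp k 0 f s) =
      ![2 * C (k 1 : ℂ) * C (k 2 : ℂ) * f 0 + 2 * C (k 0 : ℂ) * reflect 0 (reflect 1 (reflect 2
          (angular k (f 0) - (X 0 * g 1 - C Complex.I * (X 1 * g 1) + X 2 * g 0)))),
        2 * C (k 1 : ℂ) * C (k 2 : ℂ) * f 1 + 2 * C (k 0 : ℂ) * reflect 0 (reflect 1 (reflect 2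
          (angular k (f 1) - (X 0 * g 0 + C Complex.I * (X 1 * g 0) - X 2 * g 1))))] := by
  have hI : (C Complex.I : MvPolynomial (Fin 3) ℂ) ^ 2 = -1 := by rw [sq, Csq]
  subst hg
  ext1 s
  fin_cases s
  · simp only [act0, act1, act2, dirac_apply, Matrix.cons_val_zero, Matrix.cons_val_one,
      Pi.add_apply, Pi.sub_apply, angular, Fin.zero_eta, Fin.mk_one]
    simp only [map_add, map_sub, map_neg, map_mul, dunkl_C_mul, dunkl_X,
      dunkl_X_ne, refl_X_self, refl_X_ne, refl_C, dunkl_refl_self, dunkl_refl_ne, refl_refl,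
      refl_comm, dunkl_comm, neg_neg, mul_neg, neg_mul, ne_eq, Fin.isValue, Fin.reduceEq, not_false_eq_true, map_ofNat]
    ring_nf
    try simp only [hI]
    try ring
  · simp only [act0, act1, act2, dirac_apply, Matrix.cons_val_zero, Matrix.cons_val_one,
      Pi.add_apply, Pi.sub_apply, angular, Fin.zero_eta, Fin.mk_one]
    simp only [map_add, map_sub, map_neg, map_mul, dunkl_C_mul, dunkl_X,
      dunkl_X_ne, refl_X_self, refl_X_ne, refl_C, dunkl_refl_self, dunkl_refl_ne, refl_refl,
      refl_comm, dunkl_comm, neg_neg, mul_neg, neg_mul, ne_eq, Fin.isValue, Fin.reduceEq, not_false_eq_true, map_ofNat]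
    ring_nf
    try simp only [hI]
    try ring

lemma anticomm2 (k : Fin 3 → ℝ) (f g : Spinor) (hg : diracDunkl k f = g) :
    biOp k 2 (biOp k 0 f) + biOp k 0 (biOp k 2 f) - (fun s => 2 * C (1/2) * biOp k 1 f s) =
      ![2 * C (k 2 : ℂ) * C (k 0 : ℂ) * f 0 + 2 * C (k 1 : ℂ) * reflect 0 (reflect 1 (reflect 2
          (angular k (f 0) - (X 0 * g 1 - C Complex.I * (X 1 * g 1) + X 2 * g 0)))),
        2 * C (k 2 : ℂ) * C (k 0 : ℂ) * f 1 + 2 * C (k 1 : ℂ) * reflect 0 (reflect 1 (reflect 2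
          (angular k (f 1) - (X 0 * g 0 + C Complex.I * (X 1 * g 0) - X 2 * g 1))))] := by
  have hI : (C Complex.I : MvPolynomial (Fin 3) ℂ) ^ 2 = -1 := by rw [sq, Csq]
  subst hg
  ext1 s
  fin_cases s
  · simp only [act0, act1, act2, dirac_apply, Matrix.cons_val_zero, Matrix.cons_val_one,
      Pi.add_apply, Pi.sub_apply, angular, Fin.zero_eta, Fin.mk_one]
    simp only [map_add, map_sub, map_neg, map_mul, dunkl_C_mul, dunkl_X,
      dunkl_X_ne, refl_X_self, refl_X_ne, refl_C, dunkl_refl_self, dunkl_refl_ne, refl_refl,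
      refl_comm, dunkl_comm, neg_neg, mul_neg, neg_mul, ne_eq, Fin.isValue, Fin.reduceEq, not_false_eq_true, map_ofNat]
    ring_nf
    try simp only [hI]
    try ring
  · simp only [act0, act1, act2, dirac_apply, Matrix.cons_val_zero, Matrix.cons_val_one,
      Pi.add_apply, Pi.sub_apply, angular, Fin.zero_eta, Fin.mk_one]
    simp only [map_add, map_sub, map_neg, map_mul, dunkl_C_mul, dunkl_X,
      dunkl_X_ne, refl_X_self, refl_X_ne, refl_C, dunkl_refl_self, dunkl_refl_ne, refl_refl,
      refl_comm, dunkl_comm, neg_neg, mul_neg, neg_mul, ne_eq, Fin.isValue, Fin.reduceEq, not_false_eq_true, map_ofNat]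
    ring_nf
    try simp only [hI]
    try ring

/-- `{x_i, x_{i+1}} - x_{i+2}`, indices modulo 3. For `x = (X, Y, Z)` these are `κ = {X,Y} - Z`,
`λ = {Y,Z} - X` and `μ = {Z,X} - Y`. -/
def anticommDiff {A : Type*} [Ring A] (x : Fin 3 → A) (i : Fin 3) : A :=
  x i * x (i + 1) + x (i + 1) * x i - x (i + 2)

/-- The defining relations: each `{x_i, x_{i+1}} - x_{i+2}` commutes with each generator. -/
def BIRel (x y : FreeAlgebra ℂ (Fin 3)) : Prop :=
  ∃ i j : Fin 3, x = anticommDiff (FreeAlgebra.ι ℂ) i * FreeAlgebra.ι ℂ j ∧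
    y = FreeAlgebra.ι ℂ j * anticommDiff (FreeAlgebra.ι ℂ) i

/-- The universal Bannai-Ito algebra over `ℂ`. -/
def BI : Type := RingQuot BIRel

/-- The ring structure of the universal Bannai-Ito algebra. -/
def BI.ring : Ring BI := RingQuot.instRing BIRel

instance : Ring BI := BI.ring

/-- The `ℂ`-algebra structure of the universal Bannai-Ito algebra. -/
def BI.algebra : Algebra ℂ BI := RingQuot.instAlgebra BIRel

instance : Algebra ℂ BI := BI.algebra

/-- The quotient map from the free algebra. -/
def BI.mk : FreeAlgebra ℂ (Fin 3) →ₐ[ℂ] BI := RingQuot.mkAlgHom ℂ BIRel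

/-- The generators `X, Y, Z` (for `i = 0, 1, 2`). -/
def gen (i : Fin 3) : BI := BI.mk (FreeAlgebra.ι ℂ i)

/-- The universal property of the universal Bannai-Ito algebra. -/
def BI.lift {A : Type*} [Ring A] [Algebra ℂ A] (x : Fin 3 → A)
    (h : ∀ i j, Commute (anticommDiff x i) (x j)) : BI →ₐ[ℂ] A :=
  RingQuot.liftAlgHom ℂ (s := BIRel) ⟨FreeAlgebra.lift ℂ x, by
    rintro _ _ ⟨i, j, rfl, rfl⟩
    simpa [anticommDiff] using (h i j).eq⟩

lemma BI.lift_gen {A : Type*} [Ring A] [Algebra ℂ A] (x : Fin 3 → A)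
    (h : ∀ i j, Commute (anticommDiff x i) (x j)) (i : Fin 3) : BI.lift x h (gen i) = x i := by
  refine (RingQuot.liftAlgHom_mkAlgHom_apply ℂ (FreeAlgebra.lift ℂ x) _ _).trans ?_
  simp

lemma gen_central (i j : Fin 3) : Commute (anticommDiff gen i) (gen j) := by
  have h : BI.mk (anticommDiff (FreeAlgebra.ι ℂ) i * FreeAlgebra.ι ℂ j)
      = BI.mk (FreeAlgebra.ι ℂ j * anticommDiff (FreeAlgebra.ι ℂ) i) :=
    RingQuot.mkAlgHom_rel ℂ (s := BIRel) ⟨i, j, rfl, rfl⟩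
  rw [map_mul, map_mul] at h
  have e : BI.mk (anticommDiff (FreeAlgebra.ι ℂ) i) = anticommDiff gen i := by
    simp [anticommDiff, gen]
  rw [e] at h
  exact h

lemma BI.mk_surjective : Function.Surjective BI.mk := RingQuot.mkAlgHom_surjective ℂ BIRel

lemma BI.induction {P : BI → Prop} (hs : ∀ c : ℂ, P (algebraMap ℂ BI c)) (hg : ∀ i, P (gen i))
    (ha : ∀ x y, P x → P y → P (x + y)) (hm : ∀ x y, P x → P y → P (x * y)) (x : BI) : P x := by
  obtain ⟨y, rfl⟩ := BI.mk_surjective x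
  induction y using FreeAlgebra.induction with
  | grade0 r => rw [AlgHom.commutes]; exact hs r
  | grade1 i => exact hg i
  | mul a b h1 h2 => rw [map_mul]; exact hm _ _ h1 h2
  | add a b h1 h2 => rw [map_add]; exact ha _ _ h1 h2

lemma BI.hom_ext {A : Type*} [Ring A] [Algebra ℂ A] {f g : BI →ₐ[ℂ] A}
    (h : ∀ i, f (gen i) = g (gen i)) : f = g := by
  apply AlgHom.ext
  intro x
  induction x using BI.induction with
  | hs c => rw [AlgHom.commutes, AlgHom.commutes]
  | hg i => exact h i
  | ha x y hx hy => rw [map_add, map_add, hx, hy]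
  | hm x y hx hy => rw [map_mul, map_mul, hx, hy]

/-- The signs by which `g ∈ {±1}²` acts on `X, Y, Z`: `(1,-1)` fixes `X` and negates `Y, Z`, and `(-1,1)`
fixes `Y` and negates `X, Z`. -/
def signOf (g : ℤˣ × ℤˣ) (i : Fin 3) : ℤˣ := (![g.1, g.2, g.1 * g.2] : Fin 3 → ℤˣ) i

lemma gen_central' (a b c : Fin 3) (hab : a ≠ b) (hbc : b ≠ c) (hac : a ≠ c) (j : Fin 3) :
    Commute (gen a * gen b + gen b * gen a - gen c) (gen j) := by
  have h : (b = a + 1 ∧ c = a + 2) ∨ (a = b + 1 ∧ c = b + 2) := by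
    revert a b c; decide
  rcases h with ⟨rfl, rfl⟩ | ⟨rfl, rfl⟩
  · exact gen_central a j
  · rw [add_comm (gen _ * gen _)]; exact gen_central b j

lemma sgn_mul_sgn (g : ℤˣ × ℤˣ) (a b c : Fin 3) (hab : a ≠ b) (hbc : b ≠ c) (hac : a ≠ c) :
    signOf g a * signOf g b = signOf g c := by
  obtain ⟨u, v⟩ := g
  revert a b c
  rcases Int.units_eq_one_or u with rfl | rfl <;>
  rcases Int.units_eq_one_or v with rfl | rfl <;> decide

/-- The endomorphism `x_i ↦ g (x_{σ(i)}) = ± x_{σ(i)}`. -/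
def twistHom (g : ℤˣ × ℤˣ) (σ : Equiv.Perm (Fin 3)) : BI →ₐ[ℂ] BI :=
  BI.lift (fun i => ((signOf g (σ i) : ℤ) : ℂ) • gen (σ i)) (by
    intro i j
    have key : anticommDiff (fun i => ((signOf g (σ i) : ℤ) : ℂ) • gen (σ i)) i =
        ((signOf g (σ (i + 2)) : ℤ) : ℂ) • (gen (σ i) * gen (σ (i + 1)) + gen (σ (i + 1)) * gen (σ i)
          - gen (σ (i + 2))) := by
      have e := sgn_mul_sgn g (σ i) (σ (i + 1)) (σ (i + 2)) (by simp) (by simp) (by simp)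
      have e' := sgn_mul_sgn g (σ (i + 1)) (σ i) (σ (i + 2)) (by simp) (by simp) (by simp)
      simp only [anticommDiff, smul_mul_smul_comm, smul_sub, smul_add, ← Int.cast_mul, ← Units.val_mul,
        e, e']
    rw [key]
    exact ((gen_central' _ _ _ (by simp) (by simp) (by simp) _).smul_left _).smul_right _)

lemma twistHom_gen (g : ℤˣ × ℤˣ) (σ : Equiv.Perm (Fin 3)) (i : Fin 3) :
    twistHom g σ (gen i) = ((signOf g (σ i) : ℤ) : ℂ) • gen (σ i) := BI.lift_gen _ _ _

lemma twistHom_comp (g : ℤˣ × ℤˣ) (σ : Equiv.Perm (Fin 3)) :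
    (twistHom g σ).comp (twistHom (signOf g (σ 0), signOf g (σ 1)) σ⁻¹) = AlgHom.id ℂ BI ∧
    (twistHom (signOf g (σ 0), signOf g (σ 1)) σ⁻¹).comp (twistHom g σ) = AlgHom.id ℂ BI := by
  have key : ∀ i, signOf (signOf g (σ 0), signOf g (σ 1)) i = signOf g (σ i) := by
    obtain ⟨u, v⟩ := g
    revert σ
    rcases Int.units_eq_one_or u with rfl | rfl <;>
    rcases Int.units_eq_one_or v with rfl | rfl <;> decide
  have h1 : ∀ u : ℤˣ, ((u : ℤ) : ℂ) * ((u : ℤ) : ℂ) = 1 := by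
    intro u
    rcases Int.units_eq_one_or u with rfl | rfl <;> simp
  have e1 : ∀ i, σ (σ⁻¹ i) = i := fun i => σ.apply_symm_apply i
  have e2 : ∀ i, σ⁻¹ (σ i) = i := fun i => σ.symm_apply_apply i
  constructor <;>
  · apply BI.hom_ext
    intro i
    simp only [AlgHom.comp_apply, twistHom_gen, map_smul, smul_smul, key, AlgHom.id_apply, e1, e2,
      h1, one_smul]

/-- The automorphism by which `(g, σ) ∈ {±1}² ⋊ 𝔖₃` acts: first permute the generators, `x_i ↦ x_{σ(i)}`,
then apply the sign change `g`. -/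
def twistAut (g : ℤˣ × ℤˣ) (σ : Equiv.Perm (Fin 3)) : BI ≃ₐ[ℂ] BI :=
  AlgEquiv.ofAlgHom (twistHom g σ) (twistHom (signOf g (σ 0), signOf g (σ 1)) σ⁻¹)
    (twistHom_comp g σ).1 (twistHom_comp g σ).2

/-- The twisted module `V^ε`: the same space, with `x` acting as `ε(x)`. -/
def Twist (_ε : BI ≃ₐ[ℂ] BI) (V : Type*) : Type _ := V

instance (ε : BI ≃ₐ[ℂ] BI) (V : Type*) [AddCommGroup V] : AddCommGroup (Twist ε V) :=
  (inferInstance : AddCommGroup V)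

instance (ε : BI ≃ₐ[ℂ] BI) (V : Type*) [AddCommGroup V] [Module BI V] : Module BI (Twist ε V) :=
  Module.compHom V (ε : BI →+* BI)

lemma Twist.smul_def (ε : BI ≃ₐ[ℂ] BI) (V : Type*) [AddCommGroup V] [Module BI V] (x : BI)
    (v : Twist ε V) : x • v = (show Twist ε V from ((ε x • (show V from v) : V))) := rfl

/-- `θ_i = (-1)^i (2a - d + 2i) / 2`. -/
def theta (d : ℕ) (a : ℂ) (i : ℕ) : ℂ := (-1) ^ i * (2 * a - d + 2 * i) / 2

/-- The numbers `φ_i` in the upper diagonal of `Y` on `O_d(a,b,c)`. -/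
def phi (d : ℕ) (a b c : ℂ) (i : ℕ) : ℂ :=
  if Even i then i * (d + 1 - 2 * i - 2 * a - 2 * b - 2 * c) / 2
  else (i - d - 1) * (d + 1 - 2 * i - 2 * a - 2 * b + 2 * c) / 2

/-- `X` on `O_d(a,b,c)`: diagonal `θ_0, …, θ_d` and ones below the diagonal. -/
def oX (d : ℕ) (a : ℂ) : Matrix (Fin (d + 1)) (Fin (d + 1)) ℂ :=
  Matrix.of fun i j => if i = j then theta d a i else if (i : ℕ) = j + 1 then 1 else 0

/-- `Y` on `O_d(a,b,c)`: diagonal `θ*_0, …, θ*_d` (`b` in place of `a`) and `φ_1, …, φ_d` above it. -/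
def oY (d : ℕ) (a b c : ℂ) : Matrix (Fin (d + 1)) (Fin (d + 1)) ℂ :=
  Matrix.of fun i j => if i = j then theta d b i else if (j : ℕ) = i + 1 then phi d a b c j else 0

/-- `Z` on `O_d(a,b,c)`, forced by `κ = {X,Y} - Z` acting as the scalar `2ab - c(d+1)`. -/
def oZ (d : ℕ) (a b c : ℂ) : Matrix (Fin (d + 1)) (Fin (d + 1)) ℂ :=
  oX d a * oY d a b c + oY d a b c * oX d a - (2 * a * b - c * (d + 1)) • 1

/-- The formula for `X`, on functions on `ℤ`. -/
def zX (d : ℕ) (a : ℂ) (v : ℤ → ℂ) (i : ℤ) : ℂ :=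
  (-1) ^ i * (2 * a - d + 2 * i) / 2 * v i + v (i - 1)

/-- The formula for `φ_i`, for integers `i`. -/
def zphi (d : ℕ) (a b c : ℂ) (i : ℤ) : ℂ :=
  if Even i then i * (d + 1 - 2 * i - 2 * a - 2 * b - 2 * c) / 2
  else (i - d - 1) * (d + 1 - 2 * i - 2 * a - 2 * b + 2 * c) / 2

/-- The formula for `Y`, on functions on `ℤ`. -/
def zY (d : ℕ) (a b c : ℂ) (v : ℤ → ℂ) (i : ℤ) : ℂ :=
  (-1) ^ i * (2 * b - d + 2 * i) / 2 * v i + zphi d a b c (i + 1) * v (i + 1)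

/-- The formula for `Z`, on functions on `ℤ`. -/
def zZ (d : ℕ) (a b c : ℂ) (v : ℤ → ℂ) (i : ℤ) : ℂ :=
  zX d a (zY d a b c v) i + zY d a b c (zX d a v) i - (2 * a * b - c * (d + 1)) * v i

lemma z_rel (d : ℕ) (a b c : ℂ) (v : ℤ → ℂ) (i : ℤ) :
    zY d a b c (zZ d a b c v) i + zZ d a b c (zY d a b c v) i - zX d a v i =
      (2 * b * c - a * (d + 1)) * v i ∧
    zZ d a b c (zX d a v) i + zX d a (zZ d a b c v) i - zY d a b c v i =
      (2 * c * a - b * (d + 1)) * v i := by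
  have e1 : i - 1 + 1 = i := by ring
  have e2 : i + 1 - 1 = i := by ring
  have e3 : i - 1 - 1 = i - 2 := by ring
  have e4 : i + 1 + 1 = i + 2 := by ring
  have e5 : i - 2 + 1 = i - 1 := by ring
  have e6 : i + 2 - 1 = i + 1 := by ring
  rcases Int.even_or_odd i with h | h
  · have h1 : Odd (i + 1) := h.add_one
    have h2 : Odd (i - 1) := (by grind)
    have h3 : Even (i + 2) := by grind
    have h4 : Even (i - 2) := by grind
    constructor <;>
    · simp only [zZ, zX, zY, zphi, e1, e2, e3, e4, e5, e6, h.neg_one_zpow, h1.neg_one_zpow, h2.neg_one_zpow,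
        h3.neg_one_zpow, h4.neg_one_zpow, Int.not_even_iff_odd.2 h1, Int.not_even_iff_odd.2 h2, h, h3, h4,
        if_true, if_false]
      push_cast
      ring
  · have h1 : Even (i + 1) := h.add_one
    have h2 : Even (i - 1) := by grind
    have h3 : Odd (i + 2) := by grind
    have h4 : Odd (i - 2) := by grind
    constructor <;>
    · simp only [zZ, zX, zY, zphi, e1, e2, e3, e4, e5, e6, h.neg_one_zpow, h1.neg_one_zpow, h2.neg_one_zpow,
        h3.neg_one_zpow, h4.neg_one_zpow, Int.not_even_iff_odd.2 h3, Int.not_even_iff_odd.2 h4,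
        Int.not_even_iff_odd.2 h, h1, h2,
        if_true, if_false]
      push_cast
      ring

/-- Restriction of functions on `ℤ` to `{0, …, d}`. -/
def res (d : ℕ) (v : ℤ → ℂ) : Fin (d + 1) → ℂ := fun i => v (i : ℕ)

lemma res_zX (d : ℕ) (a : ℂ) (v : ℤ → ℂ) (hv : ∀ n < 0, v n = 0) :
    res d (zX d a v) = (oX d a).mulVec (res d v) ∧ ∀ n < 0, zX d a v n = 0 := by
  refine ⟨?_, fun n hn => by simp [zX, hv n hn, hv (n - 1) (by omega)]⟩
  funext i
  have hs : ∀ j, oX d a i j * res d v j = (if i = j then theta d a i * v (i : ℕ) else 0)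
      + (if (i : ℕ) = j + 1 then v ((i : ℕ) - 1) else 0) := by
    intro j
    simp only [oX, Matrix.of_apply, res]
    split_ifs with h1 h2 h2
    · subst h1; omega
    · subst h1; simp
    · rw [h2]; simp
    · simp
  simp only [Matrix.mulVec, dotProduct, hs, Finset.sum_add_distrib, Finset.sum_ite_eq,
    Finset.mem_univ, if_true]
  simp only [res, zX, theta, zpow_natCast, Int.cast_natCast]
  congr 1
  rcases Nat.eq_zero_or_pos (i : ℕ) with h | h
  · rw [Finset.sum_eq_zero, h]
    · exact hv _ (by simp)
    · intro j _; rw [if_neg (by omega)]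
  · rw [Finset.sum_eq_single (⟨i - 1, by omega⟩ : Fin (d + 1))]
    · rw [if_pos (by simp; omega)]
    · intro j _ hj
      rw [if_neg]
      intro h'
      apply hj
      ext
      simp; omega
    · simp

lemma zphi_natCast (d : ℕ) (a b c : ℂ) (n : ℕ) : zphi d a b c n = phi d a b c n := by
  simp [zphi, phi, Int.even_coe_nat]

lemma res_zY (d : ℕ) (hd : Even d) (a b c : ℂ) (v : ℤ → ℂ) (hv : ∀ n < 0, v n = 0) :
    res d (zY d a b c v) = (oY d a b c).mulVec (res d v) ∧ ∀ n < 0, zY d a b c v n = 0 := by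
  refine ⟨?_, fun n hn => ?_⟩
  · funext i
    have hs : ∀ j, oY d a b c i j * res d v j = (if i = j then theta d b i * v (i : ℕ) else 0)
        + (if (j : ℕ) = i + 1 then phi d a b c (i + 1) * v ((i : ℕ) + 1) else 0) := by
      intro j
      simp only [oY, Matrix.of_apply, res]
      split_ifs with h1 h2 h2
      · subst h1; omega
      · subst h1; simp
      · rw [h2]; simp
      · simp
    simp only [Matrix.mulVec, dotProduct, hs, Finset.sum_add_distrib, Finset.sum_ite_eq,
      Finset.mem_univ, if_true]
    simp only [res, zY, theta, zpow_natCast, Int.cast_natCast]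
    congr 1
    have : ((i : ℕ) : ℤ) + 1 = ((i + 1 : ℕ) : ℤ) := by push_cast; rfl
    rw [this, zphi_natCast]
    rcases Nat.lt_or_ge (i : ℕ) d with h | h
    · rw [Finset.sum_eq_single (⟨i + 1, by omega⟩ : Fin (d + 1))]
      · simp
      · intro j _ hj
        rw [if_neg]
        intro h'
        apply hj
        ext
        simpa using h'
      · simp
    · have hi : (i : ℕ) = d := by omega
      rw [Finset.sum_eq_zero]
      · have : ¬ Even (d + 1) := by grind
        rw [hi, phi, if_neg this]
        push_cast; ring
      · intro j _; rw [if_neg (by omega)]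
  · rcases eq_or_ne n (-1) with rfl | h
    · simp [zY, hv (-1) (by norm_num), zphi]
    · simp [zY, hv n hn, hv (n + 1) (by omega)]

lemma res_zZ (d : ℕ) (hd : Even d) (a b c : ℂ) (v : ℤ → ℂ) (hv : ∀ n < 0, v n = 0) :
    res d (zZ d a b c v) = (oZ d a b c).mulVec (res d v) ∧ ∀ n < 0, zZ d a b c v n = 0 := by
  have hX := res_zX d a v hv
  have hY := res_zY d hd a b c v hv
  have hXY := res_zX d a _ hY.2
  have hYX := res_zY d hd a b c _ hX.2
  refine ⟨?_, fun n hn => by simp [zZ, hv n hn, hXY.2 n hn, hYX.2 n hn]⟩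
  rw [oZ, Matrix.sub_mulVec, Matrix.add_mulVec, ← Matrix.mulVec_mulVec, ← Matrix.mulVec_mulVec,
    ← hX.1, ← hY.1, ← hXY.1, ← hYX.1, Matrix.smul_mulVec, Matrix.one_mulVec]
  rfl

lemma o_rel (d : ℕ) (hd : Even d) (a b c : ℂ) :
    oY d a b c * oZ d a b c + oZ d a b c * oY d a b c - oX d a
      = (2 * b * c - a * (d + 1)) • (1 : Matrix (Fin (d + 1)) (Fin (d + 1)) ℂ) ∧
    oZ d a b c * oX d a + oX d a * oZ d a b c - oY d a b c
      = (2 * c * a - b * (d + 1)) • (1 : Matrix (Fin (d + 1)) (Fin (d + 1)) ℂ) := by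
  have hr : ∀ w : Fin (d + 1) → ℂ, ∃ v : ℤ → ℂ, (∀ n < 0, v n = 0) ∧ res d v = w := by
    intro w
    refine ⟨fun n => if h : 0 ≤ n ∧ n.toNat < d + 1 then w ⟨n.toNat, h.2⟩ else 0, ?_, ?_⟩
    · intro n hn
      exact dif_neg (by omega)
    · funext i
      simp [res, i.is_le]
  constructor
  · apply Matrix.ext_of_mulVec_single
    intro i
    obtain ⟨v, hv, hw⟩ := hr (Pi.single i 1)
    have hX := res_zX d a v hv
    have hY := res_zY d hd a b c v hv
    have hZ := res_zZ d hd a b c v hv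
    have hYZ := res_zY d hd a b c _ hZ.2
    have hZY := res_zZ d hd a b c _ hY.2
    rw [← hw, Matrix.sub_mulVec, Matrix.add_mulVec, ← Matrix.mulVec_mulVec, ← Matrix.mulVec_mulVec,
      ← hZ.1, ← hY.1, ← hX.1, ← hYZ.1, ← hZY.1, Matrix.smul_mulVec, Matrix.one_mulVec]
    funext j
    exact (z_rel d a b c v _).1
  · apply Matrix.ext_of_mulVec_single
    intro i
    obtain ⟨v, hv, hw⟩ := hr (Pi.single i 1)
    have hX := res_zX d a v hv
    have hY := res_zY d hd a b c v hv
    have hZ := res_zZ d hd a b c v hv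
    have hXZ := res_zX d a _ hZ.2
    have hZX := res_zZ d hd a b c _ hX.2
    rw [← hw, Matrix.sub_mulVec, Matrix.add_mulVec, ← Matrix.mulVec_mulVec, ← Matrix.mulVec_mulVec,
      ← hZ.1, ← hX.1, ← hY.1, ← hXZ.1, ← hZX.1, Matrix.smul_mulVec, Matrix.one_mulVec]
    funext j
    exact (z_rel d a b c v _).2

/-- The three matrices of `X, Y, Z` on `O_d(a,b,c)`. -/
def oGen (d : ℕ) (a b c : ℂ) : Fin 3 → Matrix (Fin (d + 1)) (Fin (d + 1)) ℂ :=
  ![oX d a, oY d a b c, oZ d a b c]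

lemma oGen_cent (d : ℕ) (hd : Even d) (a b c : ℂ) (i j : Fin 3) :
    Commute (anticommDiff (oGen d a b c) i) (oGen d a b c j) := by
  obtain ⟨x, hx⟩ : ∃ x : ℂ, anticommDiff (oGen d a b c) i = x • 1 := by
    fin_cases i
    · exact ⟨2 * a * b - c * (d + 1), by simp [anticommDiff, oGen, oZ]⟩
    · exact ⟨_, (o_rel d hd a b c).1⟩
    · exact ⟨_, (o_rel d hd a b c).2⟩
  rw [hx]
  exact (Commute.one_left _).smul_left x

/-- The `(d+1)`-dimensional module `O_d(a,b,c)`, for even `d`. -/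
def OMod (d : ℕ) (_hd : Even d) (_a _b _c : ℂ) : Type := Fin (d + 1) → ℂ

namespace OMod
variable (d : ℕ) (hd : Even d) (a b c : ℂ)

instance : AddCommGroup (OMod d hd a b c) := (inferInstance : AddCommGroup (Fin (d + 1) → ℂ))
instance : Module ℂ (OMod d hd a b c) := (inferInstance : Module ℂ (Fin (d + 1) → ℂ))

/-- The representation of the universal Bannai-Ito algebra on `O_d(a,b,c)`. -/
def rep : BI →ₐ[ℂ] Module.End ℂ (OMod d hd a b c) :=
  (Matrix.toLinAlgEquiv' : Matrix (Fin (d + 1)) (Fin (d + 1)) ℂ ≃ₐ[ℂ] _).toAlgHom.comp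
    (BI.lift (oGen d a b c) (oGen_cent d hd a b c))

instance : Module BI (OMod d hd a b c) :=
  Module.compHom _ (rep d hd a b c : BI →+* Module.End ℂ (OMod d hd a b c))

lemma gen_smul (i : Fin 3) (v : OMod d hd a b c) :
    gen i • v = (show OMod d hd a b c from (oGen d a b c i).mulVec (show Fin (d + 1) → ℂ from v)) := by
  exact congrArg (fun A : Matrix (Fin (d + 1)) (Fin (d + 1)) ℂ =>
    A.mulVec (show Fin (d + 1) → ℂ from v)) (BI.lift_gen (oGen d a b c) (oGen_cent d hd a b c) i)

end OMod

lemma mem_homogeneous_iff (p : MvPolynomial (Fin 3) ℂ) (n : ℕ) :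
    p ∈ homogeneousSubmodule (Fin 3) ℂ n ↔ ∀ d, coeff d p ≠ 0 → d 0 + d 1 + d 2 = n := by
  rw [mem_homogeneousSubmodule, IsHomogeneous, IsWeightedHomogeneous]
  refine forall_congr' fun d => imp_congr_right fun _ => ?_
  rw [show Finsupp.weight 1 d = d 0 + d 1 + d 2 by
    simp [Finsupp.weight_apply, Finsupp.sum_fintype, Fin.sum_univ_three]]

lemma tens_mem (N N' : Submodule ℂ (MvPolynomial (Fin 3) ℂ)) (A : Matrix (Fin 2) (Fin 2) ℂ)
    (T : MvPolynomial (Fin 3) ℂ →ₗ[ℂ] MvPolynomial (Fin 3) ℂ) (hT : ∀ p ∈ N, T p ∈ N')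
    (f : Spinor) (hf : ∀ s, f s ∈ N) (s : Fin 2) : tensorOp A T f s ∈ N' := by
  simp only [tensorOp, LinearMap.pi_apply, LinearMap.sum_apply, LinearMap.smul_apply,
    LinearMap.comp_apply, LinearMap.proj_apply]
  exact N'.sum_mem fun r _ => N'.smul_mem _ (hT _ (hf r))

lemma act_mem (k : Fin 3 → ℝ) (N : Submodule ℂ (MvPolynomial (Fin 3) ℂ))
    (hr : ∀ i, ∀ p ∈ N, reflect i p ∈ N) (hd : ∀ i j, j ≠ i → ∀ p ∈ N, X j * dunkl k i p ∈ N)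
    (i : Fin 3) (f : Spinor) (hf : ∀ s, f s ∈ N) (s : Fin 2) : biOp k i f s ∈ N := by
  have h2 : ∀ s, tensorOp 1 ((reflect (i + 1)).toLinearMap ∘ₗ (reflect (i + 2)).toLinearMap) f s ∈ N :=
    tens_mem N N _ _ (fun p hp => hr _ _ (hr _ _ hp)) f hf
  refine N.add_mem (N.add_mem (N.add_mem ?_ (N.smul_mem _ (h2 s))) (N.smul_mem _ ?_))
    (N.smul_mem _ ?_)
  · refine N.smul_mem _ (tens_mem N N _ _ (fun p hp => ?_) _ h2 s)
    exact N.sub_mem (hd _ _ (by simp) _ hp) (hd _ _ (by simp) _ hp)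
  · exact tens_mem N N _ _ (fun p hp => hr _ _ hp) f hf s
  · exact tens_mem N N _ _ (fun p hp => hr _ _ hp) f hf s

lemma refl_coeff_ne {i : Fin 3} {p : MvPolynomial (Fin 3) ℂ} {d : Fin 3 →₀ ℕ}
    (h : coeff d (reflect i p) ≠ 0) : coeff d p ≠ 0 := by
  rw [coeff_refl] at h
  exact right_ne_zero_of_mul h

lemma act_monogenic (k : Fin 3 → ℝ) (n : ℕ) (i : Fin 3) (f : Spinor) (hf : f ∈ monogenic k n) :
    biOp k i f ∈ monogenic k n := by
  refine ⟨act_mem k (homogeneousSubmodule (Fin 3) ℂ n) ?_ ?_ i f hf.1, ?_⟩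
  · intro i p hp
    rw [mem_homogeneous_iff] at hp ⊢
    exact fun d hd => hp d (refl_coeff_ne hd)
  · intro i j hj p hp
    rw [mem_homogeneous_iff] at hp ⊢
    intro d hd
    rw [coeff_X_mul'] at hd
    split_ifs at hd with h
    · rw [coeff_dunkl] at hd
      have := hp _ (right_ne_zero_of_mul hd)
      have h' : d j ≠ 0 := by simpa using h
      revert this h' hj
      fin_cases i <;> fin_cases j <;> simp <;> omega
    · exact absurd rfl hd
  · rw [dirac_act, hf.2, map_zero]

lemma angular_homogeneous (k : Fin 3 → ℝ) (n : ℕ) (p : MvPolynomial (Fin 3) ℂ)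
    (hp : p.IsHomogeneous n) :
    angular k p = C ((k 0 + k 1 + k 2 + n + 1 : ℝ) : ℂ) * p := by
  have he := hp.sum_X_mul_pderiv
  rw [Fin.sum_univ_three, nsmul_eq_mul] at he
  have hn : (n : MvPolynomial (Fin 3) ℂ) = C (n : ℂ) := (map_natCast C n).symm
  rw [hn] at he
  rw [angular, X_mul_dunkl, X_mul_dunkl, X_mul_dunkl, two_half]
  push_cast
  simp only [C_add, C_1]
  linear_combination he

lemma refl_homogeneous (n : ℕ) (p : MvPolynomial (Fin 3) ℂ) (hp : p.IsHomogeneous n) :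
    reflect 0 (reflect 1 (reflect 2 p)) = C ((-1) ^ n) * p := by
  ext d
  rw [coeff_refl, coeff_refl, coeff_refl, coeff_C_mul]
  by_cases h : coeff d p = 0
  · simp [h]
  · rw [← (mem_homogeneous_iff p n).1 hp d h]
    ring

lemma anticomm (k : Fin 3 → ℝ) (n : ℕ) (i : Fin 3) :
    ∃ c : ℂ, ∀ f ∈ monogenic k n,
      biOp k i (biOp k (i + 1) f) + biOp k (i + 1) (biOp k i f) - biOp k (i + 2) f = c • f := by
  refine ⟨2 * (k i * k (i + 1) + (-1) ^ n * ((k 0 + k 1 + k 2 + n + 1 : ℝ) : ℂ) * k (i + 2)),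
    fun f hf => ?_⟩
  have h0 := angular_homogeneous k n _ (hf.1 0)
  have h1 := angular_homogeneous k n _ (hf.1 1)
  have r0 := refl_homogeneous n _ (hf.1 0)
  have r1 := refl_homogeneous n _ (hf.1 1)
  have c2 : (C (2:ℂ) : MvPolynomial (Fin 3) ℂ) = 2 := map_ofNat C 2
  have d1 : (0 : Fin 3) + 1 = 1 := rfl
  have d2 : (0 : Fin 3) + 2 = 2 := rfl
  have e1 : (1 : Fin 3) + 1 = 2 := rfl
  have e2 : (1 : Fin 3) + 2 = 0 := rfl
  have e3 : (2 : Fin 3) + 1 = 0 := rfl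
  have e4 : (2 : Fin 3) + 2 = 1 := rfl
  rcases fin3_cases i with rfl | rfl | rfl
  · have h := anticomm0 k f 0 hf.2
    have hl : (fun s => 2 * C (1/2) * biOp k 2 f s) = biOp k 2 f := by
      funext s
      rw [two_half, one_mul]
    rw [hl] at h
    rw [d1, d2, h]
    simp only [Pi.zero_apply, mul_zero, add_zero, sub_zero, h0, h1, map_mul, refl_C, r0, r1]
    ext1 s
    fin_cases s <;> simp [-Complex.coe_smul, MvPolynomial.smul_eq_C_mul, c2] <;> ring
  · have h := anticomm1 k f 0 hf.2
    have hl : (fun s => 2 * C (1/2) * biOp k 0 f s) = biOp k 0 f := by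
      funext s
      rw [two_half, one_mul]
    rw [hl] at h
    rw [e1, e2, h]
    simp only [Pi.zero_apply, mul_zero, add_zero, sub_zero, h0, h1, map_mul, refl_C, r0, r1]
    ext1 s
    fin_cases s <;> simp [-Complex.coe_smul, MvPolynomial.smul_eq_C_mul, c2] <;> ring
  · have h := anticomm2 k f 0 hf.2
    have hl : (fun s => 2 * C (1/2) * biOp k 1 f s) = biOp k 1 f := by
      funext s
      rw [two_half, one_mul]
    rw [hl] at h
    rw [e3, e4, h]
    simp only [Pi.zero_apply, mul_zero, add_zero, sub_zero, h0, h1, map_mul, refl_C, r0, r1]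
    ext1 s
    fin_cases s <;> simp [-Complex.coe_smul, MvPolynomial.smul_eq_C_mul, c2] <;> ring

/-- The space of Dunkl monogenics of degree `n`, as a type. -/
def Monogenic (k : Fin 3 → ℝ) (n : ℕ) : Type := monogenic k n

namespace Monogenic

variable {k : Fin 3 → ℝ} {n : ℕ}

/-- The additive group of Dunkl monogenics. -/
def addCommGroup : AddCommGroup (Monogenic k n) :=
  (inferInstance : AddCommGroup (monogenic k n))

instance : AddCommGroup (Monogenic k n) := addCommGroup

/-- The complex vector space of Dunkl monogenics. -/
def module : Module ℂ (Monogenic k n) := (inferInstance : Module ℂ (monogenic k n))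

instance : Module ℂ (Monogenic k n) := module

/-- The inclusion of the Dunkl monogenics in the `ℂ²`-valued polynomials. -/
def val : Monogenic k n →ₗ[ℂ] Spinor := (monogenic k n).subtype

lemma val_mem (f : Monogenic k n) : f.val ∈ monogenic k n := f.2

lemma val_injective : Function.Injective (val : Monogenic k n → Spinor) := Subtype.val_injective

end Monogenic

/-- The operators `X, Y, Z` on the Dunkl monogenics. -/
def monoAct (k : Fin 3 → ℝ) (n : ℕ) (i : Fin 3) : Module.End ℂ (Monogenic k n) :=
  (biOp k i).restrict (act_monogenic k n i)

lemma monoAct_val (k : Fin 3 → ℝ) (n : ℕ) (i : Fin 3) (f : Monogenic k n) :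
    (monoAct k n i f).val = biOp k i f.val := rfl

lemma monoAct_cent (k : Fin 3 → ℝ) (n : ℕ) (i j : Fin 3) :
    Commute (anticommDiff (monoAct k n) i) (monoAct k n j) := by
  obtain ⟨c, hc⟩ := anticomm k n i
  have : anticommDiff (monoAct k n) i = c • 1 := by
    refine LinearMap.ext fun f => Monogenic.val_injective ?_
    simp only [anticommDiff, LinearMap.sub_apply, LinearMap.add_apply, Module.End.mul_apply,
      LinearMap.smul_apply, Module.End.one_apply, map_sub, map_add, map_smul, monoAct_val]
    exact hc f.val f.val_mem
  rw [this]
  exact (Commute.one_left _).smul_left c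

/-- The representation of the universal Bannai-Ito algebra on the Dunkl monogenics. -/
def monoRep (k : Fin 3 → ℝ) (n : ℕ) : BI →ₐ[ℂ] Module.End ℂ (Monogenic k n) :=
  BI.lift (monoAct k n) (monoAct_cent k n)

instance (k : Fin 3 → ℝ) (n : ℕ) : Module BI (Monogenic k n) :=
  Module.compHom _ (monoRep k n : BI →+* Module.End ℂ (Monogenic k n))

lemma gen_smul (k : Fin 3 → ℝ) (n : ℕ) (i : Fin 3) (f : Monogenic k n) :
    (gen i • f).val = biOp k i f.val := by
  change (monoRep k n (gen i) f).val = _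
  rw [monoRep, BI.lift_gen]
  rfl

lemma algebraMap_smul' (k : Fin 3 → ℝ) (n : ℕ) (c : ℂ) (f : Monogenic k n) :
    algebraMap ℂ BI c • f = c • f := by
  change monoRep k n (algebraMap ℂ BI c) f = _
  rw [AlgHom.commutes]
  rfl

open Classical in
/-- `t = -2κ` if `2κ` is an odd negative integer, and `t = ∞` otherwise. -/
def tval (κ : ℝ) : ℕ∞ :=
  if ∃ m : ℕ, Odd m ∧ 2 * κ = -(m : ℝ) then ((⌊-(2 * κ)⌋₊ : ℕ) : ℕ∞) else ⊤

lemma tval_eq_coe {κ : ℝ} {t : ℕ} (h : tval κ = t) : Odd t ∧ 2 * κ = -(t : ℝ) := by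
  unfold tval at h
  split_ifs at h with h'
  · obtain ⟨m, hm, he⟩ := h'
    rw [he, neg_neg, Nat.floor_natCast, Nat.cast_inj] at h
    subst h
    exact ⟨hm, he⟩
  · exact absurd h (ENat.top_ne_natCast t)

/-- Polynomials all of whose monomials have exponent at least `t_i` in `x_i` (only `0` if `t_i = ∞`). -/
def highPart (κ : ℝ) (i : Fin 3) : Submodule ℂ (MvPolynomial (Fin 3) ℂ) where
  carrier := {p | ∀ d, coeff d p ≠ 0 → tval κ ≤ (d i : ℕ∞)}
  add_mem' {p q} hp hq d hd := by
    by_cases h : coeff d p = 0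
    · exact hq d (by simpa [h] using hd)
    · exact hp d h
  zero_mem' d hd := by simp at hd
  smul_mem' c p hp d hd := hp d (by
    rw [coeff_smul] at hd
    exact right_ne_zero_of_mul hd)

lemma dunkl_highPart (k : Fin 3 → ℝ) (i j : Fin 3) (p : MvPolynomial (Fin 3) ℂ)
    (hp : p ∈ highPart (k i) i) : dunkl k j p ∈ highPart (k i) i := by
  intro d hd
  rw [coeff_dunkl] at hd
  have h := hp _ (right_ne_zero_of_mul hd)
  by_cases hij : j = i
  · subst hij
    obtain ⟨t, ht⟩ := ENat.ne_top_iff_exists.1 (ne_top_of_le_ne_top (ENat.natCast_ne_top _) h)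
    obtain ⟨ho, he⟩ := tval_eq_coe ht.symm
    rw [← ht, Nat.cast_le] at h ⊢
    simp only [Finsupp.add_apply, Finsupp.single_eq_same] at h
    by_contra hlt
    have hdt : t = d j + 1 := by omega
    have hev : Even (d j) := by subst hdt; grind
    apply left_ne_zero_of_mul hd
    have : (2 * k j : ℂ) = -(d j + 1) := by
      have := congrArg (fun x : ℝ => (x : ℂ)) he
      rw [hdt] at this
      push_cast at this
      exact this
    rw [hev.neg_one_pow]
    linear_combination this
  · simpa [Finsupp.single_apply, hij] using h

/-- The submodule `M_n(x_i)`: the Dunkl monogenics of degree `n` in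
`⨁_{t_i ≤ m ≤ n} ℂ² ⊗ (x_i^m ℝ[the other two variables]_{n-m})`. -/
def monogenicSub (k : Fin 3 → ℝ) (n : ℕ) (i : Fin 3) : Submodule BI (Monogenic k n) where
  carrier := {f | ∀ s, f.val s ∈ highPart (k i) i}
  add_mem' {f g} hf hg s := by
    rw [map_add]
    exact (highPart (k i) i).add_mem (hf s) (hg s)
  zero_mem' s := by
    rw [map_zero]
    exact (highPart (k i) i).zero_mem
  smul_mem' x := by
    induction x using BI.induction with
    | hs c =>
      intro f hf s
      rw [algebraMap_smul', map_smul]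
      exact (highPart (k i) i).smul_mem c (hf s)
    | hg j =>
      intro f hf
      change ∀ s, (gen j • f).val s ∈ _
      rw [gen_smul]
      refine act_mem k _ ?_ ?_ j f.val hf
      · exact fun l p hp d hd => hp d (refl_coeff_ne hd)
      · intro l m _ p hp d hd
        rw [coeff_X_mul'] at hd
        split_ifs at hd with h
        · refine le_trans (dunkl_highPart k i l p hp _ hd) ?_
          exact_mod_cast (Nat.sub_le _ _)
        · exact absurd rfl hd
    | ha x y hx hy =>
      intro f hf
      intro s
      rw [add_smul, map_add]
      exact (highPart (k i) i).add_mem (hx hf s) (hy hf s)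
    | hm x y hx hy =>
      intro f hf
      rw [mul_smul]
      exact hx (hy hf)

lemma even_of_tval {κ : ℝ} {t : ℕ} (h : tval κ = t) : Even (t - 1) := by
  have := (tval_eq_coe h).1
  grind

lemma even_sub {n t t' : ℕ} {κ κ' : ℝ} (hn : Even n) (h : tval κ = t) (h' : tval κ' = t') :
    Even (n - t - t') := by
  have h1 := (tval_eq_coe h).1
  have h2 := (tval_eq_coe h').1
  grind

/-- The twisted module `O_d(a,b,c)^{(g,σ)}`. -/
abbrev TwistedO (g : ℤˣ × ℤˣ) (σ : Equiv.Perm (Fin 3)) (d : ℕ) (hd : Even d) (a b c : ℂ) : Type :=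
  Twist (twistAut g σ) (OMod d hd a b c)

/-- `V` is isomorphic to a direct sum of two copies of `W`. -/
def IsTwoCopies (V W : Type) [AddCommGroup V] [Module BI V] [AddCommGroup W] [Module BI W] : Prop :=
  Nonempty (V ≃ₗ[BI] W × W)

/-- The structure of a module `V` with submodules `N, N'`, up to isomorphism: `N ∩ N'` is two copies of
`A`, both `N / (N ∩ N')` and `V / N'` are two copies of `B`, and both `N' / (N ∩ N')` and `V / N` are two
copies of `C`. -/
def HasStructure {V : Type} [AddCommGroup V] [Module BI V] (N N' : Submodule BI V)
    (A B C : Type) [AddCommGroup A] [Module BI A] [AddCommGroup B] [Module BI B]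
    [AddCommGroup C] [Module BI C] : Prop :=
  IsTwoCopies ↥(N ⊓ N') A ∧
    (IsTwoCopies (↥N ⧸ (N ⊓ N').submoduleOf N) B ∧ IsTwoCopies (V ⧸ N') B) ∧
    (IsTwoCopies (↥N' ⧸ (N ⊓ N').submoduleOf N') C ∧ IsTwoCopies (V ⧸ N) C)

/-- `V` is irreducible and isomorphic to `W`. -/
def IsIrreducibleIso (V W : Type) [AddCommGroup V] [Module BI V] [AddCommGroup W] [Module BI W] :
    Prop :=
  IsSimpleModule BI V ∧ Nonempty (V ≃ₗ[BI] W)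

end BannaiIto

end

open BannaiIto

/-! Structure of the monogenics. Fix `j` so that `x_{j+1}` is the variable with `t_{j+1} > n`. Since
`T_i x_i^p = γ_i(p) x_i^{p-1}`, where for `p ≥ 1` the factor `γ_i(p)` (`gam`) vanishes exactly at `p
= t_i`, the Dirac-Dunkl equation can be solved for the successive powers of `x_{j+1}`. This is a
Cauchy-Kovalevskaya extension: restriction to `x_{j+1} = 0` is a bijection from the monogenics onto
all `ℂ²`-valued homogeneous polynomials of degree `n` in `x_j, x_{j+2}`, and membership in
`M_n(x_j)`, `M_n(x_{j+2})` can be read off the restriction (`exists_monogenic`, `monogenic_eq_zero`,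
`mem_monogenicSub_zero`, `mem_monogenicSub_two`).

On the coefficients of `x_j^{n-c} x_{j+2}^c` the generators `j` and `j + 2` act bidiagonally, in
opposite directions, and the only matrix involved is the Pauli matrix of `j + 1`
(`spinorCoeff_biOp_succ`, `spinorCoeff_biOp_two_succ`). Its two eigenlines split `ℂ²`, which is
where the two copies come from. The zeros `γ_{j+2}(t_{j+2}) = 0` and `γ_j(t_j) = 0` cut the range `0
≤ c ≤ n` into three windows: `c < t_{j+2}` for the quotient by `M_n(x_{j+2})`, `c > n - t_j` for the
quotient by `M_n(x_j)`, and the rest for the intersection. In each window the products of opposite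
off-diagonal entries are, up to sign, the `φ_i` of a twisted `O_d`, so rescaling the coordinates
gives the isomorphism (`isTwoCopies_quotient`). The remaining two quotients follow from the second
isomorphism theorem, since the two submodules span.

Irreducibility and removal of the twist. For the parameters at hand, `X² + Y² + Z²` is a scalar on
`O_d(a,b,c)`, and the ladder operators `X ∓ Z - r` move between eigenvectors of `Y` and do not
vanish where needed. So every nonzero invariant subspace contains `v_0` and is everything
(`IsGeneric.isBITriple`). An irreducible triple of dimension `d + 1` that has an extremal vector for
`X`, and on which `∏ (Y - θ*_i)` vanishes, has a standard basis (`exists_isStandardBasis`). The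
first vector of that basis is extremal for `Y`, so extremal vectors propagate to all operators and
signs (`HasExtremal.all`). Hence each signed permutation of the triple again has a standard basis,
with the permuted parameters (`IsGeneric.isIrreducibleIso`). -/

noncomputable section

namespace BannaiIto

open Polynomial (aeval)

/-! ### The chain generated by an extremal vector -/

section Triples

variable {V : Type*} [AddCommGroup V] [Module ℂ V]

/-- Three operators satisfying the relations of `X, Y, Z` on `O_d(p_0, p_1, p_2)`. -/
structure SatisfiesBI (d : ℕ) (A : Fin 3 → Module.End ℂ V) (p : Fin 3 → ℂ) : Prop where
  rel : ∀ i j l, i ≠ j → j ≠ l → i ≠ l → ∀ v,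
    A i (A j v) + A j (A i v) = A l v + (2 * p i * p j - p l * (d + 1)) • v

/-- Three operators satisfying the relations of `X, Y, Z` on `O_d(p_0, p_1, p_2)` and having no common
nontrivial invariant subspace. -/
structure IsBITriple (d : ℕ) (A : Fin 3 → Module.End ℂ V) (p : Fin 3 → ℂ) : Prop extends
    SatisfiesBI d A p where
  irred : ∀ W : Submodule ℂ V, (∀ i, ∀ w ∈ W, A i w ∈ W) → W = ⊥ ∨ W = ⊤

/-- The number `(-1)^i (b + d/2 - i)`, which is `θ_{d-i}` for even `d`. -/
def revTheta (d : ℕ) (b : ℂ) (i : ℕ) : ℂ := (-1) ^ i * (b + d / 2 - i)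

/-- The polynomial with the roots `θ_0, …, θ_d`. -/
def thetaPoly (d : ℕ) (b : ℂ) : Polynomial ℂ :=
  ∏ i ∈ Finset.range (d + 1), (Polynomial.X - Polynomial.C (revTheta d b i))

/-- The number `φ_{d+1-i}`, for even `d`. -/
def revPhi (d : ℕ) (a b c : ℂ) (i : ℕ) : ℂ :=
  if Even i then i * (d + 1 - 2 * i + 2 * a + 2 * b - 2 * c) / 2
  else (d + 1 - i) * (2 * i - d - 1 - 2 * a - 2 * b - 2 * c) / 2

/-- The sequence `v, (Y - θ_d) v, (Y - θ_{d-1}) (Y - θ_d) v, …`. -/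
def chainVec (d : ℕ) (b : ℂ) (Y : Module.End ℂ V) (v : V) : ℕ → V
  | 0 => v
  | i + 1 => Y (chainVec d b Y v i) - revTheta d b i • chainVec d b Y v i

lemma apply_chainVec (d : ℕ) (b : ℂ) (Y : Module.End ℂ V) (v : V) (i : ℕ) :
    Y (chainVec d b Y v i) = chainVec d b Y v (i + 1) + revTheta d b i • chainVec d b Y v i := by
  rw [chainVec]; abel

lemma chainVec_eq_aeval (d : ℕ) (b : ℂ) (Y : Module.End ℂ V) (v : V) (n : ℕ) :
    chainVec d b Y v n =
      aeval Y (∏ i ∈ Finset.range n, (Polynomial.X - Polynomial.C (revTheta d b i))) v := by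
  induction n with
  | zero => simp [chainVec]
  | succ n ih =>
    rw [Finset.prod_range_succ, mul_comm, map_mul, Module.End.mul_apply, ← ih, chainVec]
    simp [Algebra.algebraMap_eq_smul_one]

/-- The two formulas feed each other. The relation for `{X, Y}` at `u_i` gives `X u_{i+1}` once `Z
u_i` is known, and then the relation for `{Y, Z}` at `u_i` gives `Z u_{i+1}`. The formula for `Z` is
carried only to make the induction run. -/
lemma chainVec_relations {d : ℕ} {A : Fin 3 → Module.End ℂ V} {p : Fin 3 → ℂ} (h : IsBITriple d A p)
    {v : V} (hX : A 0 v = (p 0 + d / 2) • v) (hYZ : A 1 v - A 2 v = (p 1 - p 2) • v) (i : ℕ) :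
    A 0 (chainVec d (p 1) (A 1) v (i + 1)) =
        revTheta d (p 0) (i + 1) • chainVec d (p 1) (A 1) v (i + 1)
          + revPhi d (p 0) (p 1) (p 2) (i + 1) • chainVec d (p 1) (A 1) v i ∧
      A 2 (chainVec d (p 1) (A 1) v (i + 1)) =
        ((-1) ^ (i + 1) : ℂ) • chainVec d (p 1) (A 1) v (i + 2)
          + (2 * revTheta d (p 0) (i + 1) * revTheta d (p 1) (i + 1)
              + revPhi d (p 0) (p 1) (p 2) (i + 1) + revPhi d (p 0) (p 1) (p 2) (i + 2)
              - (2 * p 0 * p 1 - p 2 * (d + 1))) • chainVec d (p 1) (A 1) v (i + 1)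
          - ((-1) ^ (i + 1) * revPhi d (p 0) (p 1) (p 2) (i + 1)) • chainVec d (p 1) (A 1) v i := by
  have r2 := h.rel 0 1 2 (by decide) (by decide) (by decide)
  have r0 := h.rel 1 2 0 (by decide) (by decide) (by decide)
  have hY := apply_chainVec d (p 1) (A 1) v
  set u := chainVec d (p 1) (A 1) v with hu
  induction i with
  | zero =>
    have h0 : u 0 = v := rfl
    rw [← h0] at hX hYZ
    have hY0 := hY 0
    have hZ0 : A 2 (u 0) = u 1 + (revTheta d (p 1) 0 - (p 1 - p 2)) • u 0 := by
      linear_combination (norm := module) hY0 - hYZ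
    have e := r2 (u 0)
    rw [hY 0, hX, map_add, map_smul, map_smul, hX, hZ0, hY 0] at e
    have hX1 : A 0 (u 1) = revTheta d (p 0) 1 • u 1 + revPhi d (p 0) (p 1) (p 2) 1 • u 0 := by
      simp only [revTheta, revPhi, Nat.not_even_one, if_false] at e ⊢
      push_cast at e ⊢
      linear_combination (norm := module) e
    refine ⟨hX1, ?_⟩
    have e := r0 (u 0)
    rw [hZ0, hY 0, hX, map_add, map_smul, map_add, map_smul, hZ0, hY 0, hY 1] at e
    have h2 : Even 2 := by decide
    simp only [revTheta, revPhi, Nat.not_even_one, if_false, zero_add, h2, if_true] at e ⊢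
    push_cast at e ⊢
    linear_combination (norm := module) e
  | succ i ih =>
    obtain ⟨ihX, ihZ⟩ := ih
    have e := r2 (u (i + 1))
    have hX2 : A 0 (u (i + 2)) = revTheta d (p 0) (i + 2) • u (i + 2)
        + revPhi d (p 0) (p 1) (p 2) (i + 2) • u (i + 1) := by
      rw [hY (i + 1), ihX, map_add, map_smul, map_add, map_smul, map_smul, ihX, ihZ, hY i,
        hY (i + 1)] at e
      rcases Nat.even_or_odd i with hi | hi
      · have h1 : ¬ Even (i + 1) := by grind
        have h2 : Even (i + 2) := by grind
        simp only [revTheta, revPhi, h1, h2, if_true, if_false, pow_succ, hi.neg_one_pow] at e ⊢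
        push_cast at e ⊢
        linear_combination (norm := module) e
      · have h1 : Even (i + 1) := by grind
        have h2 : ¬ Even (i + 2) := by grind
        simp only [revTheta, revPhi, h1, h2, if_true, if_false, pow_succ, hi.neg_one_pow] at e ⊢
        push_cast at e ⊢
        linear_combination (norm := module) e
    refine ⟨hX2, ?_⟩
    have e := r0 (u (i + 1))
    rw [ihZ, hY (i + 1), ihX] at e
    simp only [map_add, map_sub, map_smul] at e
    rw [hY (i + 2), hY (i + 1), hY i, ihZ] at e
    rcases Nat.even_or_odd i with hi | hi
    · have h1 : ¬ Even (i + 1) := by grind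
      have h2 : Even (i + 2) := by grind
      have h3 : ¬ Even (i + 3) := by grind
      simp only [revTheta, revPhi, add_assoc, h1, h2, h3, if_true, if_false, pow_succ,
        hi.neg_one_pow, Nat.reduceAdd] at e ⊢
      push_cast at e ⊢
      linear_combination (norm := module) e
    · have h1 : Even (i + 1) := by grind
      have h2 : ¬ Even (i + 2) := by grind
      have h3 : Even (i + 3) := by grind
      simp only [revTheta, revPhi, add_assoc, h1, h2, h3, if_true, if_false, pow_succ,
        hi.neg_one_pow, Nat.reduceAdd] at e ⊢
      push_cast at e ⊢
      linear_combination (norm := module) e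

end Triples

end BannaiIto
end

/-! ### From an extremal vector to a standard basis -/

noncomputable section

namespace BannaiIto

open Polynomial (aeval)

section Triples

variable {V : Type*} [AddCommGroup V] [Module ℂ V]

/-- Invariance under `Z` is automatic, because `Z` is `{X, Y}` minus a scalar. -/
lemma IsBITriple.eq_bot_or_eq_top {d : ℕ} {A : Fin 3 → Module.End ℂ V} {p : Fin 3 → ℂ}
    (h : IsBITriple d A p) (W : Submodule ℂ V) (h0 : ∀ w ∈ W, A 0 w ∈ W) (h1 : ∀ w ∈ W, A 1 w ∈ W) :
    W = ⊥ ∨ W = ⊤ := by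
  refine h.irred W fun i w hw => ?_
  rcases fin3_cases i with rfl | rfl | rfl
  · exact h0 w hw
  · exact h1 w hw
  · rw [eq_sub_of_add_eq (h.rel 0 1 2 (by decide) (by decide) (by decide) w).symm]
    exact W.sub_mem (W.add_mem (h0 _ (h1 _ hw)) (h1 _ (h0 _ hw))) (W.smul_mem _ hw)

/-- There is a common `s`-extremal vector for the operator `A_i`. On `O_d(a,b,c)`, the vector `v_d` is
`1`-extremal for `X`, and `v_0` is `-1`-extremal for `Y`. -/
def HasExtremal (d : ℕ) (A : Fin 3 → Module.End ℂ V) (p : Fin 3 → ℂ) (i : Fin 3) (s : ℤˣ) : Prop :=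
  ∃ v ≠ 0, A i v = (p i + (s : ℤ) * d / 2) • v ∧ ∀ j l, i ≠ j → j ≠ l → i ≠ l →
    A j v - ((s : ℤ) : ℂ) • A l v = (p j - (s : ℤ) * p l) • v

lemma apply_chainVec_zero {d : ℕ} {A : Fin 3 → Module.End ℂ V} {p : Fin 3 → ℂ} (h : IsBITriple d A p)
    {v : V} (hX : A 0 v = (p 0 + d / 2) • v) (hYZ : A 1 v - A 2 v = (p 1 - p 2) • v) (i : ℕ) :
    A 0 (chainVec d (p 1) (A 1) v i) = revTheta d (p 0) i • chainVec d (p 1) (A 1) v i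
      + revPhi d (p 0) (p 1) (p 2) i • chainVec d (p 1) (A 1) v (i - 1) := by
  cases i with
  | zero => simp [chainVec, revTheta, revPhi, hX]
  | succ i => exact (chainVec_relations h hX hYZ i).1

/-- The tail `u_m, …, u_d` is invariant: `X` leaks only from `u_m` to `u_{m-1}`, with the factor
`revPhi m = 0`, and `Y` leaks only from `u_d` to `u_{d+1} = 0`. Used with `m = 0` for spanning and
with `m ≥ 1` to show that `revPhi m` cannot vanish. -/
lemma span_chainVec {d : ℕ} {A : Fin 3 → Module.End ℂ V} {p : Fin 3 → ℂ} (h : IsBITriple d A p)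
    {v : V} (hX : A 0 v = (p 0 + d / 2) • v) (hYZ : A 1 v - A 2 v = (p 1 - p 2) • v)
    (hend : chainVec d (p 1) (A 1) v (d + 1) = 0) (m : ℕ) (hm : revPhi d (p 0) (p 1) (p 2) m = 0) :
    Submodule.span ℂ (chainVec d (p 1) (A 1) v '' Set.Icc m d) = ⊥ ∨
      Submodule.span ℂ (chainVec d (p 1) (A 1) v '' Set.Icc m d) = ⊤ := by
  set W := Submodule.span ℂ (chainVec d (p 1) (A 1) v '' Set.Icc m d) with hW
  have hmem : ∀ i, m ≤ i → i ≤ d → chainVec d (p 1) (A 1) v i ∈ W := fun i h1 h2 =>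
    Submodule.subset_span ⟨i, ⟨h1, h2⟩, rfl⟩
  have key : ∀ T : Module.End ℂ V, (∀ i, m ≤ i → i ≤ d → T (chainVec d (p 1) (A 1) v i) ∈ W) →
      ∀ w ∈ W, T w ∈ W := by
    intro T hT w hw
    have : W ≤ W.comap T := by
      rw [hW, Submodule.span_le]
      rintro _ ⟨i, ⟨h1, h2⟩, rfl⟩
      exact hT i h1 h2
    exact this hw
  refine h.eq_bot_or_eq_top W (key _ fun i h1 h2 => ?_) (key _ fun i h1 h2 => ?_)
  · rw [apply_chainVec_zero h hX hYZ]
    refine W.add_mem (W.smul_mem _ (hmem i h1 h2)) ?_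
    rcases h1.eq_or_lt with rfl | h1
    · rw [hm, zero_smul]; exact W.zero_mem
    · exact W.smul_mem _ (hmem _ (by omega) (by omega))
  · rw [apply_chainVec]
    refine W.add_mem ?_ (W.smul_mem _ (hmem i h1 h2))
    rcases h2.eq_or_lt with rfl | h2
    · rw [hend]; exact W.zero_mem
    · exact hmem _ (by omega) (by omega)

lemma span_chainVec_eq_top {d : ℕ} {A : Fin 3 → Module.End ℂ V} {p : Fin 3 → ℂ}
    (h : IsBITriple d A p) {v : V} (hv : v ≠ 0) (hX : A 0 v = (p 0 + d / 2) • v)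
    (hYZ : A 1 v - A 2 v = (p 1 - p 2) • v) (hend : chainVec d (p 1) (A 1) v (d + 1) = 0) :
    Submodule.span ℂ (Set.range fun i : Fin (d + 1) => chainVec d (p 1) (A 1) v i) = ⊤ := by
  have hr : (Set.range fun i : Fin (d + 1) => chainVec d (p 1) (A 1) v i)
      = chainVec d (p 1) (A 1) v '' Set.Icc 0 d := by
    ext x
    constructor
    · rintro ⟨i, rfl⟩
      exact ⟨i, ⟨Nat.zero_le _, i.is_le⟩, rfl⟩
    · rintro ⟨i, ⟨-, hi⟩, rfl⟩
      exact ⟨⟨i, by omega⟩, rfl⟩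
  rw [hr]
  refine (span_chainVec h hX hYZ hend 0 (by simp [revPhi])).resolve_left fun hb => hv ?_
  rw [Submodule.span_eq_bot] at hb
  exact hb _ ⟨0, ⟨le_rfl, Nat.zero_le _⟩, rfl⟩

lemma revTheta_sub {d : ℕ} (hd : Even d) (b : ℂ) {i : ℕ} (hi : i ≤ d) :
    revTheta d b (d - i) = theta d b i := by
  obtain ⟨m, rfl⟩ := Nat.exists_eq_add_of_le hi
  have : (-1 : ℂ) ^ m = (-1) ^ i := by
    rcases Nat.even_or_odd i with h | h
    · rw [h.neg_one_pow, Even.neg_one_pow]; grind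
    · rw [h.neg_one_pow, Odd.neg_one_pow]; grind
  rw [revTheta, theta, Nat.add_sub_cancel_left, this]
  push_cast
  ring

/-- For even `d`, the numbers `d - i` and `i + 1` have opposite parity, so the even branch of one
definition meets the odd branch of the other. -/
lemma revPhi_sub {d : ℕ} (hd : Even d) (a b c : ℂ) {i : ℕ} (hi : i ≤ d) :
    revPhi d a b c (d - i) = phi d a b c (i + 1) := by
  obtain ⟨m, rfl⟩ := Nat.exists_eq_add_of_le hi
  rw [revPhi, phi, Nat.add_sub_cancel_left]
  by_cases h : Even m
  · have h' : ¬ Even (i + 1) := by grind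
    rw [if_pos h, if_neg h']; push_cast; ring
  · have h' : Even (i + 1) := by grind
    rw [if_neg h, if_pos h']; push_cast; ring

/-- The vectors `w_0, …, w_d` form a basis in which `X, Y` act as on the standard basis of
`O_d(a,b,c)`. -/
structure IsStandardBasis (d : ℕ) (X Y : Module.End ℂ V) (a b c : ℂ) (w : ℕ → V) : Prop where
  linearIndependent : LinearIndependent ℂ fun i : Fin (d + 1) => w i
  last : w (d + 1) = 0
  apply_X : ∀ i ≤ d, X (w i) = theta d a i • w i + w (i + 1)
  apply_Y_zero : Y (w 0) = theta d b 0 • w 0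
  apply_Y_succ : ∀ i ≤ d, Y (w (i + 1)) = theta d b (i + 1) • w (i + 1) + phi d a b c (i + 1) • w i

/-- The chain of the extremal vector stops after `d + 1` steps by the polynomial identity for `Y`,
spans by irreducibility, and is therefore a basis by dimension. In it `Y` has ones and `X` has
`revPhi` off the diagonal. Irreducibility makes these entries nonzero, so reversing the order and
rescaling moves the ones from `Y` to `X`. -/
lemma exists_isStandardBasis {d : ℕ} (hd : Even d) {A : Fin 3 → Module.End ℂ V} {p : Fin 3 → ℂ}
    (h : IsBITriple d A p) (hr : Module.finrank ℂ V = d + 1) (hY : aeval (A 1) (thetaPoly d (p 1)) = 0)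
    (hext : HasExtremal d A p 0 1) :
    ∃ w, IsStandardBasis d (A 0) (A 1) (p 0) (p 1) (p 2) w := by
  obtain ⟨v, hv, hX, hYZ⟩ := hext
  replace hYZ := hYZ 1 2 (by decide) (by decide) (by decide)
  simp only [Units.val_one, Int.cast_one, one_mul, one_smul] at hX hYZ
  have hend : chainVec d (p 1) (A 1) v (d + 1) = 0 := by
    rw [chainVec_eq_aeval, ← thetaPoly, hY, LinearMap.zero_apply]
  have htop := span_chainVec_eq_top h hv hX hYZ hend
  set u := chainVec d (p 1) (A 1) v with hu
  have hli : LinearIndependent ℂ fun i : Fin (d + 1) => u i :=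
    linearIndependent_of_top_le_span_of_card_eq_finrank htop.ge (by simp [hr])
  have hphi : ∀ m, 1 ≤ m → m ≤ d → revPhi d (p 0) (p 1) (p 2) m ≠ 0 := by
    intro m h1 h2 hm
    have hmm : u m ∈ u '' Set.Icc m d := ⟨m, ⟨le_rfl, h2⟩, rfl⟩
    rcases span_chainVec h hX hYZ hend m hm with hb | ht
    · rw [Submodule.span_eq_bot] at hb
      exact hli.ne_zero ⟨m, by omega⟩ (hb _ hmm)
    -- Since `m ≥ 1`, the vector `u_0` is independent of the tail, so the tail cannot span.
    · have hn := hli.notMem_span_image (s := {i | m ≤ (i : ℕ)}) (x := 0) (by simp; omega)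
      apply hn
      have : (fun i : Fin (d + 1) => u i) '' {i | m ≤ (i : ℕ)} = u '' Set.Icc m d := by
        ext x
        constructor
        · rintro ⟨i, hi, rfl⟩
          exact ⟨i, ⟨hi, i.is_le⟩, rfl⟩
        · rintro ⟨i, ⟨hi, hi'⟩, rfl⟩
          exact ⟨⟨i, by omega⟩, hi, rfl⟩
      rw [this, ht]
      trivial
  set s : ℕ → ℂ := fun i => ∏ k ∈ Finset.range i, revPhi d (p 0) (p 1) (p 2) (d - k) with hs
  have hs0 : ∀ i ≤ d, s i ≠ 0 := fun i hi => Finset.prod_ne_zero_iff.2 fun k hk => by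
    rw [Finset.mem_range] at hk
    exact hphi _ (by omega) (by omega)
  have hss : ∀ i, s (i + 1) = s i * revPhi d (p 0) (p 1) (p 2) (d - i) := fun i =>
    Finset.prod_range_succ _ _
  -- The last factor is `revPhi 0 = 0`. It makes `w_{d+1}` vanish although the truncated index `d -
  -- (d + 1)` points at `u_0`.
  have hlast : s (d + 1) = 0 := by rw [hss]; simp [revPhi]
  refine ⟨fun i => s i • u (d - i), ?_, ?_, ?_, ?_, ?_⟩
  · have h1 := (hli.comp Fin.rev Fin.rev_injective).units_smul
      (fun i => Units.mk0 (s i) (hs0 i i.is_le))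
    convert h1 using 2 with i
    simp [Units.smul_def, Fin.val_rev]
  · rw [hlast, zero_smul]
  · intro i hi
    rw [map_smul, apply_chainVec_zero h hX hYZ, revTheta_sub hd _ hi, hss, Nat.sub_sub]
    module
  · rw [map_smul, hu, apply_chainVec, ← hu, revTheta_sub hd _ (Nat.zero_le d), Nat.sub_zero, hend]
    module
  · intro i hi
    -- At `i = d` both sides vanish: `w_{d+1} = 0`, and `φ_{d+1} = revPhi 0 = 0`.
    rcases hi.eq_or_lt with rfl | hi
    · rw [hlast, ← revPhi_sub hd _ _ _ le_rfl]
      simp [revPhi]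
    · rw [map_smul, hu, apply_chainVec, revTheta_sub hd _ hi, hss, revPhi_sub hd _ _ _ hi.le,
        show d - (i + 1) + 1 = d - i by omega]
      module

/-- The relation for `{X, Y}` at `w_0` expresses `Z w_0` through `w_0` and `w_1`, and the `w_1`
terms cancel against those of `X w_0`. This turns extremality for `X` into extremality for `Y`. -/
lemma IsStandardBasis.apply_zero_add_two {d : ℕ} {A : Fin 3 → Module.End ℂ V} {p : Fin 3 → ℂ}
    (h : SatisfiesBI d A p) {w : ℕ → V} (hw : IsStandardBasis d (A 0) (A 1) (p 0) (p 1) (p 2) w) :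
    A 0 (w 0) + A 2 (w 0) = (p 0 + p 2) • w 0 := by
  have hX := hw.apply_X 0 (Nat.zero_le d)
  have hY0 := hw.apply_Y_zero
  have hY1 := hw.apply_Y_succ 0 (Nat.zero_le d)
  have e := h.rel 0 1 2 (by decide) (by decide) (by decide) (w 0)
  rw [hY0, hX, map_add, map_smul, map_smul, hX, hY1, hY0] at e
  rw [hX]
  simp only [theta, phi, zero_add, Nat.not_even_one, if_false] at e ⊢
  push_cast at e ⊢
  linear_combination (norm := module) -e

lemma IsStandardBasis.hasExtremal {d : ℕ} {A : Fin 3 → Module.End ℂ V} {p : Fin 3 → ℂ}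
    (h : SatisfiesBI d A p) {w : ℕ → V} (hw : IsStandardBasis d (A 0) (A 1) (p 0) (p 1) (p 2) w) :
    HasExtremal d A p 1 (-1) := by
  have key := hw.apply_zero_add_two h
  refine ⟨w 0, hw.linearIndependent.ne_zero 0, ?_, ?_⟩
  · rw [hw.apply_Y_zero, theta]
    congr 1
    push_cast
    ring
  · intro j l hj hl hjl
    have : (j = 0 ∧ l = 2) ∨ (j = 2 ∧ l = 0) := by revert j l; decide
    rcases this with ⟨rfl, rfl⟩ | ⟨rfl, rfl⟩ <;> push_cast <;>
    linear_combination (norm := module) key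

end Triples

end BannaiIto
end

/-! ### Signed permutations and the propagation of extremal vectors -/

noncomputable section

namespace BannaiIto

open Polynomial (aeval)

/-- The family `i ↦ ± A_{σ(i)}` obtained from three vectors by a signed permutation. -/
def twistFam {M : Type*} [AddCommGroup M] [Module ℂ M] (g : ℤˣ × ℤˣ) (σ : Equiv.Perm (Fin 3))
    (A : Fin 3 → M) (i : Fin 3) : M :=
  ((signOf g (σ i) : ℤ) : ℂ) • A (σ i)

/-- The three signs are constrained only by having product `1`, so two of them can be prescribed at
will. -/
lemma exists_twist (i j : Fin 3) (hij : i ≠ j) (s s' : ℤˣ) :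
    ∃ (g : ℤˣ × ℤˣ) (σ : Equiv.Perm (Fin 3)), σ 0 = i ∧ σ 1 = j ∧ signOf g i = s ∧ signOf g j = s' := by
  have hσ : ∃ σ : Equiv.Perm (Fin 3), σ 0 = i ∧ σ 1 = j := by
    clear s s'
    revert i j; decide
  have hg : ∃ g, signOf g i = s ∧ signOf g j = s' := by
    clear hσ
    revert i j s s'; decide
  obtain ⟨g, hg⟩ := hg
  obtain ⟨σ, hσ⟩ := hσ
  exact ⟨g, σ, hσ.1, hσ.2, hg.1, hg.2⟩

lemma twistFam_finRotate_zero {M : Type*} [AddCommGroup M] [Module ℂ M] (A : Fin 3 → M) :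
    twistFam (-1, -1) (finRotate 3) A 0 = -A 1 := by simp [twistFam, signOf]

lemma twistFam_finRotate_one {M : Type*} [AddCommGroup M] [Module ℂ M] (A : Fin 3 → M) :
    twistFam (-1, -1) (finRotate 3) A 1 = A 2 := by
  simp [twistFam, signOf, show finRotate 3 1 = 2 from rfl]

section Triples

variable {V : Type*} [AddCommGroup V] [Module ℂ V] {d : ℕ} {A : Fin 3 → Module.End ℂ V} {p : Fin 3 → ℂ}

/-- The product of two of the signs is the third, so each relation is merely multiplied by a common
sign. -/
lemma SatisfiesBI.twist (h : SatisfiesBI d A p) (g : ℤˣ × ℤˣ) (σ : Equiv.Perm (Fin 3)) :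
    SatisfiesBI d (twistFam g σ A) (twistFam g σ p) where
  rel i j l hij hjl hil v := by
    have e := h.rel (σ i) (σ j) (σ l) (by simpa) (by simpa) (by simpa) v
    have hs := sgn_mul_sgn g (σ i) (σ j) (σ l) (by simpa) (by simpa) (by simpa)
    simp only [twistFam, ← hs, LinearMap.smul_apply, map_smul, smul_eq_mul]
    push_cast
    linear_combination (norm := module) (((signOf g (σ i) : ℤ) : ℂ) * ((signOf g (σ j) : ℤ) : ℂ)) • e

lemma IsBITriple.twist (h : IsBITriple d A p) (g : ℤˣ × ℤˣ) (σ : Equiv.Perm (Fin 3)) :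
    IsBITriple d (twistFam g σ A) (twistFam g σ p) where
  toSatisfiesBI := h.toSatisfiesBI.twist g σ
  irred W hW := by
    refine h.irred W fun i w hw => ?_
    have := W.smul_mem ((signOf g i : ℤ) : ℂ) (hW (σ.symm i) w hw)
    simp only [twistFam, LinearMap.smul_apply, Equiv.apply_symm_apply, smul_smul, ← Int.cast_mul,
      ← Units.val_mul, Int.units_mul_self] at this
    simpa using this

/-- The same vector serves on both sides: the sign on the operator in slot `i` is absorbed into `s`,
and the conditions on the other two are multiplied by the sign of `j`. -/
lemma hasExtremal_twist (g : ℤˣ × ℤˣ) (σ : Equiv.Perm (Fin 3)) (i : Fin 3) (s : ℤˣ) :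
    HasExtremal d (twistFam g σ A) (twistFam g σ p) i s ↔
      HasExtremal d A p (σ i) (signOf g (σ i) * s) := by
  refine exists_congr fun v => and_congr_right fun _ => and_congr ?_ ?_
  · rcases Int.units_eq_one_or (signOf g (σ i)) with h | h <;>
    simp only [twistFam, h, LinearMap.smul_apply, smul_eq_mul] <;> push_cast
    · simp
    · rw [show ((-1 : ℂ) • A (σ i) v = (-1 * p (σ i) + s * d / 2) • v) ↔
        (-1 : ℂ) • A (σ i) v = (-1 : ℂ) • ((p (σ i) + -1 * s * d / 2) • v) by
          rw [smul_smul]; ring_nf]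
      exact (smul_right_injective V (neg_ne_zero.2 one_ne_zero : (-1 : ℂ) ≠ 0)).eq_iff
  · refine σ.forall_congr fun j => σ.forall_congr fun l => ?_
    simp only [σ.injective.ne_iff]
    refine imp_congr_right fun hij => imp_congr_right fun hjl => imp_congr_right fun hil => ?_
    have hs := sgn_mul_sgn g (σ i) (σ j) (σ l) (by simpa) (by simpa) (by simpa)
    simp only [twistFam, ← hs, LinearMap.smul_apply, smul_eq_mul]
    have hinj := smul_right_injective V (neg_ne_zero.2 one_ne_zero : (-1 : ℂ) ≠ 0)
    rcases Int.units_eq_one_or (signOf g (σ j)) with h | h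
    · simp only [h]
      push_cast
      simp only [one_smul, one_mul, smul_smul, mul_comm, mul_left_comm]
    · simp only [h]
      rw [← hinj.eq_iff (a := A (σ j) v - _)]
      push_cast
      simp only [smul_sub, smul_smul]
      ring_nf

/-- Passing from `b` to `-b` negates the list of roots and reverses its order. The number `d + 1` of
factors is odd, whence the overall sign in `e`. -/
lemma aeval_neg_thetaPoly (hd : Even d) (T : Module.End ℂ V) (b : ℂ)
    (h : aeval T (thetaPoly d b) = 0) : aeval (-T) (thetaPoly d (-b)) = 0 := by
  have e : (thetaPoly d (-b)).comp (-Polynomial.X) = -thetaPoly d b := by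
    rw [thetaPoly, Polynomial.prod_comp, ← Finset.prod_range_reflect, thetaPoly]
    have hsign : ∀ q : Polynomial ℂ, -q = (∏ _i ∈ Finset.range (d + 1), (-1)) * q := fun q => by
      rw [Finset.prod_const, Finset.card_range, hd.add_one.neg_one_pow, neg_one_mul]
    rw [hsign (∏ i ∈ _, _), ← Finset.prod_mul_distrib]
    refine Finset.prod_congr rfl fun i hi => ?_
    have hi' : i ≤ d := by simp at hi; omega
    have : revTheta d (-b) (d - i) = -revTheta d b i := by
      rw [revTheta_sub hd _ hi', theta, revTheta]; ring
    simp [this]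
    ring
  have := congrArg (aeval T) e
  rwa [Polynomial.aeval_comp, map_neg, map_neg, h, neg_zero, Polynomial.aeval_X] at this

lemma aeval_twist (hd : Even d) (h : ∀ i, aeval (A i) (thetaPoly d (p i)) = 0) (g : ℤˣ × ℤˣ)
    (σ : Equiv.Perm (Fin 3)) (i : Fin 3) :
    aeval (twistFam g σ A i) (thetaPoly d (twistFam g σ p i)) = 0 := by
  rcases Int.units_eq_one_or (signOf g (σ i)) with h' | h' <;> simp only [twistFam, h']
  · simpa using h (σ i)
  · simpa using aeval_neg_thetaPoly hd _ _ (h (σ i))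

/-- Twist so that `A_i` with sign `s` takes the place of `X` and `A_j` with sign `-s'` that of `Y`.
The first vector of the resulting standard basis is `-1`-extremal for the new `Y`, that is,
`s'`-extremal for `A_j`. -/
lemma HasExtremal.of_ne (hd : Even d) (h : IsBITriple d A p) (hr : Module.finrank ℂ V = d + 1)
    (ha : ∀ i, aeval (A i) (thetaPoly d (p i)) = 0) {i j : Fin 3} {s : ℤˣ} (he : HasExtremal d A p i s)
    (hij : i ≠ j) (s' : ℤˣ) : HasExtremal d A p j s' := by
  obtain ⟨g, σ, rfl, rfl, rfl, hj⟩ := exists_twist i j hij s (-s')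
  obtain ⟨w, hw⟩ := exists_isStandardBasis hd (h.twist g σ) hr (aeval_twist hd ha g σ 1)
    ((hasExtremal_twist g σ 0 1).2 (by simpa using he))
  simpa [hj] using (hasExtremal_twist g σ 1 (-1)).1 (hw.hasExtremal (h.toSatisfiesBI.twist g σ))

lemma HasExtremal.all (hd : Even d) (h : IsBITriple d A p) (hr : Module.finrank ℂ V = d + 1)
    (ha : ∀ i, aeval (A i) (thetaPoly d (p i)) = 0) {i : Fin 3} {s : ℤˣ} (he : HasExtremal d A p i s)
    (j : Fin 3) (s' : ℤˣ) : HasExtremal d A p j s' := by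
  by_cases hij : i = j
  · have : i ≠ i + 1 := by simp
    -- The sign at the same operator is changed by a detour through another operator.
    exact (he.of_ne hd h hr ha this 1).of_ne hd h hr ha (hij ▸ this.symm) s'
  · exact he.of_ne hd h hr ha hij s'

/-- Because `revPhi (d + 1) = 0`, the vector `u_{d+1}` satisfies the eigenvector equation of `X` for
`revTheta (d + 1)`; if that number is not an eigenvalue, the chain stops. Then the polynomial in `Y`
kills `u_0`, hence every `u_i`, since these are polynomials in `Y` applied to `u_0`. -/
lemma aeval_thetaPoly_of_extremal (hd : Even d) (h : IsBITriple d A p) (he : HasExtremal d A p 0 1)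
    (hX : ∀ w, A 0 w = revTheta d (p 0) (d + 1) • w → w = 0) :
    aeval (A 1) (thetaPoly d (p 1)) = 0 := by
  obtain ⟨v, hv, hXv, hYZ⟩ := he
  replace hYZ := hYZ 1 2 (by decide) (by decide) (by decide)
  simp only [Units.val_one, Int.cast_one, one_mul, one_smul] at hXv hYZ
  have hend : chainVec d (p 1) (A 1) v (d + 1) = 0 := by
    refine hX _ ?_
    have : ¬ Even (d + 1) := by grind
    rw [apply_chainVec_zero h hXv hYZ, revPhi, if_neg this]
    push_cast
    module
  refine LinearMap.ext_on_range (span_chainVec_eq_top h hv hXv hYZ hend) fun i => ?_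
  have hq : aeval (A 1) (thetaPoly d (p 1)) v = 0 := by rw [thetaPoly, ← chainVec_eq_aeval, hend]
  simp only [chainVec_eq_aeval]
  rw [← Module.End.mul_apply, ← map_mul, mul_comm, map_mul, Module.End.mul_apply, hq, map_zero,
    LinearMap.zero_apply]

/-- The preceding criterion for the twisted triple beginning with `-Y, Z`. The excluded eigenvalue
of `-Y` becomes `-(b + d/2 + 1)` for `Y`. -/
lemma aeval_thetaPoly_two (hd : Even d) (h : IsBITriple d A p) (he : HasExtremal d A p 1 (-1))
    (hY : ∀ w, A 1 w = -(p 1 + d / 2 + 1) • w → w = 0) :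
    aeval (A 2) (thetaPoly d (p 2)) = 0 := by
  have := aeval_thetaPoly_of_extremal hd (h.twist (-1, -1) (finRotate 3))
    ((hasExtremal_twist _ _ 0 1).2 (by simpa [signOf] using he)) ?_
  · rwa [twistFam_finRotate_one, twistFam_finRotate_one] at this
  · intro w hw
    rw [twistFam_finRotate_zero, twistFam_finRotate_zero, LinearMap.neg_apply, neg_eq_iff_eq_neg] at hw
    refine hY w (hw.trans ?_)
    rw [revTheta, hd.add_one.neg_one_pow]
    push_cast
    module

end Triples

end BannaiIto
end

/-! ### The operators on `O_d(a,b,c)`, the Casimir operator and ladder operators -/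

noncomputable section

namespace BannaiIto

open Polynomial (aeval)

lemma exists_int_extension {d : ℕ} (f : ℕ → ℂ) :
    ∃ v : ℤ → ℂ, (∀ n < 0, v n = 0) ∧ (∀ n : ℕ, v n = f n) ∧ res d v = fun i : Fin (d + 1) => f i := by
  refine ⟨fun n => if 0 ≤ n then f n.toNat else 0, fun n hn => if_neg (by omega), fun n => ?_, ?_⟩
  · simp
  · funext i
    simp [res]

lemma oX_mulVec (d : ℕ) (a : ℂ) (f : ℕ → ℂ) (i : Fin (d + 1)) :
    (oX d a).mulVec (fun j => f j) i = theta d a i * f i + if (i : ℕ) = 0 then 0 else f (i - 1) := by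
  obtain ⟨v, hv, hf, hr⟩ := exists_int_extension (d := d) f
  rw [← hr, ← (res_zX d a v hv).1, res, zX, theta, hf]
  congr 1
  split_ifs with h
  · rw [h]; exact hv _ (by norm_num)
  · rw [← hf]; congr 1; omega

lemma oY_mulVec {d : ℕ} (hd : Even d) (a b c : ℂ) (f : ℕ → ℂ) (i : Fin (d + 1)) :
    (oY d a b c).mulVec (fun j => f j) i =
      theta d b i * f i + phi d a b c (i + 1) * f (i + 1) := by
  obtain ⟨v, hv, hf, hr⟩ := exists_int_extension (d := d) f
  have e : ((i : ℕ) : ℤ) + 1 = ((i + 1 : ℕ) : ℤ) := by push_cast; rfl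
  rw [← hr, ← (res_zY d hd a b c v hv).1, res, zY, theta, hf, e, zphi_natCast, hf]
  rfl

/-- The operators `X, Y, Z` on `O_d(a,b,c)`. -/
def oEnd (d : ℕ) (a b c : ℂ) (i : Fin 3) : Module.End ℂ (Fin (d + 1) → ℂ) :=
  Matrix.toLin' (oGen d a b c i)

lemma oEnd_satisfiesBI {d : ℕ} (hd : Even d) (a b c : ℂ) :
    SatisfiesBI d (oEnd d a b c) ![a, b, c] where
  rel := by
    have key : ∀ i v, oEnd d a b c i (oEnd d a b c (i + 1) v) + oEnd d a b c (i + 1) (oEnd d a b c i v)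
        = oEnd d a b c (i + 2) v + (2 * (![a, b, c] : Fin 3 → ℂ) i * (![a, b, c] : Fin 3 → ℂ) (i + 1)
          - (![a, b, c] : Fin 3 → ℂ) (i + 2) * (d + 1)) • v := by
      have hm : ∀ i, oGen d a b c i * oGen d a b c (i + 1) + oGen d a b c (i + 1) * oGen d a b c i
          = oGen d a b c (i + 2) + (2 * (![a, b, c] : Fin 3 → ℂ) i * (![a, b, c] : Fin 3 → ℂ) (i + 1)
          - (![a, b, c] : Fin 3 → ℂ) (i + 2) * (d + 1)) • 1 := by
        intro i
        rcases fin3_cases i with rfl | rfl | rfl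
        · simp [oGen, oZ]
        · exact sub_eq_iff_eq_add'.1 (o_rel d hd a b c).1
        · exact sub_eq_iff_eq_add'.1 (o_rel d hd a b c).2
      intro i v
      have := congrArg (fun M => Matrix.toLin' M v) (hm i)
      simpa [oEnd, Matrix.toLin'_mul] using this
    intro i j l hij hjl hil v
    have : (j = i + 1 ∧ l = i + 2) ∨ (i = j + 1 ∧ l = j + 2) := by
      revert i j l; decide
    rcases this with ⟨rfl, rfl⟩ | ⟨rfl, rfl⟩
    · exact key i v
    · exact (add_comm _ _).trans ((key j v).trans (by rw [mul_right_comm]))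

/-- The standard basis `v_0, …, v_d` of `O_d(a,b,c)`, followed by zeros. -/
def oBasis (d : ℕ) (i : ℕ) : Fin (d + 1) → ℂ := fun j => if (j : ℕ) = i then 1 else 0

lemma oBasis_eq_single (d : ℕ) (i : Fin (d + 1)) : oBasis d i = Pi.single i 1 := by
  funext j
  simp [oBasis, Pi.single_apply, Fin.ext_iff]

lemma oBasis_isStandardBasis {d : ℕ} (hd : Even d) (a b c : ℂ) :
    IsStandardBasis d (oEnd d a b c 0) (oEnd d a b c 1) a b c (oBasis d) where
  linearIndependent := by
    simpa only [oBasis_eq_single] using Pi.linearIndependent_single_one (Fin (d + 1)) ℂ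
  last := by
    funext j
    exact if_neg (by omega)
  apply_X i _ := by
    funext j
    refine (oX_mulVec d a (fun j => if j = i then 1 else 0) j).trans ?_
    simp only [Pi.add_apply, Pi.smul_apply, oBasis, smul_eq_mul]
    grind
  apply_Y_zero := by
    funext j
    refine (oY_mulVec hd a b c (fun j => if j = 0 then 1 else 0) j).trans ?_
    simp only [Pi.smul_apply, oBasis, smul_eq_mul]
    grind
  apply_Y_succ i _ := by
    funext j
    refine (oY_mulVec hd a b c (fun j => if j = i + 1 then 1 else 0) j).trans ?_
    simp only [Pi.add_apply, Pi.smul_apply, oBasis, smul_eq_mul]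
    grind

lemma thetaPoly_eq_prod {d : ℕ} (hd : Even d) (b : ℂ) :
    thetaPoly d b = ∏ i : Fin (d + 1), (Polynomial.X - Polynomial.C (theta d b i)) := by
  rw [thetaPoly, ← Finset.prod_range_reflect, Finset.prod_range]
  refine Finset.prod_congr rfl fun i _ => ?_
  rw [Nat.add_sub_cancel, revTheta_sub hd _ i.is_le]

/-- Cayley-Hamilton. It is applied to the triangular matrices of `X` and `Y`, whose characteristic
polynomials are read off the diagonal. -/
lemma aeval_oEnd {d : ℕ} (a b c : ℂ) (i : Fin 3) (q : Polynomial ℂ)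
    (h : (oGen d a b c i).charpoly = q) : aeval (oEnd d a b c i) q = 0 := by
  have := Polynomial.aeval_algHom_apply
    (Matrix.toLinAlgEquiv' : Matrix (Fin (d + 1)) (Fin (d + 1)) ℂ ≃ₐ[ℂ] _).toAlgHom
    (oGen d a b c i) q
  rw [← h, Matrix.aeval_self_charpoly, map_zero, h] at this
  exact this

lemma aeval_oEnd_zero {d : ℕ} (hd : Even d) (a b c : ℂ) :
    aeval (oEnd d a b c 0) (thetaPoly d a) = 0 := by
  refine aeval_oEnd a b c 0 _ ?_
  rw [← Matrix.charpoly_transpose, Matrix.charpoly_of_isUpperTriangular, thetaPoly_eq_prod hd]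
  · simp [oGen, oX]
  · intro i j hij
    have hij : (j : ℕ) < i := hij
    simp only [oGen, Matrix.cons_val_zero, Matrix.transpose_apply, oX, Matrix.of_apply]
    rw [if_neg (by grind), if_neg (by grind)]

lemma aeval_oEnd_one {d : ℕ} (hd : Even d) (a b c : ℂ) :
    aeval (oEnd d a b c 1) (thetaPoly d b) = 0 := by
  refine aeval_oEnd a b c 1 _ ?_
  rw [show oGen d a b c 1 = oY d a b c from rfl, Matrix.charpoly_of_isUpperTriangular,
    thetaPoly_eq_prod hd]
  · simp [oY]
  · intro i j hij
    have hij : (j : ℕ) < i := hij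
    simp only [oY, Matrix.of_apply]
    rw [if_neg (by grind), if_neg (by grind)]

section Casimir

variable {V : Type*} [AddCommGroup V] [Module ℂ V] {d : ℕ} {A : Fin 3 → Module.End ℂ V} {p : Fin 3 → ℂ}

/-- `[Y², X] = [Y, {X, Y}] = [Y, Z]` and `[Z², X] = [Z, {X, Z}] = [Z, Y]` cancel. -/
lemma SatisfiesBI.casimir_commute (h : SatisfiesBI d A p) (v : V) :
    A 0 (A 0 (A 0 v)) + A 1 (A 1 (A 0 v)) + A 2 (A 2 (A 0 v)) =
      A 0 (A 0 (A 0 v) + A 1 (A 1 v) + A 2 (A 2 v)) := by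
  have r2 := h.rel 0 1 2 (by decide) (by decide) (by decide)
  have r1 := h.rel 0 2 1 (by decide) (by decide) (by decide)
  have e1 := r2 (A 1 v)
  have e2 := congrArg (A 1) (r2 v)
  have e3 := r1 (A 2 v)
  have e4 := congrArg (A 2) (r1 v)
  simp only [map_add, map_smul] at *
  linear_combination (norm := module) e2 - e1 + e4 - e3

/-- Expand `(X + Z)² v = (a + c)² v` and replace `{X, Z}` by `Y` plus a scalar. -/
lemma SatisfiesBI.casimir_extremal (h : SatisfiesBI d A p) {v : V}
    (hY : A 1 v = (p 1 - d / 2) • v) (hXZ : A 0 v + A 2 v = (p 0 + p 2) • v) :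
    A 0 (A 0 v) + A 1 (A 1 v) + A 2 (A 2 v) =
      (p 0 ^ 2 + p 1 ^ 2 + p 2 ^ 2 + ((d + 1) ^ 2 - 1) / 4) • v := by
  have e := h.rel 0 2 1 (by decide) (by decide) (by decide) v
  have hZ : A 2 v = (p 0 + p 2) • v - A 0 v := by rw [← hXZ]; abel
  have e1 := congrArg (A 2) hZ
  have e2 := congrArg (A 0) hZ
  rw [map_sub, map_smul] at e1 e2
  have e3 : A 1 (A 1 v) = (p 1 - d / 2 : ℂ) • (p 1 - d / 2 : ℂ) • v := by rw [hY, map_smul, hY]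
  linear_combination (norm := module) e1 - e + e2 + e3 - hY + (p 0 + p 2) • hXZ

/-- For `s = ±1` the relations combine to `{Y, X - sZ} = -s (X - sZ) + (a - sc)(2b + s(d+1))`. On an
eigenvector of `Y`, the correction by `r` absorbs the constant. -/
lemma SatisfiesBI.ladder (h : SatisfiesBI d A p) {s : ℂ} (hs : s ^ 2 = 1) {v : V} {y r : ℂ}
    (hy : A 1 v = y • v) (hr : r * (2 * y + s) = (p 0 - s * p 2) * (2 * p 1 + s * (d + 1))) :
    A 1 (A 0 v - s • A 2 v - r • v) = (-s - y) • (A 0 v - s • A 2 v - r • v) := by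
  have e1 := h.rel 0 1 2 (by decide) (by decide) (by decide) v
  have e2 := h.rel 1 2 0 (by decide) (by decide) (by decide) v
  rw [hy, map_smul] at e1 e2
  have e3 := congrArg (fun z : ℂ => z • v) hr
  have e4 := congrArg (fun z : ℂ => z • ((p 2 * (d + 1)) • v - A 2 v)) hs
  simp only [map_sub, map_smul, hy]
  linear_combination (norm := module) e1 - s • e2 - e3 + e4

/-- If `X v = s Z v + r v`, then `(X² + Z²) v = s {X, Z} v + r² v`, and the Casimir value becomes an
equation in `y` and `r`. Eliminating `r` leaves a quadratic in `(y + s/2)²` that factors. -/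
lemma SatisfiesBI.ladder_zero (h : SatisfiesBI d A p) {s : ℂ} (hs : s ^ 2 = 1) {v : V} (hv : v ≠ 0)
    {y r : ℂ} (hC : A 0 (A 0 v) + A 1 (A 1 v) + A 2 (A 2 v) =
      (p 0 ^ 2 + p 1 ^ 2 + p 2 ^ 2 + ((d + 1) ^ 2 - 1) / 4) • v)
    (hy : A 1 v = y • v) (hr : r * (2 * y + s) = (p 0 - s * p 2) * (2 * p 1 + s * (d + 1)))
    (h0 : A 0 v - s • A 2 v - r • v = 0) :
    ((y + s / 2) ^ 2 - (p 0 - s * p 2) ^ 2) * ((y + s / 2) ^ 2 - (p 1 + s * (d + 1) / 2) ^ 2) = 0 := by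
  have e := h.rel 0 2 1 (by decide) (by decide) (by decide) v
  have hX : A 0 v = s • A 2 v + r • v := by linear_combination (norm := module) h0
  have e1 := congrArg (A 0) hX
  have e2 := congrArg (A 2) hX
  rw [map_add, map_smul, map_smul] at e1 e2
  have e3 : A 1 (A 1 v) = y • y • v := by rw [hy, map_smul, hy]
  have e4 := congrArg (fun z : ℂ => z • A 2 (A 2 v)) hs
  have key : (p 0 ^ 2 + p 1 ^ 2 + p 2 ^ 2 + ((d + 1) ^ 2 - 1) / 4 - y ^ 2 - s * y
      - s * (2 * p 0 * p 2 - p 1 * (d + 1)) - r ^ 2) • v = 0 := by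
    linear_combination (norm := module) -hC + e3 + s • e + e1 - s • e2 + r • hX - e4 + s • hy
  have key := (smul_eq_zero.1 key).resolve_right hv
  -- Multiplying by `(y + s/2)²` allows `hr` to replace `r (y + s/2)` by `(a - sc)(b + s(d+1)/2)`.
  linear_combination -(y + s / 2) ^ 2 * key
    - (r * (y + s / 2) + (p 0 - s * p 2) * (p 1 + s * (d + 1) / 2)) / 2 * hr
    - (y + s / 2) ^ 2 * (p 2 ^ 2 + ((d + 1) ^ 2 - 1) / 4) * hs

end Casimir

end BannaiIto
end

/-! ### Irreducibility for generic real parameters -/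

noncomputable section

namespace BannaiIto

open Polynomial (aeval)

/-- Real parameters for which `O_d(a,b,c)` is irreducible, and `Y` is diagonalizable on it with distinct
eigenvalues of one sign pattern. -/
structure IsGeneric (d : ℕ) (a b c : ℝ) : Prop where
  lt : 2 * b < -(d + 1)
  add_add : (d + 1) / 2 ≤ |b + (a + c)|
  sub_add : (d + 1) / 2 ≤ |b - (a + c)|
  add_sub : (d + 1) / 2 ≤ |b + (a - c)|
  sub_sub : (d + 1) / 2 ≤ |b - (a - c)|

variable {d : ℕ} {a b c : ℝ}

/-- A zero of the first factor makes one of the four combinations `b ± (a ± c)` equal to `(d+1)/2 -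
(j+1)`, which lies strictly between `-(d+1)/2` and `(d+1)/2`. A zero of the second forces `j ∈ {-1,
d}` or `2b ∈ {-(j+1), d - j}`, against the bound on `b`. -/
lemma IsGeneric.ladder_ne_zero (hg : IsGeneric d a b c) {j : ℕ} (hj : j + 1 ≤ d) {s : ℝ}
    (hs : s = 1 ∨ s = -1) (h : ((b - d / 2 + j + 1 / 2) ^ 2 - (a - s * c) ^ 2) *
      ((b - d / 2 + j + 1 / 2) ^ 2 - (b + s * (d + 1) / 2) ^ 2) = 0) : False := by
  have hj : (j : ℝ) + 1 ≤ d := by exact_mod_cast hj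
  have hj0 : (0 : ℝ) ≤ j := Nat.cast_nonneg j
  have hlt := hg.lt
  have habs : ∀ x : ℝ, (d + 1) / 2 ≤ |x| → x = (d + 1) / 2 - (j + 1) → False := by
    intro x hx he
    rcases le_abs.1 hx with h | h <;> linarith
  rcases mul_eq_zero.1 h with h | h
  · rcases hs with rfl | rfl <;> rcases sq_eq_sq_iff_eq_or_eq_neg.1 (sub_eq_zero.1 h) with h | h
    · exact habs _ hg.sub_sub (by linarith)
    · exact habs _ hg.add_sub (by linarith)
    · exact habs _ hg.sub_add (by linarith)
    · exact habs _ hg.add_add (by linarith)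
  · rcases hs with rfl | rfl <;> rcases sq_eq_sq_iff_eq_or_eq_neg.1 (sub_eq_zero.1 h) with h | h <;>
    linarith

/-- The ones below the diagonal of `X` make `v_0` a cyclic vector. -/
lemma eq_top_of_oBasis_mem {W : Submodule ℂ (Fin (d + 1) → ℂ)} (hd : Even d) (a b c : ℂ)
    (hX : ∀ w ∈ W, oEnd d a b c 0 w ∈ W) (h0 : oBasis d 0 ∈ W) : W = ⊤ := by
  have hB := oBasis_isStandardBasis hd a b c
  have hmem : ∀ i, i ≤ d → oBasis d i ∈ W := by
    intro i
    induction i with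
    | zero => exact fun _ => h0
    | succ i ih =>
      intro hi
      have := hB.apply_X i (by omega)
      rw [eq_sub_of_add_eq' this.symm]
      exact W.sub_mem (hX _ (ih (by omega))) (W.smul_mem _ (ih (by omega)))
  rw [eq_top_iff, ← (Pi.basisFun ℂ (Fin (d + 1))).span_eq, Submodule.span_le]
  rintro _ ⟨i, rfl⟩
  rw [Pi.basisFun_apply, ← oBasis_eq_single]
  exact hmem i i.is_le

/-- The locus where the identity holds is stable under `X`, by commutation, and contains `v_0`,
which is extremal for `Y`. -/
lemma oEnd_casimir (hd : Even d) (a b c : ℂ) (v : Fin (d + 1) → ℂ) :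
    oEnd d a b c 0 (oEnd d a b c 0 v) + oEnd d a b c 1 (oEnd d a b c 1 v)
      + oEnd d a b c 2 (oEnd d a b c 2 v) = (a ^ 2 + b ^ 2 + c ^ 2 + ((d + 1) ^ 2 - 1) / 4) • v := by
  have h := oEnd_satisfiesBI hd a b c
  have hB := oBasis_isStandardBasis hd a b c
  set A := oEnd d a b c with hA
  have key : LinearMap.eqLocus (A 0 * A 0 + A 1 * A 1 + A 2 * A 2)
      ((a ^ 2 + b ^ 2 + c ^ 2 + ((d + 1) ^ 2 - 1) / 4 : ℂ) • 1) = ⊤ := by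
    refine eq_top_of_oBasis_mem hd a b c (fun w hw => ?_) ?_
    · have hw : A 0 (A 0 w) + A 1 (A 1 w) + A 2 (A 2 w) =
        (a ^ 2 + b ^ 2 + c ^ 2 + ((d + 1) ^ 2 - 1) / 4 : ℂ) • w := hw
      change A 0 (A 0 (A 0 w)) + A 1 (A 1 (A 0 w)) + A 2 (A 2 (A 0 w)) =
        (a ^ 2 + b ^ 2 + c ^ 2 + ((d + 1) ^ 2 - 1) / 4 : ℂ) • A 0 w
      rw [h.casimir_commute, hw, map_smul]
    · refine h.casimir_extremal ?_ (hB.apply_zero_add_two h)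
      rw [hB.apply_Y_zero, theta]
      congr 1
      simp
      ring
  have : v ∈ LinearMap.eqLocus (A 0 * A 0 + A 1 * A 1 + A 2 * A 2)
      ((a ^ 2 + b ^ 2 + c ^ 2 + ((d + 1) ^ 2 - 1) / 4 : ℂ) • 1) := key ▸ Submodule.mem_top
  exact this


/-- The ladder operator lies in the algebra of the three operators, so it preserves `W`; genericity
keeps the image nonzero. -/
lemma oEnd_descend (hd : Even d) (hg : IsGeneric d a b c) {W : Submodule ℂ (Fin (d + 1) → ℂ)}
    (hW : ∀ i, ∀ w ∈ W, oEnd d a b c i w ∈ W) {j : ℕ} (hj : j + 1 ≤ d)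
    (h : ∃ w ∈ W, w ≠ 0 ∧ oEnd d a b c 1 w = theta d b (j + 1) • w) :
    ∃ w ∈ W, w ≠ 0 ∧ oEnd d a b c 1 w = theta d b j • w := by
  obtain ⟨w, hw, hw0, hY⟩ := h
  -- With `s = (-1)^j` the ladder goes down: `-s - θ*_{j+1} = θ*_j`.
  obtain ⟨s, hs, hsj⟩ : ∃ s : ℝ, (s = 1 ∨ s = -1) ∧ ((-1) ^ j : ℂ) = s := by
    rcases Nat.even_or_odd j with h | h
    · exact ⟨1, Or.inl rfl, by simp [h.neg_one_pow]⟩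
    · exact ⟨-1, Or.inr rfl, by simp [h.neg_one_pow]⟩
  have hs2 : (s : ℂ) ^ 2 = 1 := by rcases hs with rfl | rfl <;> simp
  have hs0 : (s : ℂ) ≠ 0 := by rintro h; simp [h] at hs2
  have hne : (2 * b - d + 2 * j + 1 : ℂ) ≠ 0 := by
    have hj : (j : ℝ) + 1 ≤ d := by exact_mod_cast hj
    have hlt := hg.lt
    have : 2 * b - d + 2 * j + 1 ≠ 0 := by linarith
    exact_mod_cast this
  have hrel := oEnd_satisfiesBI hd a b c
  set y := theta d (b : ℂ) (j + 1) with hy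
  have hy' : y = -s * (2 * b - d + 2 * j + 2) / 2 := by
    rw [hy, theta, pow_succ, hsj]; push_cast; ring
  have hr : ((a - s * c) * (2 * b + s * (d + 1)) / (2 * y + s)) * (2 * y + s)
      = (a - s * c : ℂ) * (2 * b + s * (d + 1)) := by
    refine div_mul_cancel₀ _ ?_
    rw [show 2 * y + s = -s * (2 * b - d + 2 * j + 1) by rw [hy']; ring]
    exact mul_ne_zero (neg_ne_zero.2 hs0) hne
  set r := (a - s * c) * (2 * b + s * (d + 1)) / (2 * y + s) with hrdef
  refine ⟨oEnd d a b c 0 w - (s : ℂ) • oEnd d a b c 2 w - r • w,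
    W.sub_mem (W.sub_mem (hW 0 w hw) (W.smul_mem _ (hW 2 w hw))) (W.smul_mem _ hw), fun h0 => ?_, ?_⟩
  · have h := hrel.ladder_zero hs2 hw0 (oEnd_casimir hd a b c w) hY hr h0
    simp only [Matrix.cons_val_zero, Matrix.cons_val_one, Matrix.cons_val_two, Matrix.head_cons,
      Matrix.tail_cons] at h
    refine hg.ladder_ne_zero hj hs ?_
    have e : (y + s / 2) ^ 2 = ((b - d / 2 + j + 1 / 2) ^ 2 : ℂ) := by
      rw [hy']
      linear_combination (b - d / 2 + j + 1 / 2 : ℂ) ^ 2 * hs2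
    rw [e] at h
    refine Complex.ofReal_eq_zero.1 ?_
    push_cast
    exact h
  · rw [hrel.ladder hs2 hY hr]
    congr 1
    rw [hy', theta, hsj]
    ring

/-- `Y` is upper triangular and `θ*_0` occurs only once on the diagonal, so the coordinates of index
`d, d - 1, …, 1` vanish successively. -/
lemma oEnd_eigenvector_zero (hd : Even d) {a b c : ℂ}
    (hb : ∀ i : ℕ, 1 ≤ i → i ≤ d → theta d b i ≠ theta d b 0) {w : Fin (d + 1) → ℂ}
    (h : oEnd d a b c 1 w = theta d b 0 • w) : w = w 0 • oBasis d 0 := by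
  set f : ℕ → ℂ := fun n => if h : n < d + 1 then w ⟨n, h⟩ else 0 with hf
  have hfw : ∀ i : Fin (d + 1), f i = w i := fun i => by
    simp only [hf, dif_pos i.isLt, Fin.eta]
  have hfun : (fun j : Fin (d + 1) => f j) = w := funext hfw
  have key : ∀ m i : ℕ, 1 ≤ i → d < i + m → f i = 0 := by
    intro m
    induction m with
    | zero => intro i _ hi; exact dif_neg (by omega)
    | succ m ih =>
      intro i h1 hi
      by_cases hid : i ≤ d
      · have e := oY_mulVec hd a b c f ⟨i, by omega⟩
        rw [hfun] at e
        have e' := congrFun h ⟨i, by omega⟩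
        have e'' := e.symm.trans e'
        simp only [ih (i + 1) (by omega) (by omega), mul_zero, add_zero, Pi.smul_apply,
          smul_eq_mul, ← hfw] at e''
        exact (mul_eq_zero.1 (show (theta d b i - theta d b 0) * f i = 0 by
          linear_combination e'')).resolve_left (sub_ne_zero.2 (hb i h1 hid))
      · exact dif_neg (by omega)
  funext i
  rw [← hfw i]
  by_cases hi : (i : ℕ) = 0
  · have : i = 0 := by ext; simpa using hi
    subst this
    simp [oBasis, hf]
  · simp [key (d + 1) i (by omega) (by omega), oBasis, hi]

lemma IsGeneric.theta_ne (hg : IsGeneric d a b c) {i : ℕ} (h1 : 1 ≤ i) (hi : i ≤ d) :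
    theta d (b : ℂ) i ≠ theta d b 0 := by
  have hi : (i : ℝ) ≤ d := by exact_mod_cast hi
  have h1 : (1 : ℝ) ≤ i := by exact_mod_cast h1
  have hlt := hg.lt
  rcases Nat.even_or_odd i with h | h <;> simp only [theta, h.neg_one_pow, pow_zero] <;> intro e
  · have : (i : ℝ) = 0 := by
      have : ((i : ℝ) : ℂ) = (0 : ℝ) := by push_cast at e ⊢; linear_combination e
      exact_mod_cast this
    linarith
  · have : 2 * b - d + i = 0 := by
      have : ((2 * b - d + i : ℝ) : ℂ) = (0 : ℝ) := by push_cast at e ⊢; linear_combination -e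
      exact_mod_cast this
    linarith

lemma exists_theta_of_eigenvector (hd : Even d) {a b c : ℂ} {w : Fin (d + 1) → ℂ} (hw : w ≠ 0) {y : ℂ}
    (h : oEnd d a b c 1 w = y • w) : ∃ j ≤ d, y = theta d b j := by
  have := Module.End.aeval_apply_of_hasEigenvector (p := thetaPoly d b)
    ⟨Module.End.mem_eigenspace_iff.2 h, hw⟩
  rw [aeval_oEnd_one hd, LinearMap.zero_apply, eq_comm, smul_eq_zero, or_iff_left hw,
    thetaPoly_eq_prod hd, Polynomial.eval_prod, Finset.prod_eq_zero_iff] at this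
  obtain ⟨i, -, hi⟩ := this
  exact ⟨i, i.is_le, by simpa [sub_eq_zero] using hi⟩

/-- A nonzero invariant subspace contains an eigenvector of `Y`, hence, going down the ladder, one
for `θ*_0`. That one is a multiple of the cyclic vector `v_0`. -/
lemma IsGeneric.isBITriple (hd : Even d) (hg : IsGeneric d a b c) :
    IsBITriple d (oEnd d a b c) ![(a : ℂ), b, c] where
  toSatisfiesBI := oEnd_satisfiesBI hd a b c
  irred W hW := by
    refine or_iff_not_imp_left.2 fun hbot => ?_
    have : Nontrivial W := Submodule.nontrivial_iff_ne_bot.2 hbot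
    obtain ⟨y, hy⟩ := Module.End.exists_eigenvalue ((oEnd d (a : ℂ) b c 1).restrict (hW 1))
    obtain ⟨w, hw⟩ := hy.exists_hasEigenvector
    have hw0 : (w : Fin (d + 1) → ℂ) ≠ 0 := fun h => hw.2 (Subtype.ext h)
    have hwy : oEnd d (a : ℂ) b c 1 w = y • (w : Fin (d + 1) → ℂ) := congrArg Subtype.val hw.apply_eq_smul
    obtain ⟨j, hj, rfl⟩ := exists_theta_of_eigenvector hd hw0 hwy
    have key : ∀ j ≤ d, (∃ w ∈ W, w ≠ 0 ∧ oEnd d (a : ℂ) b c 1 w = theta d b j • w) →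
        ∃ w ∈ W, w ≠ 0 ∧ oEnd d (a : ℂ) b c 1 w = theta d b 0 • w := by
      intro j
      induction j with
      | zero => exact fun _ h => h
      | succ j ih => exact fun hj h => ih (by omega) (oEnd_descend hd hg hW hj h)
    obtain ⟨v, hv, hv0, hvy⟩ := key j hj ⟨w, w.2, hw0, hwy⟩
    have e := oEnd_eigenvector_zero hd (fun i h1 h2 => hg.theta_ne h1 h2) hvy
    have hv0' : v 0 ≠ 0 := fun h => hv0 (by rw [e, h, zero_smul])
    refine eq_top_of_oBasis_mem hd a b c (hW 0) ?_
    rw [e] at hv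
    exact (W.smul_mem_iff hv0').1 hv

end BannaiIto
end

/-! ### Twists of `O_d(a,b,c)` as modules -/

noncomputable section

namespace BannaiIto

open Polynomial (aeval)

/-- An additive map commuting with the scalars and the generators is `𝔅ℑ`-linear. -/
def BI.linearMapOfGen {V W : Type*} [AddCommGroup V] [Module BI V] [AddCommGroup W] [Module BI W]
    (φ : V →+ W) (hc : ∀ (c : ℂ) v, φ (algebraMap ℂ BI c • v) = algebraMap ℂ BI c • φ v)
    (hg : ∀ i v, φ (gen i • v) = gen i • φ v) : V →ₗ[BI] W where
  toFun := φ
  map_add' := map_add φ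
  map_smul' x := by
    induction x using BI.induction with
    | hs c => exact hc c
    | hg i => exact hg i
    | ha x y hx hy =>
      intro v
      rw [add_smul, map_add, hx, hy, RingHom.id_apply, RingHom.id_apply, RingHom.id_apply, add_smul]
    | hm x y hx hy =>
      intro v
      rw [mul_smul, hx, hy, RingHom.id_apply, RingHom.id_apply, RingHom.id_apply, mul_smul]

/-- The vectors of `O_d(a,b,c)` as functions. -/
def OMod.ofFun (d : ℕ) (hd : Even d) (a b c : ℂ) : (Fin (d + 1) → ℂ) ≃+ OMod d hd a b c :=
  AddEquiv.refl (Fin (d + 1) → ℂ)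

lemma OMod.gen_smul_ofFun (d : ℕ) (hd : Even d) (a b c : ℂ) (i : Fin 3) (v : Fin (d + 1) → ℂ) :
    gen i • ofFun d hd a b c v = ofFun d hd a b c (oEnd d a b c i v) :=
  OMod.gen_smul d hd a b c i v

lemma OMod.algebraMap_smul_ofFun (d : ℕ) (hd : Even d) (a b c : ℂ) (z : ℂ) (v : Fin (d + 1) → ℂ) :
    algebraMap ℂ BI z • ofFun d hd a b c v = ofFun d hd a b c (z • v) := by
  change rep d hd a b c (algebraMap ℂ BI z) _ = _
  rw [AlgHom.commutes]
  rfl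

/-- The vectors of a twist of `O_d(a,b,c)` as functions. -/
def twistedOOfFun (g : ℤˣ × ℤˣ) (σ : Equiv.Perm (Fin 3)) (d : ℕ) (hd : Even d) (a b c : ℂ) :
    (Fin (d + 1) → ℂ) ≃+ TwistedO g σ d hd a b c :=
  AddEquiv.refl (Fin (d + 1) → ℂ)

lemma algebraMap_smul_twistedOOfFun (g : ℤˣ × ℤˣ) (σ : Equiv.Perm (Fin 3)) (d : ℕ) (hd : Even d)
    (a b c : ℂ) (z : ℂ) (v : Fin (d + 1) → ℂ) :
    algebraMap ℂ BI z • twistedOOfFun g σ d hd a b c v = twistedOOfFun g σ d hd a b c (z • v) := by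
  rw [Twist.smul_def, AlgEquiv.commutes]
  exact OMod.algebraMap_smul_ofFun d hd a b c z v

lemma gen_smul_twistedOOfFun (g : ℤˣ × ℤˣ) (σ : Equiv.Perm (Fin 3)) (d : ℕ) (hd : Even d)
    (a b c : ℂ) (i : Fin 3) (v : Fin (d + 1) → ℂ) :
    gen i • twistedOOfFun g σ d hd a b c v =
      twistedOOfFun g σ d hd a b c (twistFam g σ (oEnd d a b c) i v) := by
  have e : twistAut g σ (gen i) = algebraMap ℂ BI ((signOf g (σ i) : ℤ) : ℂ) * gen (σ i) := by
    rw [← Algebra.smul_def]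
    exact twistHom_gen g σ i
  rw [Twist.smul_def, e]
  change (algebraMap ℂ BI ((signOf g (σ i) : ℤ) : ℂ) * gen (σ i)) • OMod.ofFun d hd a b c v = _
  rw [mul_smul, OMod.gen_smul_ofFun, OMod.algebraMap_smul_ofFun]
  rfl

lemma twistedO_isSimpleModule (g : ℤˣ × ℤˣ) (σ : Equiv.Perm (Fin 3)) {d : ℕ} (hd : Even d) {a b c : ℂ}
    (h : IsBITriple d (oEnd d a b c) ![a, b, c]) : IsSimpleModule BI (TwistedO g σ d hd a b c) := by
  have hnt : Nontrivial (TwistedO g σ d hd a b c) :=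
    (twistedOOfFun g σ d hd a b c).symm.toEquiv.nontrivial
  rw [isSimpleModule_iff]
  refine { eq_bot_or_eq_top := fun N => ?_ }
  let W : Submodule ℂ (Fin (d + 1) → ℂ) :=
    { carrier := {v | twistedOOfFun g σ d hd a b c v ∈ N}
      add_mem' := fun {v w} hv hw => by
        simp only [Set.mem_ofPred_eq, map_add] at *
        exact N.add_mem hv hw
      zero_mem' := by simp only [Set.mem_ofPred_eq, map_zero]; exact N.zero_mem
      smul_mem' := fun z v hv => by
        simp only [Set.mem_ofPred_eq] at *
        rw [← algebraMap_smul_twistedOOfFun]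
        exact N.smul_mem _ hv }
  have hW : ∀ v, v ∈ W ↔ twistedOOfFun g σ d hd a b c v ∈ N := fun v => Iff.rfl
  have hsurj := (twistedOOfFun g σ d hd a b c).surjective
  rcases (h.twist g σ).irred W (fun i w hw => by
    rw [hW, ← gen_smul_twistedOOfFun]
    exact N.smul_mem _ hw) with hb | ht
  · left
    rw [eq_bot_iff]
    intro x hx
    obtain ⟨v, rfl⟩ := hsurj x
    rw [← hW, hb, Submodule.mem_bot] at hx
    rw [hx, map_zero]
    exact Submodule.zero_mem _
  · right
    rw [eq_top_iff]
    intro x _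
    obtain ⟨v, rfl⟩ := hsurj x
    rw [← hW, ht]
    trivial

/-- Sending the standard basis to `w` intertwines `X` and `Y` by construction, and `Z` because both
sides satisfy the same relation for `{X, Y}`. -/
lemma OMod_equiv_twistedO (g : ℤˣ × ℤˣ) (σ : Equiv.Perm (Fin 3)) {d : ℕ} (hd : Even d)
    {a b c a' b' c' : ℂ} (ha : ![a', b', c'] = twistFam g σ ![a, b, c]) {w : ℕ → Fin (d + 1) → ℂ}
    (hw : IsStandardBasis d (twistFam g σ (oEnd d a b c) 0) (twistFam g σ (oEnd d a b c) 1) a' b' c' w) :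
    Nonempty (OMod d hd a' b' c' ≃ₗ[BI] TwistedO g σ d hd a b c) := by
  set A := twistFam g σ (oEnd d a b c) with hA
  have hrel : SatisfiesBI d A ![a', b', c'] := ha ▸ (oEnd_satisfiesBI hd a b c).twist g σ
  have hrel' := oEnd_satisfiesBI hd a' b' c'
  have hB := oBasis_isStandardBasis hd a' b' c'
  set B := oEnd d a' b' c' with hBdef
  let E := (basisOfLinearIndependentOfCardEqFinrank hw.linearIndependent (by simp)).equivFun.symm
  have hE : ∀ i ≤ d + 1, E (oBasis d i) = w i := by
    intro i hi
    rcases hi.eq_or_lt with rfl | hi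
    · rw [hB.last, hw.last, map_zero]
    · have := oBasis_eq_single d ⟨i, hi⟩
      simp only at this
      rw [this]
      simp [E, Module.Basis.equivFun_symm_apply, Pi.single_apply]
  have hX : ∀ v, E (B 0 v) = A 0 (E v) := by
    suffices h : E.toLinearMap ∘ₗ B 0 = A 0 ∘ₗ E.toLinearMap from fun v => LinearMap.congr_fun h v
    refine (Pi.basisFun ℂ (Fin (d + 1))).ext fun i => ?_
    rw [Pi.basisFun_apply, ← oBasis_eq_single]
    have := i.is_le
    simp only [LinearMap.comp_apply, LinearEquiv.coe_coe]
    rw [hB.apply_X i (by omega), map_add, map_smul, hE i (by omega), hE (i + 1) (by omega),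
      hw.apply_X i (by omega)]
  have hY : ∀ v, E (B 1 v) = A 1 (E v) := by
    suffices h : E.toLinearMap ∘ₗ B 1 = A 1 ∘ₗ E.toLinearMap from fun v => LinearMap.congr_fun h v
    refine (Pi.basisFun ℂ (Fin (d + 1))).ext fun i => ?_
    rw [Pi.basisFun_apply, ← oBasis_eq_single]
    simp only [LinearMap.comp_apply, LinearEquiv.coe_coe]
    obtain ⟨_ | i, hi⟩ := i
    · rw [hB.apply_Y_zero, map_smul, hE 0 (by omega), hw.apply_Y_zero]
    · simp only
      rw [hB.apply_Y_succ i (by omega), map_add, map_smul, map_smul, hE i (by omega),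
        hE (i + 1) (by omega), hw.apply_Y_succ i (by omega)]
  have hZ : ∀ v, E (B 2 v) = A 2 (E v) := by
    intro v
    rw [eq_sub_of_add_eq (hrel'.rel 0 1 2 (by decide) (by decide) (by decide) v).symm,
      eq_sub_of_add_eq (hrel.rel 0 1 2 (by decide) (by decide) (by decide) (E v)).symm]
    simp only [map_sub, map_add, map_smul, hX, hY]
  let φ : OMod d hd a' b' c' ≃+ TwistedO g σ d hd a b c :=
    ((OMod.ofFun d hd a' b' c').symm.trans E.toAddEquiv).trans (twistedOOfFun g σ d hd a b c)
  have hφ : ∀ v, φ (OMod.ofFun d hd a' b' c' v) = twistedOOfFun g σ d hd a b c (E v) := fun v => rfl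
  refine ⟨LinearEquiv.ofBijective (BI.linearMapOfGen φ.toAddMonoidHom ?_ ?_) φ.bijective⟩
  · intro z x
    obtain ⟨v, rfl⟩ := (OMod.ofFun d hd a' b' c').surjective x
    rw [OMod.algebraMap_smul_ofFun]
    change φ _ = _ • φ _
    rw [hφ, hφ, map_smul, algebraMap_smul_twistedOOfFun]
  · intro i x
    obtain ⟨v, rfl⟩ := (OMod.ofFun d hd a' b' c').surjective x
    rw [OMod.gen_smul_ofFun]
    change φ _ = _ • φ _
    rw [hφ, hφ, gen_smul_twistedOOfFun]
    congr 1
    rcases fin3_cases i with rfl | rfl | rfl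
    · exact hX v
    · exact hY v
    · exact hZ v

/-- `X` and `Y` are triangular, but `Z` is not. For `Z` the extremal vector `v_0` of `Y` is used;
the eigenvalue to be excluded would require `2b + 1 + j = 0` or `j = d + 1`. -/
lemma IsGeneric.aeval_oEnd (hd : Even d) {a b c : ℝ} (hg : IsGeneric d a b c) (i : Fin 3) :
    aeval (oEnd d (a : ℂ) b c i) (thetaPoly d ((![(a : ℂ), b, c] : Fin 3 → ℂ) i)) = 0 := by
  rcases fin3_cases i with rfl | rfl | rfl
  · exact aeval_oEnd_zero hd a b c
  · exact aeval_oEnd_one hd a b c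
  · refine aeval_thetaPoly_two hd (hg.isBITriple hd)
      ((oBasis_isStandardBasis hd (a : ℂ) b c).hasExtremal (oEnd_satisfiesBI hd a b c)) fun w hw => ?_
    by_contra hw0
    obtain ⟨j, hj, e⟩ := exists_theta_of_eigenvector hd hw0 hw
    have hj : (j : ℝ) ≤ d := by exact_mod_cast hj
    have hj0 : (0 : ℝ) ≤ j := Nat.cast_nonneg j
    have hlt := hg.lt
    rcases Nat.even_or_odd j with h | h <;>
    simp only [theta, h.neg_one_pow, Matrix.cons_val_one, Matrix.cons_val_zero] at e
    · have : 2 * b + 1 + j = 0 := by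
        refine Complex.ofReal_eq_zero.1 ?_
        push_cast
        linear_combination -e
      linarith
    · have : (j : ℝ) - (d + 1) = 0 := by
        refine Complex.ofReal_eq_zero.1 ?_
        push_cast
        linear_combination e
      linarith

/-- For generic real parameters, a twist of `O_d(a,b,c)` is irreducible, and it is isomorphic to the
untwisted module whose parameters are obtained from `a, b, c` by the signed permutation. -/
theorem IsGeneric.isIrreducibleIso (g : ℤˣ × ℤˣ) (σ : Equiv.Perm (Fin 3)) {d : ℕ} (hd : Even d)
    {a b c : ℂ} {ar br cr : ℝ} (hg : IsGeneric d ar br cr) (ha : a = ar) (hb : b = br) (hc : c = cr)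
    {a' b' c' : ℂ} (ha' : ![a', b', c'] = twistFam g σ ![a, b, c]) :
    IsIrreducibleIso (TwistedO g σ d hd a b c) (OMod d hd a' b' c') := by
  subst ha hb hc
  have h := hg.isBITriple hd
  -- Starting from `v_0`, which is extremal for `Y`, extremal vectors are obtained for all operators
  -- and signs. The twist therefore has one for its own first operator.
  have hext := ((oBasis_isStandardBasis hd (ar : ℂ) br cr).hasExtremal
    (oEnd_satisfiesBI hd ar br cr)).all hd h (by simp) (hg.aeval_oEnd hd)
  obtain ⟨w, hw⟩ := exists_isStandardBasis hd (h.twist g σ) (by simp)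
    (aeval_twist hd (hg.aeval_oEnd hd) g σ 1) ((hasExtremal_twist g σ 0 1).2 (hext _ _))
  rw [← ha'] at hw
  obtain ⟨e⟩ := OMod_equiv_twistedO g σ hd ha' hw
  exact ⟨twistedO_isSimpleModule g σ hd h, ⟨e.symm⟩⟩

end BannaiIto
end

/-! ### Dunkl monogenics in coefficients -/

noncomputable section

namespace BannaiIto

open MvPolynomial

/-- The exponent `p` of `x_j^a x_{j+1}^b x_{j+2}^c`, indices modulo 3. -/
def mon (j : Fin 3) (a b c : ℕ) : Fin 3 →₀ ℕ :=
  Finsupp.single j a + Finsupp.single (j + 1) b + Finsupp.single (j + 2) c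

section mon
variable (j : Fin 3) (a b c : ℕ)

lemma mon_apply_zero : mon j a b c j = a := by
  rcases fin3_cases j with rfl | rfl | rfl <;> simp [mon]

lemma mon_apply_one : mon j a b c (j + 1) = b := by
  rcases fin3_cases j with rfl | rfl | rfl <;> simp [mon]

lemma mon_apply_two : mon j a b c (j + 2) = c := by
  rcases fin3_cases j with rfl | rfl | rfl <;> simp [mon]

lemma mon_add_zero : mon j a b c + Finsupp.single j 1 = mon j (a + 1) b c := by
  rw [mon, mon, Finsupp.single_add]; abel

lemma mon_add_one : mon j a b c + Finsupp.single (j + 1) 1 = mon j a (b + 1) c := by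
  rw [mon, mon, Finsupp.single_add]; abel

lemma mon_add_two : mon j a b c + Finsupp.single (j + 2) 1 = mon j a b (c + 1) := by
  rw [mon, mon, Finsupp.single_add]; abel

lemma eq_mon (d : Fin 3 →₀ ℕ) : d = mon j (d j) (d (j + 1)) (d (j + 2)) := by
  ext i
  rcases fin3_cases j with rfl | rfl | rfl <;> rcases fin3_cases i with rfl | rfl | rfl <;>
  simp [mon]

lemma degree_mon : mon j a b c 0 + mon j a b c 1 + mon j a b c 2 = a + b + c := by
  rcases fin3_cases j with rfl | rfl | rfl <;> simp [mon] <;> omega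

end mon

/-- The factor in `T_i x_i^p = γ(p) x_i^{p-1}`. -/
def gam (κ : ℝ) (p : ℕ) : ℂ := p + (1 - (-1) ^ p) * κ

/-- For even `p` the factor is `p` itself, and for odd `p` it is `p + 2κ`. -/
lemma gam_eq_zero {κ : ℝ} {p : ℕ} (hp : p ≠ 0) (h : gam κ p = 0) : tval κ = p := by
  rcases Nat.even_or_odd p with he | ho
  · rw [gam, he.neg_one_pow] at h
    simp [hp] at h
  · have h2 : 2 * κ = -(p : ℝ) := by
      rw [gam, ho.neg_one_pow] at h
      have : (p : ℝ) + 2 * κ = 0 := by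
        refine Complex.ofReal_eq_zero.1 ?_
        push_cast
        linear_combination h
      linarith
    rw [tval, if_pos ⟨p, ho, h2⟩, h2, neg_neg, Nat.floor_natCast]

lemma gam_of_tval {κ : ℝ} {t : ℕ} (h : tval κ = t) : gam κ t = 0 := by
  obtain ⟨ho, he⟩ := tval_eq_coe h
  have := congrArg (fun x : ℝ => (x : ℂ)) he
  push_cast at this
  rw [gam, ho.neg_one_pow]
  linear_combination this

/-- The coefficient of a monomial in a `ℂ²`-valued polynomial. -/
def spinorCoeff (d : Fin 3 →₀ ℕ) (f : Spinor) : Fin 2 → ℂ := fun s => coeff d (f s)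

lemma spinorCoeff_add (d : Fin 3 →₀ ℕ) (f g : Spinor) :
    spinorCoeff d (f + g) = spinorCoeff d f + spinorCoeff d g := by
  funext s; simp [spinorCoeff]

lemma spinorCoeff_smul (d : Fin 3 →₀ ℕ) (z : ℂ) (f : Spinor) :
    spinorCoeff d (z • f) = z • spinorCoeff d f := by
  funext s; simp [spinorCoeff]

lemma spinorCoeff_tensorOp (d : Fin 3 →₀ ℕ) (A : Matrix (Fin 2) (Fin 2) ℂ)
    (T : MvPolynomial (Fin 3) ℂ →ₗ[ℂ] MvPolynomial (Fin 3) ℂ) (f : Spinor) :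
    spinorCoeff d (tensorOp A T f) = A.mulVec fun s => coeff d (T (f s)) := by
  funext r
  simp [spinorCoeff, tensorOp, Matrix.mulVec, dotProduct]

lemma coeff_dunkl_eq_gam (k : Fin 3 → ℝ) (i : Fin 3) (f : MvPolynomial (Fin 3) ℂ) (d : Fin 3 →₀ ℕ) :
    coeff d (dunkl k i f) = gam (k i) (d i + 1) * coeff (d + Finsupp.single i 1) f := by
  rw [coeff_dunkl, gam, pow_succ]
  push_cast
  ring

/-- Written with exponents counted cyclically from `j`, so that one computation serves all three
parts of the theorem. -/
lemma spinorCoeff_diracDunkl (k : Fin 3 → ℝ) (j : Fin 3) (f : Spinor) (a b c : ℕ) :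
    spinorCoeff (mon j a b c) (diracDunkl k f) =
      gam (k j) (a + 1) • (pauli j).mulVec (spinorCoeff (mon j (a + 1) b c) f)
      + gam (k (j + 1)) (b + 1) • (pauli (j + 1)).mulVec (spinorCoeff (mon j a (b + 1) c) f)
      + gam (k (j + 2)) (c + 1) • (pauli (j + 2)).mulVec (spinorCoeff (mon j a b (c + 1)) f) := by
  have hsum : diracDunkl k f = tensorOp (pauli j) (dunkl k j) f
      + tensorOp (pauli (j + 1)) (dunkl k (j + 1)) f + tensorOp (pauli (j + 2)) (dunkl k (j + 2)) f := by
    rw [diracDunkl, Fin.sum_univ_three]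
    rcases fin3_cases j with rfl | rfl | rfl
    · rfl
    · simp only [LinearMap.add_apply, show (1 : Fin 3) + 1 = 2 from rfl, show (1 : Fin 3) + 2 = 0 from rfl]
      abel
    · simp only [LinearMap.add_apply, show (2 : Fin 3) + 1 = 0 from rfl, show (2 : Fin 3) + 2 = 1 from rfl]
      abel
  rw [hsum, spinorCoeff_add, spinorCoeff_add]
  simp only [spinorCoeff_tensorOp, coeff_dunkl_eq_gam, mon_apply_zero, mon_apply_one, mon_apply_two,
    mon_add_zero, mon_add_one, mon_add_two, ← Matrix.mulVec_smul]
  rfl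

lemma pauli_mul_self (j : Fin 3) : pauli j * pauli j = 1 := by
  rcases fin3_cases j with rfl | rfl | rfl <;>
  · ext r s
    fin_cases r <;> fin_cases s <;> simp [pauli, Matrix.mul_apply]

lemma pauli_mul_succ (j : Fin 3) : pauli j * pauli (j + 1) = Complex.I • pauli (j + 2) := by
  rcases fin3_cases j with rfl | rfl | rfl <;>
  · ext r s
    fin_cases r <;> fin_cases s <;> simp [pauli, Matrix.mul_apply]

lemma pauli_succ_mul (j : Fin 3) : pauli (j + 1) * pauli j = -Complex.I • pauli (j + 2) := by
  rcases fin3_cases j with rfl | rfl | rfl <;>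
  · ext r s
    fin_cases r <;> fin_cases s <;> simp [pauli, Matrix.mul_apply]

/-- The two eigenlines produce the two copies in the theorem. -/
lemma exists_diagonalize_pauli (j : Fin 3) : ∃ P Q : Matrix (Fin 2) (Fin 2) ℂ, P * Q = 1 ∧ Q * P = 1 ∧
    P * pauli j = Matrix.diagonal ![1, -1] * P := by
  rcases fin3_cases j with rfl | rfl | rfl
  · refine ⟨!![1, 1; 1, -1], (1 / 2 : ℂ) • !![1, 1; 1, -1], ?_, ?_, ?_⟩ <;>
    · ext r s
      fin_cases r <;> fin_cases s <;> simp [pauli, Matrix.mul_apply] <;> norm_num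
  · refine ⟨!![1, -Complex.I; 1, Complex.I], (1 / 2 : ℂ) • !![1, 1; Complex.I, -Complex.I], ?_, ?_, ?_⟩ <;>
    · ext r s
      fin_cases r <;> fin_cases s <;> simp [pauli, Matrix.mul_apply] <;> ring_nf <;> simp <;> norm_num
  · refine ⟨1, 1, by simp, by simp, ?_⟩
    ext r s
    fin_cases r <;> fin_cases s <;> simp [pauli, Matrix.mul_apply]

lemma tensorOp_one_apply (T : MvPolynomial (Fin 3) ℂ →ₗ[ℂ] MvPolynomial (Fin 3) ℂ) (f : Spinor)
    (s : Fin 2) : tensorOp 1 T f s = T (f s) := by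
  fin_cases s <;> simp [tensorOp]

lemma coeff_mulX_zero {i : Fin 3} {d : Fin 3 →₀ ℕ} (hd : d i = 0) (q : MvPolynomial (Fin 3) ℂ) :
    coeff d (mulX i q) = 0 := by
  rw [mulX, LinearMap.mulLeft_apply, coeff_X_mul', if_neg (by simpa using hd)]

lemma coeff_mulX_add {i : Fin 3} {d : Fin 3 →₀ ℕ} (q : MvPolynomial (Fin 3) ℂ) :
    coeff (d + Finsupp.single i 1) (mulX i q) = coeff d q := by
  rw [mulX, LinearMap.mulLeft_apply, add_comm, coeff_X_mul]

section action

variable (k : Fin 3 → ℝ) (j : Fin 3) (f : Spinor)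

/-- Both terms of the angular part carry a factor `x_{j+1}` or `x_{j+2}` and do not reach a power of
`x_j`. -/
lemma spinorCoeff_biOp_zero (a : ℕ) : spinorCoeff (mon j a 0 0) (biOp k j f) =
    (1 / 2 + k (j + 1) + k (j + 2) : ℂ) • spinorCoeff (mon j a 0 0) f := by
  simp only [biOp, LinearMap.add_apply, LinearMap.comp_apply, LinearMap.smul_apply, spinorCoeff_add,
    spinorCoeff_smul, spinorCoeff_tensorOp, Matrix.one_mulVec]
  simp only [tensorOp_one_apply, LinearMap.comp_apply, LinearMap.sub_apply, coeff_sub,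
    coeff_mulX_zero (mon_apply_one j a 0 0), coeff_mulX_zero (mon_apply_two j a 0 0),
    AlgHom.toLinearMap_apply, coeff_refl, mon_apply_one, mon_apply_two]
  simp only [sub_zero, show (fun _ : Fin 2 => (0 : ℂ)) = 0 from rfl, Matrix.mulVec_zero]
  funext s
  simp only [Pi.add_apply, Pi.smul_apply, smul_eq_mul, spinorCoeff, Pi.zero_apply, pow_zero, one_mul]
  ring

/-- At a monomial free of `x_{j+1}` only `x_{j+2} T_{j+1}` contributes, through the coefficient of
`x_j^a x_{j+1} x_{j+2}^c`. The Dirac equation at `x_j^a x_{j+2}^c` expresses that coefficient by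
ones free of `x_{j+1}`. -/
lemma spinorCoeff_biOp_succ (hf : diracDunkl k f = 0) (a c : ℕ) :
    spinorCoeff (mon j a 0 (c + 1)) (biOp k j f) =
      ((-1) ^ (c + 1) * ((c + 1 : ℕ) + 1 / 2 + k (j + 1) + k (j + 2)) : ℂ) •
        spinorCoeff (mon j a 0 (c + 1)) f
      + ((-1) ^ (c + 1) * Complex.I * gam (k j) (a + 1)) •
        (pauli (j + 1)).mulVec (spinorCoeff (mon j (a + 1) 0 c) f) := by
  have hD := spinorCoeff_diracDunkl k j f a 0 c
  rw [hf] at hD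
  -- Multiplication by `e_{j+2}` turns `e_{j+1}` into a multiple of `e_j`, the matrix occurring in
  -- the generator, and `e_j` into a multiple of `e_{j+1}`.
  have hD' := congrArg (pauli (j + 2)).mulVec hD
  have e1 := pauli_mul_succ (j + 2)
  have e2 := pauli_succ_mul (j + 1)
  rw [show j + 2 + 1 = j by rw [add_assoc]; simp, show j + 2 + 2 = j + 1 by rw [add_assoc]; rfl] at e1
  rw [show j + 1 + 1 = j + 2 by rw [add_assoc]; rfl, show j + 1 + 2 = j by rw [add_assoc]; simp] at e2
  simp only [Matrix.mulVec_add, Matrix.mulVec_smul, Matrix.mulVec_mulVec, e1, e2, pauli_mul_self,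
    Matrix.one_mulVec, Matrix.smul_mulVec] at hD'
  rw [show spinorCoeff (mon j a 0 c) 0 = 0 from rfl, Matrix.mulVec_zero] at hD'
  simp only [biOp, LinearMap.add_apply, LinearMap.comp_apply, LinearMap.smul_apply, spinorCoeff_add,
    spinorCoeff_smul, spinorCoeff_tensorOp, Matrix.one_mulVec]
  simp only [tensorOp_one_apply, LinearMap.comp_apply, LinearMap.sub_apply, coeff_sub,
    coeff_mulX_zero (mon_apply_one j a 0 (c + 1)), AlgHom.toLinearMap_apply, coeff_refl,
    mon_apply_one, mon_apply_two]
  simp only [← mon_add_two, coeff_mulX_add, coeff_dunkl_eq_gam, coeff_refl]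
  simp only [mon_add_two, mon_add_one, mon_apply_one, mon_apply_two]
  have hF : (fun s => (-1) ^ (c + 1) * coeff (mon j a 0 (c + 1)) (f s)) =
      ((-1) ^ (c + 1) : ℂ) • spinorCoeff (mon j a 0 (c + 1)) f := rfl
  have hF' : (fun s => coeff (mon j a 0 (c + 1)) (f s)) = spinorCoeff (mon j a 0 (c + 1)) f := rfl
  have hw : (fun s => gam (k (j + 1)) (0 + 1) * ((-1) ^ (0 + 1) *
      ((-1) ^ c * coeff (mon j a (0 + 1) c) (f s))) - 0) =
      (-(-1) ^ c * gam (k (j + 1)) (0 + 1)) • spinorCoeff (mon j a (0 + 1) c) f := by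
    funext s
    simp [spinorCoeff]
    ring
  simp only [pow_zero, one_mul]
  rw [hw, hF, hF', Matrix.mulVec_smul]
  rcases Nat.even_or_odd c with hc | hc <;>
  simp only [gam, pow_succ, hc.neg_one_pow] at hD' ⊢ <;> push_cast at hD' ⊢
  · linear_combination (norm := module) -hD'
  · linear_combination (norm := module) hD'

lemma spinorCoeff_biOp_two_zero (c : ℕ) : spinorCoeff (mon j 0 0 c) (biOp k (j + 2) f) =
    (1 / 2 + k j + k (j + 1) : ℂ) • spinorCoeff (mon j 0 0 c) f := by
  have h1 : j + 2 + 1 = j := by rw [add_assoc]; simp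
  have h2 : j + 2 + 2 = j + 1 := by rw [add_assoc]; rfl
  simp only [biOp, h1, h2, LinearMap.add_apply, LinearMap.comp_apply, LinearMap.smul_apply,
    spinorCoeff_add, spinorCoeff_smul, spinorCoeff_tensorOp, Matrix.one_mulVec]
  simp only [tensorOp_one_apply, LinearMap.comp_apply, LinearMap.sub_apply, coeff_sub,
    coeff_mulX_zero (mon_apply_one j 0 0 c), coeff_mulX_zero (mon_apply_zero j 0 0 c),
    AlgHom.toLinearMap_apply, coeff_refl, mon_apply_one, mon_apply_zero]
  simp only [sub_zero, show (fun _ : Fin 2 => (0 : ℂ)) = 0 from rfl, Matrix.mulVec_zero]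
  funext s
  simp only [Pi.add_apply, Pi.smul_apply, smul_eq_mul, spinorCoeff, Pi.zero_apply, pow_zero, one_mul]
  ring

/-- The mirror image of `spinorCoeff_biOp_succ`: now `x_j T_{j+1}` contributes, and the Dirac
equation is multiplied by `e_j`. -/
lemma spinorCoeff_biOp_two_succ (hf : diracDunkl k f = 0) (a c : ℕ) :
    spinorCoeff (mon j (a + 1) 0 c) (biOp k (j + 2) f) =
      ((-1) ^ (a + 1) * ((a + 1 : ℕ) + 1 / 2 + k j + k (j + 1)) : ℂ) •
        spinorCoeff (mon j (a + 1) 0 c) f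
      - ((-1) ^ (a + 1) * Complex.I * gam (k (j + 2)) (c + 1)) •
        (pauli (j + 1)).mulVec (spinorCoeff (mon j a 0 (c + 1)) f) := by
  have h1 : j + 2 + 1 = j := by rw [add_assoc]; simp
  have h2 : j + 2 + 2 = j + 1 := by rw [add_assoc]; rfl
  have hD := spinorCoeff_diracDunkl k j f a 0 c
  rw [hf] at hD
  have hD' := congrArg (pauli j).mulVec hD
  have e1 := pauli_mul_succ j
  have e2 := pauli_succ_mul (j + 2)
  rw [h1, h2] at e2
  simp only [Matrix.mulVec_add, Matrix.mulVec_smul, Matrix.mulVec_mulVec, e1, e2, pauli_mul_self,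
    Matrix.one_mulVec, Matrix.smul_mulVec] at hD'
  rw [show spinorCoeff (mon j a 0 c) 0 = 0 from rfl, Matrix.mulVec_zero] at hD'
  simp only [biOp, h1, h2, LinearMap.add_apply, LinearMap.comp_apply, LinearMap.smul_apply,
    spinorCoeff_add, spinorCoeff_smul, spinorCoeff_tensorOp, Matrix.one_mulVec]
  simp only [tensorOp_one_apply, LinearMap.comp_apply, LinearMap.sub_apply, coeff_sub,
    coeff_mulX_zero (mon_apply_one j (a + 1) 0 c), AlgHom.toLinearMap_apply, coeff_refl,
    mon_apply_one, mon_apply_zero]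
  simp only [← mon_add_zero, coeff_mulX_add, coeff_dunkl_eq_gam, coeff_refl]
  simp only [mon_add_zero, mon_add_one, mon_apply_one, mon_apply_zero]
  have hF : (fun s => (-1) ^ (a + 1) * coeff (mon j (a + 1) 0 c) (f s)) =
      ((-1) ^ (a + 1) : ℂ) • spinorCoeff (mon j (a + 1) 0 c) f := rfl
  have hF' : (fun s => coeff (mon j (a + 1) 0 c) (f s)) = spinorCoeff (mon j (a + 1) 0 c) f := rfl
  have hw : (fun s => 0 - gam (k (j + 1)) (0 + 1) * ((-1) ^ a * ((-1) ^ (0 + 1) *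
      coeff (mon j a (0 + 1) c) (f s)))) =
      ((-1) ^ a * gam (k (j + 1)) (0 + 1)) • spinorCoeff (mon j a (0 + 1) c) f := by
    funext s
    simp [spinorCoeff]
    ring
  simp only [pow_zero, one_mul]
  rw [hw, hF, hF', Matrix.mulVec_smul]
  rcases Nat.even_or_odd a with ha | ha <;>
  simp only [gam, pow_succ, ha.neg_one_pow] at hD' ⊢ <;> push_cast at hD' ⊢
  · linear_combination (norm := module) -hD'
  · linear_combination (norm := module) hD'

end action

end BannaiIto
end

/-! ### Cauchy-Kovalevskaya extension -/

noncomputable section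

namespace BannaiIto

open MvPolynomial

variable {k : Fin 3 → ℝ} {n : ℕ} {j : Fin 3}

lemma spinorCoeff_eq_zero_of_degree {f : Spinor} (hf : f ∈ monogenic k n) {a b c : ℕ}
    (h : a + b + c ≠ n) : spinorCoeff (mon j a b c) f = 0 := by
  funext s
  by_contra hne
  have := (mem_homogeneous_iff (f s) n).1 (hf.1 s) _ hne
  rw [degree_mon] at this
  exact h this

lemma pauli_mulVec_eq_zero {v : Fin 2 → ℂ} (h : (pauli j).mulVec v = 0) : v = 0 := by
  have := congrArg (pauli j).mulVec h
  rwa [Matrix.mulVec_mulVec, pauli_mul_self, Matrix.one_mulVec, Matrix.mulVec_zero] at this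

lemma gam_ne_zero_of_lt {κ : ℝ} (h : (n : ℕ∞) < tval κ) {p : ℕ} (hp : p ≠ 0) (hpn : p ≤ n) :
    gam κ p ≠ 0 := by
  intro h0
  rw [gam_eq_zero hp h0, Nat.cast_lt] at h
  omega

/-- A vanishing pattern of the coefficients of `x_j^a x_{j+2}^c` that is closed under raising `a` or `c`
propagates to all the coefficients of a Dunkl monogenic. -/
lemma spinorCoeff_eq_zero_of_pattern (hn : (n : ℕ∞) < tval (k (j + 1))) {f : Spinor}
    (hf : f ∈ monogenic k n) (S : ℕ → ℕ → Prop)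
    (ha : ∀ a c, S a c → gam (k j) (a + 1) = 0 ∨ S (a + 1) c)
    (hc : ∀ a c, S a c → gam (k (j + 2)) (c + 1) = 0 ∨ S a (c + 1))
    (h0 : ∀ a c, S a c → spinorCoeff (mon j a 0 c) f = 0) (a b c : ℕ) (h : S a c) :
    spinorCoeff (mon j a b c) f = 0 := by
  induction b generalizing a c with
  | zero => exact h0 a c h
  | succ b ih =>
    by_cases hd : a + (b + 1) + c = n
    -- The Dirac equation at `x_j^a x_{j+1}^b x_{j+2}^c`: each neighbour of `x_{j+1}`-degree `b` is
    -- zero by induction or has factor zero, leaving the unknown coefficient times the nonzero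
    -- `γ_{j+1}(b+1)`.
    · have hD := spinorCoeff_diracDunkl k j f a b c
      rw [hf.2, show spinorCoeff (mon j a b c) 0 = 0 from rfl] at hD
      have e1 : gam (k j) (a + 1) • (pauli j).mulVec (spinorCoeff (mon j (a + 1) b c) f) = 0 := by
        rcases ha a c h with h | h
        · rw [h, zero_smul]
        · rw [ih _ _ h, Matrix.mulVec_zero, smul_zero]
      have e2 : gam (k (j + 2)) (c + 1) •
          (pauli (j + 2)).mulVec (spinorCoeff (mon j a b (c + 1)) f) = 0 := by
        rcases hc a c h with h | h
        · rw [h, zero_smul]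
        · rw [ih _ _ h, Matrix.mulVec_zero, smul_zero]
      rw [e1, e2, zero_add, add_zero, eq_comm, smul_eq_zero] at hD
      exact pauli_mulVec_eq_zero (hD.resolve_left (gam_ne_zero_of_lt hn (by omega) (by omega)))
    · exact spinorCoeff_eq_zero_of_degree hf hd

/-- The coefficients of the Cauchy-Kovalevskaya extension of a polynomial in `x_j, x_{j+2}` with the
coefficients `F`, as functions of the exponents of `x_{j+1}, x_j, x_{j+2}`. -/
def ckExt (k : Fin 3 → ℝ) (j : Fin 3) (F : ℕ → Fin 2 → ℂ) : ℕ → ℕ → ℕ → Fin 2 → ℂ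
  | 0, _, c => F c
  | b + 1, a, c => -(gam (k (j + 1)) (b + 1))⁻¹ • (pauli (j + 1)).mulVec
      (gam (k j) (a + 1) • (pauli j).mulVec (ckExt k j F b (a + 1) c)
        + gam (k (j + 2)) (c + 1) • (pauli (j + 2)).mulVec (ckExt k j F b a (c + 1)))

/-- The homogeneous polynomial of degree `n` with the coefficients `ckExt`. -/
def ckPoly (k : Fin 3 → ℝ) (n : ℕ) (j : Fin 3) (F : ℕ → Fin 2 → ℂ) : Spinor := fun s =>
  ∑ d ∈ Finset.univ.finsuppAntidiag n,
    monomial d (ckExt k j F (d (j + 1)) (d j) (d (j + 2)) s)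

lemma spinorCoeff_ckPoly (F : ℕ → Fin 2 → ℂ) (a b c : ℕ) :
    spinorCoeff (mon j a b c) (ckPoly k n j F) = if a + b + c = n then ckExt k j F b a c else 0 := by
  funext s
  have hmem : mon j a b c ∈ (Finset.univ : Finset (Fin 3)).finsuppAntidiag n ↔ a + b + c = n := by
    rw [Finset.mem_finsuppAntidiag, Fin.sum_univ_three, degree_mon]
    simp
  simp only [spinorCoeff, ckPoly, coeff_sum, coeff_monomial, Finset.sum_ite_eq', hmem,
    mon_apply_zero, mon_apply_one, mon_apply_two]
  split_ifs <;> rfl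

/-- The recursion for `ckExt` is the Dirac equation solved for the highest power of `x_{j+1}`. Only
`γ_{j+1}(b+1)` with `b + 1 ≤ n < t_{j+1}` is inverted in degree `n`. -/
lemma ckPoly_mem (hn : (n : ℕ∞) < tval (k (j + 1))) (F : ℕ → Fin 2 → ℂ) :
    ckPoly k n j F ∈ monogenic k n := by
  constructor
  · intro s
    rw [← mem_homogeneousSubmodule, mem_homogeneous_iff]
    intro d hd
    by_contra hne
    have := congrFun (spinorCoeff_ckPoly (k := k) (n := n) (j := j) F (d j) (d (j + 1)) (d (j + 2))) s
    rw [← degree_mon j, ← eq_mon, if_neg hne] at this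
    exact hd this
  · funext s
    ext d
    have hD := spinorCoeff_diracDunkl k j (ckPoly k n j F) (d j) (d (j + 1)) (d (j + 2))
    simp only [spinorCoeff_ckPoly] at hD
    rw [← eq_mon] at hD
    suffices h : spinorCoeff d (diracDunkl k (ckPoly k n j F)) = 0 from congrFun h s
    rw [hD]
    generalize d j = a, d (j + 1) = b, d (j + 2) = c
    by_cases h : a + b + c + 1 = n
    · rw [if_pos (by omega), if_pos (by omega), if_pos (by omega), ckExt, Matrix.mulVec_smul,
        Matrix.mulVec_mulVec, pauli_mul_self, Matrix.one_mulVec, smul_smul, mul_neg,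
        mul_inv_cancel₀ (gam_ne_zero_of_lt hn (by omega) (by omega))]
      module
    · rw [if_neg (by omega), if_neg (by omega), if_neg (by omega)]
      simp

lemma exists_monogenic (hn : (n : ℕ∞) < tval (k (j + 1))) (F : ℕ → Fin 2 → ℂ) :
    ∃ f ∈ monogenic k n, ∀ a c, a + c = n → spinorCoeff (mon j a 0 c) f = F c :=
  ⟨ckPoly k n j F, ckPoly_mem hn F, fun a c h => by
    rw [spinorCoeff_ckPoly, if_pos (by omega), ckExt]⟩

/-- The vanishing pattern `a < t` propagates to all powers of `x_{j+1}`: raising `a` leaves it only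
at `a = t - 1`, where the factor is `γ_j(t) = 0`. -/
lemma mem_monogenicSub_zero (hn : (n : ℕ∞) < tval (k (j + 1))) {t : ℕ} (ht : tval (k j) = t)
    (f : Monogenic k n) : f ∈ monogenicSub k n j ↔
      ∀ a c, a + c = n → a < t → spinorCoeff (mon j a 0 c) f.val = 0 := by
  constructor
  · intro hf a c _ ha
    funext s
    by_contra hne
    have := hf s _ hne
    rw [ht, mon_apply_zero, Nat.cast_le] at this
    omega
  · intro h s d hd
    rw [ht, Nat.cast_le]
    by_contra hlt
    rw [eq_mon j d] at hd
    refine hd (congrFun (spinorCoeff_eq_zero_of_pattern hn f.val_mem (fun a _ => a < t) ?_ ?_ ?_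
      (d j) (d (j + 1)) (d (j + 2)) (by omega)) s)
    · intro a c ha
      rcases (show a + 1 ≤ t from ha).eq_or_lt with h | h
      · left; rw [h]; exact gam_of_tval ht
      · exact Or.inr h
    · exact fun a c ha => Or.inr ha
    · intro a c ha
      by_cases hd : a + c = n
      · exact h a c hd ha
      · exact spinorCoeff_eq_zero_of_degree f.val_mem (by omega)

lemma mem_monogenicSub_two (hn : (n : ℕ∞) < tval (k (j + 1))) {t : ℕ} (ht : tval (k (j + 2)) = t)
    (f : Monogenic k n) : f ∈ monogenicSub k n (j + 2) ↔
      ∀ a c, a + c = n → c < t → spinorCoeff (mon j a 0 c) f.val = 0 := by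
  constructor
  · intro hf a c _ hc
    funext s
    by_contra hne
    have := hf s _ hne
    rw [ht, mon_apply_two, Nat.cast_le] at this
    omega
  · intro h s d hd
    rw [ht, Nat.cast_le]
    by_contra hlt
    rw [eq_mon j d] at hd
    refine hd (congrFun (spinorCoeff_eq_zero_of_pattern hn f.val_mem (fun _ c => c < t) ?_ ?_ ?_
      (d j) (d (j + 1)) (d (j + 2)) (by omega)) s)
    · exact fun a c ha => Or.inr ha
    · intro a c ha
      rcases (show c + 1 ≤ t from ha).eq_or_lt with h | h
      · left; rw [h]; exact gam_of_tval ht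
      · exact Or.inr h
    · intro a c ha
      by_cases hd : a + c = n
      · exact h a c hd ha
      · exact spinorCoeff_eq_zero_of_degree f.val_mem (by omega)

/-- Uniqueness of the extension: propagation with the pattern that holds everywhere. -/
lemma monogenic_eq_zero (hn : (n : ℕ∞) < tval (k (j + 1))) {f : Monogenic k n}
    (h : ∀ a c, a + c = n → spinorCoeff (mon j a 0 c) f.val = 0) : f = 0 := by
  refine Monogenic.val_injective ?_
  rw [map_zero]
  funext s
  ext d
  rw [eq_mon j d]
  refine congrFun (spinorCoeff_eq_zero_of_pattern hn f.val_mem (fun _ _ => True) ?_ ?_ ?_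
    (d j) (d (j + 1)) (d (j + 2)) trivial) s
  · exact fun _ _ _ => Or.inr trivial
  · exact fun _ _ _ => Or.inr trivial
  · intro a c _
    by_cases hd : a + c = n
    · exact h a c hd
    · exact spinorCoeff_eq_zero_of_degree f.val_mem (by omega)

/-- For even `n`, the central element `{X_i, X_{i+1}} - X_{i+2}` acts on the Dunkl monogenics as a scalar. -/
lemma anticomm_smul (hn : Even n) (i : Fin 3) (f : Monogenic k n) :
    gen i • gen (i + 1) • f + gen (i + 1) • gen i • f = gen (i + 2) • f +
      (2 * (k i * k (i + 1) + (k 0 + k 1 + k 2 + n + 1) * k (i + 2)) : ℂ) • f := by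
  refine Monogenic.val_injective ?_
  simp only [map_add, map_smul, gen_smul]
  have hf := f.val_mem
  have h0 := angular_homogeneous k n _ (hf.1 0)
  have h1 := angular_homogeneous k n _ (hf.1 1)
  have r0 := refl_homogeneous n _ (hf.1 0)
  have r1 := refl_homogeneous n _ (hf.1 1)
  rw [hn.neg_one_pow, C_1, one_mul] at r0 r1
  push_cast at h0 h1
  have c2 : (C (2:ℂ) : MvPolynomial (Fin 3) ℂ) = 2 := map_ofNat C 2
  rcases fin3_cases i with rfl | rfl | rfl
  · have h := anticomm0 k f.val 0 hf.2
    have hl : (fun s => 2 * C (1/2) * biOp k 2 f.val s) = biOp k 2 f.val := by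
      funext s
      rw [two_half, one_mul]
    rw [hl, sub_eq_iff_eq_add'] at h
    simp only [show (0 : Fin 3) + 1 = 1 from rfl, show (0 : Fin 3) + 2 = 2 from rfl]
    rw [h]
    congr 1
    simp only [Pi.zero_apply, mul_zero, add_zero, sub_zero, h0, h1, map_mul, refl_C, r0, r1]
    ext1 s
    fin_cases s <;> simp [-Complex.coe_smul, MvPolynomial.smul_eq_C_mul, c2] <;> ring
  · have h := anticomm1 k f.val 0 hf.2
    have hl : (fun s => 2 * C (1/2) * biOp k 0 f.val s) = biOp k 0 f.val := by
      funext s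
      rw [two_half, one_mul]
    rw [hl, sub_eq_iff_eq_add'] at h
    simp only [show (1 : Fin 3) + 1 = 2 from rfl, show (1 : Fin 3) + 2 = 0 from rfl]
    rw [h]
    congr 1
    simp only [Pi.zero_apply, mul_zero, add_zero, sub_zero, h0, h1, map_mul, refl_C, r0, r1]
    ext1 s
    fin_cases s <;> simp [-Complex.coe_smul, MvPolynomial.smul_eq_C_mul, c2] <;> ring
  · have h := anticomm2 k f.val 0 hf.2
    have hl : (fun s => 2 * C (1/2) * biOp k 1 f.val s) = biOp k 1 f.val := by
      funext s
      rw [two_half, one_mul]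
    rw [hl, sub_eq_iff_eq_add'] at h
    simp only [show (2 : Fin 3) + 1 = 0 from rfl, show (2 : Fin 3) + 2 = 1 from rfl]
    rw [h]
    congr 1
    simp only [Pi.zero_apply, mul_zero, add_zero, sub_zero, h0, h1, map_mul, refl_C, r0, r1]
    ext1 s
    fin_cases s <;> simp [-Complex.coe_smul, MvPolynomial.smul_eq_C_mul, c2] <;> ring

end BannaiIto
end

/-! ### Recognizing two copies of a twisted `O_d` from bidiagonal coordinates -/

noncomputable section

namespace BannaiIto

open MvPolynomial

/-- Rescaling coordinate `i` by `s_i = ∏ g_1/α_l` turns the lower entries `α` into `g_1`, as in the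
twisted `X`. Only the products `α_{i+1} β_i` survive in the entries of `Y`, and they are the
prescribed `φ_{i+1}` up to sign. The third generator follows from the relation. -/
lemma exists_hom_twistedO {V : Type} [AddCommGroup V] [Module BI V] {g : ℤˣ × ℤˣ}
    {σ : Equiv.Perm (Fin 3)} {d : ℕ} (hd : Even d) {a b c : ℂ} {iX iY iZ : Fin 3} (hσX : σ iX = 0)
    (hσY : σ iY = 1) (hσZ : σ iZ = 2) (ψ : ℕ → V →+ ℂ) (α β : ℕ → ℂ)
    (hsc : ∀ i z v, ψ i (algebraMap ℂ BI z • v) = z * ψ i v)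
    (hX : ∀ i ≤ d, ∀ v, ψ i (gen iX • v) =
      (g.1 : ℤ) * theta d a i * ψ i v + if i = 0 then 0 else α i * ψ (i - 1) v)
    (hY : ∀ i ≤ d, ∀ v, ψ i (gen iY • v) =
      (g.2 : ℤ) * theta d b i * ψ i v + if i = d then 0 else β i * ψ (i + 1) v)
    (hα : ∀ i, 1 ≤ i → i ≤ d → α i ≠ 0)
    (hαβ : ∀ i < d, α (i + 1) * β i = (g.1 : ℤ) * (g.2 : ℤ) * phi d a b c (i + 1))
    (hZ : ∀ v : V, gen iX • gen iY • v + gen iY • gen iX • v = gen iZ • v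
      + algebraMap ℂ BI ((g.1 : ℤ) * (g.2 : ℤ) * (2 * a * b - c * (d + 1))) • v) :
    ∃ (Φ : V →ₗ[BI] TwistedO g σ d hd a b c) (s : ℕ → ℂ), (∀ i ≤ d, s i ≠ 0) ∧
      ∀ v, Φ v = twistedOOfFun g σ d hd a b c fun i => s i * ψ i v := by
  have hg : ((g.1 : ℤ) : ℂ) * (g.1 : ℤ) = 1 := by
    rw [← Int.cast_mul, ← Units.val_mul, Int.units_mul_self]; simp
  have hg0 : ((g.1 : ℤ) : ℂ) ≠ 0 := left_ne_zero_of_mul_eq_one hg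
  set s : ℕ → ℂ := fun i => ∏ l ∈ Finset.range i, ((g.1 : ℤ) / α (l + 1) : ℂ) with hs
  have hss : ∀ i, s (i + 1) = s i * ((g.1 : ℤ) / α (i + 1)) := fun i => Finset.prod_range_succ _ _
  have hs0 : ∀ i ≤ d, s i ≠ 0 := fun i hi => Finset.prod_ne_zero_iff.2 fun l hl => by
    rw [Finset.mem_range] at hl
    exact div_ne_zero hg0 (hα _ (by omega) (by omega))
  set A := twistFam g σ (oEnd d a b c) with hA
  set T := twistedOOfFun g σ d hd a b c with hT
  set E : V → Fin (d + 1) → ℂ := fun v i => s i * ψ i v with hE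
  have hEadd : ∀ v w, E (v + w) = E v + E w := fun v w => by
    funext i; simp [hE, mul_add]
  have hEsmul : ∀ (z : ℂ) v, E (algebraMap ℂ BI z • v) = z • E v := fun z v => by
    funext i; simp only [hE, hsc, Pi.smul_apply, smul_eq_mul]; ring
  have hEX : ∀ v, E (gen iX • v) = A iX (E v) := by
    intro v
    funext i
    rw [hA, twistFam, hσX, LinearMap.smul_apply, Pi.smul_apply]
    have e : oEnd d a b c 0 (E v) i = _ := oX_mulVec d a (fun i => s i * ψ i v) i
    rw [e]
    simp only [hE, hX i i.is_le, signOf, Matrix.cons_val_zero, smul_eq_mul]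
    rcases hi : (i : ℕ) with _ | m
    · simp; ring
    · have := hα (m + 1) (by omega) (by omega)
      simp only [Nat.add_eq_zero_iff, one_ne_zero, and_false, if_false, Nat.add_sub_cancel, hss]
      field_simp
  have hEY : ∀ v, E (gen iY • v) = A iY (E v) := by
    intro v
    funext i
    rw [hA, twistFam, hσY, LinearMap.smul_apply, Pi.smul_apply]
    have e : oEnd d a b c 1 (E v) i = _ := oY_mulVec hd a b c (fun i => s i * ψ i v) i
    rw [e]
    simp only [hE, hY i i.is_le, signOf, Matrix.cons_val_one, Matrix.cons_val_zero, smul_eq_mul]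
    split_ifs with hi
    -- The formula `oY_mulVec` still shows a neighbour beyond the last coordinate, but `φ_{d+1} =
    -- 0`.
    · have : phi d a b c (i + 1) = 0 := by
        rw [hi, ← revPhi_sub hd _ _ _ le_rfl]; simp [revPhi]
      rw [this]; ring
    · have hid : (i : ℕ) < d := by have := i.is_le; omega
      have h0 := hα (i + 1) (by omega) (by omega)
      have hp := hαβ i hid
      rw [hss]
      have : β i = (g.1 : ℤ) * (g.2 : ℤ) * phi d a b c (i + 1) / α (i + 1) := by
        rw [← hp]; field_simp
      rw [this]
      field_simp
  have hEZ : ∀ v, E (gen iZ • v) = A iZ (E v) := by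
    intro v
    have hne : ∀ i j : Fin 3, σ i ≠ σ j → i ≠ j := fun i j h e => h (by rw [e])
    have hr := ((oEnd_satisfiesBI hd a b c).twist g σ).rel iX iY iZ
      (hne _ _ (by rw [hσX, hσY]; decide)) (hne _ _ (by rw [hσY, hσZ]; decide))
      (hne _ _ (by rw [hσX, hσZ]; decide)) (E v)
    have h := congrArg E (hZ v)
    rw [hEadd, hEadd, hEX, hEY, hEY, hEX, hEsmul, ← hA] at *
    rw [h] at hr
    have hp : 2 * twistFam g σ ![a, b, c] iX * twistFam g σ ![a, b, c] iY
        - twistFam g σ ![a, b, c] iZ * (d + 1) =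
        (g.1 : ℤ) * (g.2 : ℤ) * (2 * a * b - c * (d + 1)) := by
      simp [twistFam, hσX, hσY, hσZ, signOf]
      ring
    rw [hp] at hr
    exact add_right_cancel hr
  refine ⟨BI.linearMapOfGen ⟨⟨fun v => T (E v), ?_⟩, ?_⟩ ?_ ?_, s, hs0, fun v => rfl⟩
  · rw [show E 0 = 0 by funext i; simp [hE], map_zero]
  · intro v w
    simp only [hEadd, map_add]
  · intro z v
    change T (E _) = _ • T (E v)
    rw [hEsmul, algebraMap_smul_twistedOOfFun]
  · intro i v
    change T (E _) = _ • T (E v)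
    rw [gen_smul_twistedOOfFun]
    congr 1
    have : i = iX ∨ i = iY ∨ i = iZ := by
      rcases fin3_cases (σ i) with h | h | h
      · exact Or.inl (σ.injective (h.trans hσX.symm))
      · exact Or.inr (Or.inl (σ.injective (h.trans hσY.symm)))
      · exact Or.inr (Or.inr (σ.injective (h.trans hσZ.symm)))
    rcases this with rfl | rfl | rfl
    · exact hEX v
    · exact hEY v
    · exact hEZ v

/-- If two families of coordinates on `V`, jointly independent and vanishing simultaneously exactly on
`N`, transform under the generators bidiagonally as in a twist of `O_d(a,b,c)`, then `V / N` is two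
copies of it. -/
lemma isTwoCopies_quotient {V : Type} [AddCommGroup V] [Module BI V] {g : ℤˣ × ℤˣ}
    {σ : Equiv.Perm (Fin 3)} {d : ℕ} (hd : Even d) {a b c : ℂ} {iX iY iZ : Fin 3} (hσX : σ iX = 0)
    (hσY : σ iY = 1) (hσZ : σ iZ = 2) (ψ : Fin 2 → ℕ → V →+ ℂ) (α β : Fin 2 → ℕ → ℂ)
    (hsc : ∀ t i z v, ψ t i (algebraMap ℂ BI z • v) = z * ψ t i v)
    (hX : ∀ t, ∀ i ≤ d, ∀ v, ψ t i (gen iX • v) =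
      (g.1 : ℤ) * theta d a i * ψ t i v + if i = 0 then 0 else α t i * ψ t (i - 1) v)
    (hY : ∀ t, ∀ i ≤ d, ∀ v, ψ t i (gen iY • v) =
      (g.2 : ℤ) * theta d b i * ψ t i v + if i = d then 0 else β t i * ψ t (i + 1) v)
    (hα : ∀ t i, 1 ≤ i → i ≤ d → α t i ≠ 0)
    (hαβ : ∀ t, ∀ i < d, α t (i + 1) * β t i = (g.1 : ℤ) * (g.2 : ℤ) * phi d a b c (i + 1))
    (hZ : ∀ v : V, gen iX • gen iY • v + gen iY • gen iX • v = gen iZ • v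
      + algebraMap ℂ BI ((g.1 : ℤ) * (g.2 : ℤ) * (2 * a * b - c * (d + 1))) • v)
    (N : Submodule BI V) (hN : ∀ v, v ∈ N ↔ ∀ t, ∀ i ≤ d, ψ t i v = 0)
    (hsurj : ∀ F : Fin 2 → ℕ → ℂ, ∃ v, ∀ t, ∀ i ≤ d, ψ t i v = F t i) :
    IsTwoCopies (V ⧸ N) (TwistedO g σ d hd a b c) := by
  have h := fun t => exists_hom_twistedO hd hσX hσY hσZ (ψ t) (α t) (β t) (hsc t) (hX t) (hY t) (hα t)
    (hαβ t) hZ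
  choose Φ s hs0 hΦ using h
  set T := twistedOOfFun g σ d hd a b c with hT
  have hker : LinearMap.ker ((Φ 0).prod (Φ 1)) = N := by
    ext v
    rw [LinearMap.mem_ker, LinearMap.prod_apply, Function.prod_apply, Prod.mk_eq_zero, hN, Fin.forall_fin_two]
    have key : ∀ t, Φ t v = 0 ↔ ∀ i ≤ d, ψ t i v = 0 := by
      intro t
      rw [hΦ, map_eq_zero_iff _ T.injective]
      constructor
      · intro h i hi
        have := congrFun h ⟨i, by omega⟩
        exact (mul_eq_zero.1 this).resolve_left (hs0 t i hi)
      · intro h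
        funext i
        change s t i * ψ t i v = 0
        rw [h i i.is_le, mul_zero]
    rw [key, key]
  have hsur : Function.Surjective ((Φ 0).prod (Φ 1)) := by
    rintro ⟨x, y⟩
    obtain ⟨x, rfl⟩ := T.surjective x
    obtain ⟨y, rfl⟩ := T.surjective y
    obtain ⟨v, hv⟩ := hsurj fun t i => (s t i)⁻¹ *
      if h : i < d + 1 then (![x, y] : Fin 2 → Fin (d + 1) → ℂ) t ⟨i, h⟩ else 0
    refine ⟨v, ?_⟩
    have key : ∀ t, Φ t v = T ((![x, y] : Fin 2 → Fin (d + 1) → ℂ) t) := by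
      intro t
      rw [hΦ]
      congr 1
      funext i
      rw [hv t i i.is_le, dif_pos i.isLt, mul_inv_cancel_left₀ (hs0 t i i.is_le)]
    exact Prod.ext (key 0) (key 1)
  exact ⟨(Submodule.quotEquivOfEq _ _ hker.symm).trans (LinearMap.quotKerEquivOfSurjective _ hsur)⟩

/-- The second isomorphism theorem for submodules spanning the whole module. -/
lemma IsTwoCopies.of_sup_eq_top {V W : Type} [AddCommGroup V] [Module BI V] [AddCommGroup W]
    [Module BI W] {N N' M : Submodule BI V} (h : N ⊔ N' = ⊤) (hM : M = N ⊓ N')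
    (hW : IsTwoCopies (V ⧸ N') W) : IsTwoCopies (↥N ⧸ M.submoduleOf N) W := by
  have hker : LinearMap.ker (N'.mkQ ∘ₗ N.subtype) = M.submoduleOf N := by
    rw [LinearMap.ker_comp, Submodule.ker_mkQ, hM]
    ext v
    simp [Submodule.submoduleOf]
  have hsur : Function.Surjective (N'.mkQ ∘ₗ N.subtype) := by
    intro x
    obtain ⟨v, rfl⟩ := N'.mkQ_surjective x
    obtain ⟨y, hy, z, hz, rfl⟩ := Submodule.mem_sup.1 (h ▸ Submodule.mem_top : v ∈ N ⊔ N')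
    refine ⟨⟨y, hy⟩, ?_⟩
    have hz0 : N'.mkQ z = 0 := (Submodule.Quotient.mk_eq_zero N').2 hz
    rw [map_add, hz0, add_zero]
    rfl
  obtain ⟨e⟩ := hW
  exact ⟨((Submodule.quotEquivOfEq _ _ hker.symm).trans
    (LinearMap.quotKerEquivOfSurjective _ hsur)).trans e⟩

end BannaiIto
end

/-! ### Coordinates on the monogenics -/

noncomputable section

namespace BannaiIto

variable {k : Fin 3 → ℝ} {n : ℕ} {j : Fin 3}

lemma gam_even {κ : ℝ} {p : ℕ} (h : Even p) : gam κ p = p := by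
  rw [gam, h.neg_one_pow]; ring

lemma gam_odd {κ : ℝ} {p : ℕ} (h : Odd p) : gam κ p = p + 2 * κ := by
  rw [gam, h.neg_one_pow]; ring

/-- Coordinates on the Dunkl monogenics in which the generators `j` and `j + 2` are bidiagonal: the
components of the coefficients of `x_j^(n-c) x_{j+2}^c` in an eigenbasis of `pauli (j + 1)`, whose
eigenvalues are the `ε t`. -/
structure IsCKCoord (k : Fin 3 → ℝ) (n : ℕ) (j : Fin 3) (φ : Fin 2 → ℕ → Monogenic k n →+ ℂ)
    (ε : Fin 2 → ℂ) : Prop where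
  sq : ∀ t, ε t * ε t = 1
  scalar : ∀ t c z v, φ t c (algebraMap ℂ BI z • v) = z * φ t c v
  gen_zero : ∀ t, ∀ c ≤ n, ∀ v, φ t c (gen j • v) =
    (-1) ^ c * (c + 1 / 2 + k (j + 1) + k (j + 2)) * φ t c v +
      if c = 0 then 0 else (-1) ^ c * Complex.I * ε t * gam (k j) (n - c + 1) * φ t (c - 1) v
  gen_two : ∀ t, ∀ c ≤ n, ∀ v, φ t c (gen (j + 2) • v) =
    (-1) ^ c * ((n - c : ℕ) + 1 / 2 + k j + k (j + 1)) * φ t c v -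
      if c = n then 0 else (-1) ^ c * Complex.I * ε t * gam (k (j + 2)) (c + 1) * φ t (c + 1) v
  mem_zero : ∀ s : ℕ, tval (k j) = s → ∀ v, v ∈ monogenicSub k n j ↔
    ∀ t, ∀ c ≤ n, n < c + s → φ t c v = 0
  mem_two : ∀ s : ℕ, tval (k (j + 2)) = s → ∀ v, v ∈ monogenicSub k n (j + 2) ↔
    ∀ t, ∀ c ≤ n, c < s → φ t c v = 0
  inj : ∀ v, (∀ t, ∀ c ≤ n, φ t c v = 0) → v = 0
  surj : ∀ F : Fin 2 → ℕ → ℂ, ∃ v, ∀ t, ∀ c ≤ n, φ t c v = F t c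

/-- In the action on the restriction to `x_{j+1} = 0` the only matrix is `e_{j+1}`; in its
eigenbasis the two components decouple. -/
lemma exists_isCKCoord (hn : Even n) (hm : (n : ℕ∞) < tval (k (j + 1))) :
    ∃ φ ε, IsCKCoord k n j φ ε := by
  obtain ⟨P, Q, hPQ, hQP, hD⟩ := exists_diagonalize_pauli (j + 1)
  set ε : Fin 2 → ℂ := ![1, -1]
  have hDv : ∀ v t, P.mulVec ((pauli (j + 1)).mulVec v) t = ε t * P.mulVec v t := by
    intro v t
    rw [Matrix.mulVec_mulVec, hD, ← Matrix.mulVec_mulVec, Matrix.mulVec_diagonal]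
  have hP0 : ∀ v : Fin 2 → ℂ, (∀ t, P.mulVec v t = 0) ↔ v = 0 := by
    intro v
    constructor
    · intro h
      have h' : P.mulVec v = 0 := funext h
      have := congrArg Q.mulVec h'
      rwa [Matrix.mulVec_mulVec, hQP, Matrix.one_mulVec, Matrix.mulVec_zero] at this
    · rintro rfl t
      rw [Matrix.mulVec_zero]; rfl
  set φ : Fin 2 → ℕ → Monogenic k n →+ ℂ := fun t c => AddMonoidHom.mk'
    (fun f => P.mulVec (spinorCoeff (mon j (n - c) 0 c) f.val) t) (fun f g => by
      rw [map_add, spinorCoeff_add, Matrix.mulVec_add]; rfl) with hφ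
  have hφv : ∀ t c f, φ t c f = P.mulVec (spinorCoeff (mon j (n - c) 0 c) f.val) t := fun _ _ _ => rfl
  have hall : ∀ (S : ℕ → Prop) (v : Monogenic k n), (∀ t, ∀ c ≤ n, S c → φ t c v = 0) ↔
      ∀ a c, a + c = n → S c → spinorCoeff (mon j a 0 c) v.val = 0 := by
    intro S v
    constructor
    · intro h a c hac hS
      rw [← hP0]
      intro t
      have := h t c (by omega) hS
      rwa [hφv, show n - c = a by omega] at this
    · intro h t c hc hS
      rw [hφv]
      exact (hP0 _).2 (h _ _ (by omega) hS) t
  refine ⟨φ, ε, ⟨?_, ?_, ?_, ?_, ?_, ?_, ?_, ?_⟩⟩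
  · intro t; fin_cases t <;> simp [ε]
  · intro t c z v
    rw [hφv, algebraMap_smul', map_smul, spinorCoeff_smul, Matrix.mulVec_smul]; rfl
  · intro t c hc v
    rw [hφv, hφv, gen_smul]
    rcases c with _ | c
    · rw [spinorCoeff_biOp_zero, Matrix.mulVec_smul]
      simp
    · rw [spinorCoeff_biOp_succ k j v.val v.val_mem.2, Matrix.mulVec_add, Matrix.mulVec_smul,
        Matrix.mulVec_smul, Pi.add_apply, Pi.smul_apply, Pi.smul_apply, hDv, hφv,
        show n - (c + 1) + 1 = n - c by omega]
      simp only [smul_eq_mul, Nat.add_eq_zero_iff, one_ne_zero, and_false, if_false,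
        Nat.add_sub_cancel]
      ring
  · intro t c hc v
    rw [hφv, hφv, gen_smul]
    -- The sign of generator `j + 2` depends on the exponent `n - c` of `x_j`; evenness of `n` makes
    -- it agree with that of generator `j`.
    have hs : ((-1 : ℂ)) ^ (n - c) = (-1) ^ c := by
      rcases Nat.even_or_odd c with h | h
      · rw [h.neg_one_pow, (Nat.even_sub hc |>.2 (by simp [hn, h])).neg_one_pow]
      · rw [h.neg_one_pow, (Nat.Even.sub_odd hc hn h).neg_one_pow]
    rcases ha : n - c with _ | a
    · rw [if_pos (by omega), spinorCoeff_biOp_two_zero, Matrix.mulVec_smul, ← hs, ha]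
      simp
    · rw [spinorCoeff_biOp_two_succ k j v.val v.val_mem.2, Matrix.mulVec_sub, Matrix.mulVec_smul,
        Matrix.mulVec_smul, Pi.sub_apply, Pi.smul_apply, Pi.smul_apply, hDv, if_neg (by omega), hφv,
        ← hs, ha, show n - (c + 1) = a by omega]
      simp only [smul_eq_mul]
      ring
  · intro s hs v
    rw [mem_monogenicSub_zero hm hs, hall]
    refine forall_congr' fun a => forall_congr' fun c => forall_congr' fun hac => ?_
    rw [show a < s ↔ n < c + s by omega]
  · intro s hs v
    rw [mem_monogenicSub_two hm hs, hall]
  · intro v h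
    refine monogenic_eq_zero hm fun a c hac => ?_
    exact (hall (fun _ => True) v).1 (fun t c hc _ => h t c hc) a c hac trivial
  · intro F
    obtain ⟨f, hf, hF⟩ := exists_monogenic hm fun c => Q.mulVec fun t => F t c
    refine ⟨(⟨f, hf⟩ : monogenic k n), fun t c hc => ?_⟩
    change P.mulVec (spinorCoeff (mon j (n - c) 0 c) f) t = _
    rw [hF _ _ (by omega), Matrix.mulVec_mulVec, hPQ, Matrix.one_mulVec]

lemma anticomm_gen (hn : Even n) (j : Fin 3) (f : Monogenic k n) :
    gen j • gen (j + 2) • f + gen (j + 2) • gen j • f = gen (j + 1) • f +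
      algebraMap ℂ BI (2 * (k (j + 2) * k j +
        (k j + k (j + 1) + k (j + 2) + n + 1) * k (j + 1))) • f := by
  have h := anticomm_smul hn (j + 2) f
  have e1 : j + 2 + 1 = j := by rw [add_assoc]; exact add_zero j
  have e2 : j + 2 + 2 = j + 1 := by rw [add_assoc]; rfl
  rw [e1, e2, add_comm (gen (j + 2) • _)] at h
  rw [h, algebraMap_smul']
  congr 3
  rcases fin3_cases j with rfl | rfl | rfl
  · rfl
  · rw [show (1 : Fin 3) + 1 = 2 from rfl, show (1 : Fin 3) + 2 = 0 from rfl]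
    ring
  · rw [show (2 : Fin 3) + 1 = 0 from rfl, show (2 : Fin 3) + 2 = 1 from rfl]
    ring

lemma ofReal_of_tval {κ : ℝ} {t : ℕ} (h : tval κ = t) : (t : ℂ) = -(2 * κ) := by
  have := (tval_eq_coe h).2
  have h2 : (t : ℝ) = -(2 * κ) := by linarith
  exact_mod_cast congrArg (fun x : ℝ => (x : ℂ)) h2

lemma gam_ne_zero_of_lt_tval {κ : ℝ} {t p : ℕ} (h : tval κ = t) (hp : p ≠ 0) (hpt : p ≠ t) :
    gam κ p ≠ 0 := by
  intro h0
  have := gam_eq_zero hp h0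
  rw [h, Nat.cast_inj] at this
  exact hpt this.symm

end BannaiIto
end

/-! ### The three windows of coordinates -/

noncomputable section

namespace BannaiIto

variable {k : Fin 3 → ℝ} {n : ℕ} {j : Fin 3} {φ : Fin 2 → ℕ → Monogenic k n →+ ℂ} {ε : Fin 2 → ℂ}
  {s t : ℕ}

/-- The window is `0 ≤ c ≤ t - 1`, with generator `j` as `X` and minus generator `j + 2` as `Y`. -/
lemma IsCKCoord.isTwoCopies_quotient_two (h : IsCKCoord k n j φ ε) (hn : Even n) {d : ℕ}
    (hd : Even d) (hj : tval (k j) = s) (hr : tval (k (j + 2)) = t) (hst : s + t ≤ n) (hdt : d + 1 = t)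
    {σ : Equiv.Perm (Fin 3)} (h0 : σ j = 0) (h1 : σ (j + 2) = 1) (h2 : σ (j + 1) = 2) {a b c : ℂ}
    (ha : a = k (j + 1)) (hb : b = -k j - k (j + 1) - k (j + 2) - n - 1) (hc : c = -k j) :
    IsTwoCopies (Monogenic k n ⧸ monogenicSub k n (j + 2)) (TwistedO (1, -1) σ d hd a b c) := by
  have hs := ofReal_of_tval hj
  have ht := ofReal_of_tval hr
  have hd' : (d : ℂ) = -(2 * k (j + 2)) - 1 := by rw [← ht, ← hdt]; push_cast; ring
  refine isTwoCopies_quotient hd h0 h1 h2 φ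
    (fun u i => (-1) ^ i * Complex.I * ε u * gam (k j) (n - i + 1))
    (fun u i => -((-1) ^ i * Complex.I * ε u * gam (k (j + 2)) (i + 1))) h.scalar ?_ ?_ ?_ ?_ ?_ _ ?_ ?_
  · intro u i hi v
    rw [h.gen_zero u i (by omega), theta, ha, hd']
    congr 1
    push_cast
    simp
    left; ring
  · intro u i hi v
    rw [h.gen_two u i (by omega), if_neg (show i ≠ n by omega), theta, hb, hd',
      Nat.cast_sub (show i ≤ n by omega), sub_eq_add_neg]
    congr 1
    · simp
      ring
    -- The window closes at `i = t - 1`: the link to the coordinate `t` carries the factor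
    -- `γ_{j+2}(t) = 0`.
    · split_ifs with hid
      · rw [hid, hdt, gam_of_tval hr]; simp
      · ring
  · intro u i hi hid
    have hε : ε u ≠ 0 := left_ne_zero_of_mul_eq_one (h.sq u)
    have := gam_ne_zero_of_lt_tval hj (p := n - i + 1) (by omega) (by omega)
    simp [hε, this]
  · intro u i hi
    have hI := Complex.I_mul_I
    have hε := h.sq u
    have hp : ((-1 : ℂ) ^ i) * (-1) ^ i = 1 := by rw [← mul_pow]; simp
    have e : n - (i + 1) + 1 = n - i := by omega
    -- For even `n` the arguments `n - i` and `i + 1` have opposite parity, so exactly one factor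
    -- involves a `k`; this matches the two branches of `phi`.
    have key : gam (k j) (n - i) * gam (k (j + 2)) (i + 1) = phi d a b c (i + 1) := by
      rw [phi, ha, hb, hc, hd']
      rcases Nat.even_or_odd i with hi' | hi'
      · rw [if_neg (by simpa using hi'.add_one), gam_even ((Nat.even_sub (by omega)).2 (by simp [hn, hi'])),
          gam_odd hi'.add_one, Nat.cast_sub (by omega)]
        push_cast
        ring
      · rw [if_pos hi'.add_one, gam_odd (Nat.Even.sub_odd (by omega) hn hi'), gam_even hi'.add_one,
          Nat.cast_sub (by omega)]
        push_cast
        ring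
    rw [e, ← key, pow_succ]
    simp
    linear_combination (gam (k j) (n - i) * gam (k (j + 2)) (i + 1)) *
      ((-1) ^ i * (-1) ^ i * (ε u * ε u) * hI - (-1) ^ i * (-1) ^ i * hε - hp)
  · intro v
    rw [anticomm_gen hn j v]
    congr 3
    rw [ha, hb, hc, hd']
    push_cast
    simp
    ring
  · intro v
    rw [h.mem_two t hr]
    refine forall_congr' fun u => ⟨fun H i hi => H i (by omega) (by omega),
      fun H i _ hi => H i (by omega)⟩
  · intro F
    obtain ⟨v, hv⟩ := h.surj F
    exact ⟨v, fun u i hi => hv u i (by omega)⟩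

/-- The window `n - s < c ≤ n` read backwards, `i = n - c`, which interchanges the roles of the
generators `j` and `j + 2`. -/
lemma IsCKCoord.isTwoCopies_quotient_zero (h : IsCKCoord k n j φ ε) (hn : Even n) {d : ℕ}
    (hd : Even d) (hj : tval (k j) = s) (hr : tval (k (j + 2)) = t) (hst : s + t ≤ n) (hds : d + 1 = s)
    {σ : Equiv.Perm (Fin 3)} (h0 : σ (j + 2) = 0) (h1 : σ j = 1) (h2 : σ (j + 1) = 2) {a b c : ℂ}
    (ha : a = k (j + 1)) (hb : b = -k j - k (j + 1) - k (j + 2) - n - 1) (hc : c = -k (j + 2)) :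
    IsTwoCopies (Monogenic k n ⧸ monogenicSub k n j) (TwistedO (1, -1) σ d hd a b c) := by
  have hs := ofReal_of_tval hj
  have ht := ofReal_of_tval hr
  have hd' : (d : ℂ) = -(2 * k j) - 1 := by rw [← hs, ← hds]; push_cast; ring
  have hsub : ∀ i ≤ n, ((-1 : ℂ)) ^ (n - i) = (-1) ^ i := by
    intro i hi
    rcases Nat.even_or_odd i with h | h
    · rw [h.neg_one_pow, (Nat.even_sub hi |>.2 (by simp [hn, h])).neg_one_pow]
    · rw [h.neg_one_pow, (Nat.Even.sub_odd hi hn h).neg_one_pow]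
  refine isTwoCopies_quotient hd h0 h1 h2 (fun u i => φ u (n - i))
    (fun u i => -((-1) ^ i * Complex.I * ε u * gam (k (j + 2)) (n - i + 1)))
    (fun u i => (-1) ^ i * Complex.I * ε u * gam (k j) (i + 1)) (fun u i => h.scalar u _)
    ?_ ?_ ?_ ?_ ?_ _ ?_ ?_
  · intro u i hi v
    rw [h.gen_two u (n - i) (by omega), theta, ha, hd', hsub i (by omega),
      show n - (n - i) = i by omega, sub_eq_add_neg]
    congr 1
    · simp
      left; ring
    · split_ifs with h1 h2 h2
      · simp
      · omega
      · omega
      · rw [show n - (i - 1) = n - i + 1 by omega]; ring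
  · intro u i hi v
    rw [h.gen_zero u (n - i) (by omega), if_neg (show n - i ≠ 0 by omega), theta, hb, hd',
      hsub i (by omega), Nat.cast_sub (show i ≤ n by omega), show n - (n - i) = i by omega,
      show n - (i + 1) = n - i - 1 by omega]
    congr 1
    · simp
      ring
    · split_ifs with hid
      · rw [hid, hds, gam_of_tval hj]; simp
      · ring
  · intro u i hi hid
    have hε : ε u ≠ 0 := left_ne_zero_of_mul_eq_one (h.sq u)
    have := gam_ne_zero_of_lt_tval hr (p := n - i + 1) (by omega) (by omega)
    simp [hε, this]
  · intro u i hi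
    have hI := Complex.I_mul_I
    have hε := h.sq u
    have hp : ((-1 : ℂ) ^ i) * (-1) ^ i = 1 := by rw [← mul_pow]; simp
    have e : n - (i + 1) + 1 = n - i := by omega
    have key : gam (k (j + 2)) (n - i) * gam (k j) (i + 1) = phi d a b c (i + 1) := by
      rw [phi, ha, hb, hc, hd']
      rcases Nat.even_or_odd i with hi' | hi'
      · rw [if_neg (by simpa using hi'.add_one), gam_even ((Nat.even_sub (by omega)).2 (by simp [hn, hi'])),
          gam_odd hi'.add_one, Nat.cast_sub (by omega)]
        push_cast
        ring
      · rw [if_pos hi'.add_one, gam_odd (Nat.Even.sub_odd (by omega) hn hi'), gam_even hi'.add_one,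
          Nat.cast_sub (by omega)]
        push_cast
        ring
    rw [e, ← key, pow_succ]
    simp
    linear_combination (gam (k (j + 2)) (n - i) * gam (k j) (i + 1)) *
      ((-1) ^ i * (-1) ^ i * (ε u * ε u) * hI - (-1) ^ i * (-1) ^ i * hε - hp)
  · intro v
    rw [add_comm, anticomm_gen hn j v]
    congr 3
    rw [ha, hb, hc, hd']
    push_cast
    simp
    ring
  · intro v
    rw [h.mem_zero s hj]
    refine forall_congr' fun u => ⟨fun H i hi => H (n - i) (by omega) (by omega),
      fun H i hin hi => ?_⟩
    have := H (n - i) (by omega)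
    rwa [show n - (n - i) = i by omega] at this
  · intro F
    obtain ⟨v, hv⟩ := h.surj fun u i => F u (n - i)
    refine ⟨v, fun u i hi => ?_⟩
    rw [hv u _ (by omega), show n - (n - i) = i by omega]

lemma IsTwoCopies.of_quotient_bot {V W : Type} [AddCommGroup V] [Module BI V] [AddCommGroup W]
    [Module BI W] (h : IsTwoCopies (V ⧸ (⊥ : Submodule BI V)) W) : IsTwoCopies V W := by
  obtain ⟨e⟩ := h
  exact ⟨(Submodule.quotEquivOfEqBot ⊥ rfl).symm.trans e⟩

/-- The middle window `t ≤ c ≤ n - s`, `i = c - t`. As `t` is odd, `(-1)^{t+i} = -(-1)^i`, which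
changes the sign pattern of the twist to `(-1, 1)`. -/
lemma IsCKCoord.isTwoCopies_inf (h : IsCKCoord k n j φ ε) (hn : Even n) {d : ℕ}
    (hd : Even d) (hj : tval (k j) = s) (hr : tval (k (j + 2)) = t) (hst : d + s + t = n)
    {σ : Equiv.Perm (Fin 3)} (h0 : σ j = 0) (h1 : σ (j + 2) = 1) (h2 : σ (j + 1) = 2) {a b c : ℂ}
    (ha : a = k j + k (j + 1) + (n + 1) / 2) (hb : b = -k (j + 1) - k (j + 2) - (n + 1) / 2)
    (hc : c = -((n + 1) / 2)) :
    IsTwoCopies ↥(monogenicSub k n j ⊓ monogenicSub k n (j + 2)) (TwistedO (-1, 1) σ d hd a b c) := by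
  have hs := ofReal_of_tval hj
  have ht := ofReal_of_tval hr
  have hso := (tval_eq_coe hj).1
  have hto := (tval_eq_coe hr).1
  have hn' : (n : ℂ) = d - 2 * k j - 2 * k (j + 2) := by
    rw [← hst]; push_cast; rw [hs, ht]; ring
  refine IsTwoCopies.of_quotient_bot ?_
  refine isTwoCopies_quotient hd h0 h1 h2
    (fun u i => (φ u (t + i)).comp (Submodule.subtype _).toAddMonoidHom)
    (fun u i => (-1) ^ (t + i) * Complex.I * ε u * gam (k j) (n - (t + i) + 1))
    (fun u i => -((-1) ^ (t + i) * Complex.I * ε u * gam (k (j + 2)) (t + i + 1)))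
    (fun u i z v => h.scalar u _ z v.1) ?_ ?_ ?_ ?_ ?_ _ ?_ ?_
  · intro u i hi v
    change φ u (t + i) (gen j • v.1) = _ * φ u (t + i) v.1 + if _ then _ else _ * φ u (t + (i - 1)) v.1
    rw [h.gen_zero u (t + i) (by omega), if_neg (by have := hto.pos; omega), theta, ha, pow_add, hto.neg_one_pow, hn']
    congr 1
    · push_cast
      rw [ht]
      simp
      left; ring
    -- At the lower end the neighbouring coordinate `t - 1` vanishes on `M_n(x_{j+2})`; at the upper
    -- end, for generator `j + 2`, the coordinate `n - s + 1` vanishes on `M_n(x_j)`.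
    · split_ifs with hi0
      · rw [(h.mem_two t hr v.1).1 v.2.2 u (t + i - 1) (by omega) (by have := hto.pos; omega)]; ring
      · rw [show t + i - 1 = t + (i - 1) by omega]
  · intro u i hi v
    change φ u (t + i) (gen (j + 2) • v.1) =
      _ * φ u (t + i) v.1 + if _ then _ else _ * φ u (t + (i + 1)) v.1
    rw [h.gen_two u (t + i) (by omega), if_neg (by have := hso.pos; omega), theta, hb, pow_add, hto.neg_one_pow,
      Nat.cast_sub (show t + i ≤ n by omega), sub_eq_add_neg]
    congr 1
    · push_cast
      rw [ht, hn']
      simp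
      ring
    · split_ifs with hid
      · rw [(h.mem_zero s hj v.1).1 v.2.1 u (t + i + 1) (by have := hso.pos; omega) (by omega)]; ring
      · rw [show t + i + 1 = t + (i + 1) by omega]; ring
  · intro u i hi hid
    have hε : ε u ≠ 0 := left_ne_zero_of_mul_eq_one (h.sq u)
    have := gam_ne_zero_of_lt_tval hj (p := n - (t + i) + 1) (by omega) (by omega)
    simp [hε, this]
  · intro u i hi
    have hI := Complex.I_mul_I
    have hε := h.sq u
    have hp : ((-1 : ℂ) ^ i) * (-1) ^ i = 1 := by rw [← mul_pow]; simp
    have e : n - (t + (i + 1)) + 1 = n - (t + i) := by omega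
    have key : gam (k j) (n - (t + i)) * gam (k (j + 2)) (t + i + 1) = phi d a b c (i + 1) := by
      rw [phi, ha, hb, hc]
      rcases Nat.even_or_odd i with hi' | hi'
      · rw [if_neg (by simpa using hi'.add_one),
          gam_odd (Nat.Even.sub_odd (by omega) hn (hto.add_even hi')),
          gam_even (hto.add_even hi').add_one, Nat.cast_sub (by omega)]
        push_cast
        rw [ht, hn']
        ring
      · rw [if_pos hi'.add_one, gam_even ((Nat.even_sub (by omega)).2 (by simp [hn, hto.add_odd hi'])),
          gam_odd (hto.add_odd hi').add_one, Nat.cast_sub (by omega)]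
        push_cast
        rw [ht, hn']
        ring
    rw [e, ← key, pow_add, pow_add _ t i, hto.neg_one_pow, pow_succ]
    simp
    linear_combination (gam (k j) (n - (t + i)) * gam (k (j + 2)) (t + i + 1)) *
      ((-1) ^ i * (-1) ^ i * (ε u * ε u) * hI - (-1) ^ i * (-1) ^ i * hε - hp)
  · intro v
    refine Subtype.ext ?_
    have := anticomm_gen hn j v.1
    refine this.trans ?_
    change _ = _ + algebraMap ℂ BI _ • v.1
    congr 3
    rw [ha, hb, hc, hn']
    push_cast
    simp
    ring
  · intro v
    rw [Submodule.mem_bot]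
    constructor
    · rintro rfl u i hi
      exact map_zero _
    · intro H
      refine Subtype.ext (h.inj _ fun u c hc => ?_)
      by_cases h1 : c < t
      · exact (h.mem_two t hr v.1).1 v.2.2 u c hc h1
      · by_cases h2 : n < c + s
        · exact (h.mem_zero s hj v.1).1 v.2.1 u c hc h2
        · have := H u (c - t) (by omega)
          change φ u (t + (c - t)) v.1 = 0 at this
          rwa [show t + (c - t) = c by omega] at this
  · intro F
    obtain ⟨v, hv⟩ := h.surj fun u c => if c < t ∨ n < c + s then 0 else F u (c - t)
    refine ⟨⟨v, (h.mem_zero s hj v).2 fun u c hc hcs => ?_, (h.mem_two t hr v).2 fun u c hc hct => ?_⟩,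
      fun u i hi => ?_⟩
    · rw [hv u c hc, if_pos (Or.inr hcs)]
    · rw [hv u c hc, if_pos (Or.inl hct)]
    · change φ u (t + i) v = _
      rw [hv u _ (by omega), if_neg (by omega), show t + i - t = i by omega]

/-- Split the coordinates at `c = t`. The part with `c < t` has no coordinate with `c > n - s`,
because `s + t ≤ n`. -/
lemma IsCKCoord.sup_eq_top (h : IsCKCoord k n j φ ε) (hj : tval (k j) = s)
    (hr : tval (k (j + 2)) = t) (hst : s + t ≤ n) :
    monogenicSub k n j ⊔ monogenicSub k n (j + 2) = ⊤ := by
  rw [eq_top_iff]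
  intro v _
  obtain ⟨w, hw⟩ := h.surj fun u c => if c < t then φ u c v else 0
  refine Submodule.mem_sup.2 ⟨w, (h.mem_zero s hj w).2 fun u c hc hcs => ?_, v - w,
    (h.mem_two t hr _).2 fun u c hc hct => ?_, add_sub_cancel _ _⟩
  · rw [hw u c hc, if_neg (by omega)]
  · rw [map_sub, hw u c hc, if_pos hct, sub_self]

lemma HasStructure.symm {V : Type} [AddCommGroup V] [Module BI V] {N N' : Submodule BI V}
    {A B C : Type} [AddCommGroup A] [Module BI A] [AddCommGroup B] [Module BI B]
    [AddCommGroup C] [Module BI C] (h : HasStructure N N' A B C) : HasStructure N' N A C B := by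
  rw [HasStructure, inf_comm]
  exact ⟨h.1, h.2.2, h.2.1⟩

theorem hasStructure_monogenicSub (hn : Even n) (hm : (n : ℕ∞) < tval (k (j + 1))) {d d₁ d₂ : ℕ}
    (hd : Even d) (hd₁ : Even d₁) (hd₂ : Even d₂)
    (hj : tval (k j) = s) (hr : tval (k (j + 2)) = t) (hst : d + s + t = n) (hd₁t : d₁ + 1 = t)
    (hd₂s : d₂ + 1 = s) {σ τ : Equiv.Perm (Fin 3)} (hσ : σ j = 0 ∧ σ (j + 2) = 1 ∧ σ (j + 1) = 2)
    (hτ : τ (j + 2) = 0 ∧ τ j = 1 ∧ τ (j + 1) = 2) {a b c a' b' c₁ c₂ : ℂ}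
    (ha : a = k j + k (j + 1) + (n + 1) / 2) (hb : b = -k (j + 1) - k (j + 2) - (n + 1) / 2)
    (hc : c = -((n + 1) / 2)) (ha' : a' = k (j + 1))
    (hb' : b' = -k j - k (j + 1) - k (j + 2) - n - 1) (hc₁ : c₁ = -k j) (hc₂ : c₂ = -k (j + 2)) :
    HasStructure (monogenicSub k n j) (monogenicSub k n (j + 2)) (TwistedO (-1, 1) σ d hd a b c)
      (TwistedO (1, -1) σ d₁ hd₁ a' b' c₁) (TwistedO (1, -1) τ d₂ hd₂ a' b' c₂) := by
  obtain ⟨φ, ε, h⟩ := exists_isCKCoord hn hm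
  have h2 := h.isTwoCopies_quotient_two hn hd₁ hj hr (by omega) hd₁t hσ.1 hσ.2.1 hσ.2.2 ha' hb' hc₁
  have h0 := h.isTwoCopies_quotient_zero hn hd₂ hj hr (by omega) hd₂s hτ.1 hτ.2.1 hτ.2.2 ha' hb' hc₂
  have hsup := h.sup_eq_top hj hr (by omega)
  exact ⟨h.isTwoCopies_inf hn hd hj hr hst hσ.1 hσ.2.1 hσ.2.2 ha hb hc,
    ⟨h2.of_sup_eq_top hsup rfl, h2⟩,
    ⟨h0.of_sup_eq_top (sup_comm (monogenicSub k n j) _ ▸ hsup) (inf_comm _ _), h0⟩⟩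

end BannaiIto
end

/-! ### Genericity of the parameters and the three cases -/

noncomputable section

namespace BannaiIto

/-- All four combinations are at most `-t/2 = -(d+1)/2`. -/
lemma isGeneric_quotient {d n s t : ℕ} {x y z : ℝ} (hx : 2 * x = -s) (hz : 2 * z = -t)
    (hst : s + t ≤ n) (hdt : d + 1 = t) (hy : 0 ≤ y) : IsGeneric d y (-x - y - z - n - 1) (-x) := by
  have h1 : (s : ℝ) + t ≤ n := by exact_mod_cast hst
  have h2 : (d : ℝ) + 1 = t := by exact_mod_cast hdt
  have h3 : (0 : ℝ) ≤ s := s.cast_nonneg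
  have h4 : (0 : ℝ) ≤ t := t.cast_nonneg
  refine ⟨by linarith, ?_, ?_, ?_, ?_⟩ <;> rw [le_abs] <;> right <;> linarith

/-- Here `b + (a+c) = -(d+1)/2 - s`, `b - (a+c) = -(d+1)/2 - 2y` and `b + (a-c) = (d+1)/2 + t`; the
second bound is where `y ≥ 0` is sharp. Also `2b = -(d+1) - s - 2y`, and `s ≥ 1` makes the first
condition strict. -/
lemma isGeneric_inf {d n s t : ℕ} {x y z : ℝ} (hx : 2 * x = -s) (hz : 2 * z = -t)
    (hst : d + s + t = n) (hs : Odd s) (hy : 0 ≤ y) :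
    IsGeneric d (x + y + (n + 1) / 2) (-y - z - (n + 1) / 2) (-((n + 1) / 2)) := by
  have h1 : (d : ℝ) + s + t = n := by exact_mod_cast hst
  have h3 : (1 : ℝ) ≤ s := by exact_mod_cast hs.pos
  have h4 : (0 : ℝ) ≤ t := t.cast_nonneg
  refine ⟨by linarith, ?_, ?_, ?_, ?_⟩ <;> rw [le_abs]
  · right; linarith
  · right; linarith
  · left; linarith
  · right; linarith

lemma eq_twistFam_of {g : ℤˣ × ℤˣ} {σ : Equiv.Perm (Fin 3)} {a b c a' b' c' : ℂ}
    (h0 : a' = twistFam g σ ![a, b, c] 0) (h1 : b' = twistFam g σ ![a, b, c] 1)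
    (h2 : c' = twistFam g σ ![a, b, c] 2) : ![a', b', c'] = twistFam g σ ![a, b, c] := by
  funext i
  rcases fin3_cases i with rfl | rfl | rfl
  exacts [h0, h1, h2]

end BannaiIto
end

open BannaiIto

theorem theorem8p10 (k : Fin 3 → ℝ) (n : ℕ) (hn : Even n) :
    (∀ (t₁ t₃ : ℕ) (h₁ : tval (k 0) = t₁) (h₃ : tval (k 2) = t₃),
      t₁ + t₃ ≤ n → (n : ℕ∞) < tval (k 1) →
      HasStructure (monogenicSub k n 0) (monogenicSub k n 2)
        (TwistedO (-1, 1) (Equiv.swap 1 2) (n - t₁ - t₃) (even_sub hn h₁ h₃)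
        (k 0 + k 1 + (n + 1) / 2) (-k 1 - k 2 - (n + 1) / 2) (-((n + 1) / 2)))
        (TwistedO (1, -1) (Equiv.swap 1 2) (t₃ - 1) (even_of_tval h₃)
        (k 1) (-k 0 - k 1 - k 2 - n - 1) (-k 0))
        (TwistedO (1, -1) (finRotate 3) (t₁ - 1) (even_of_tval h₁)
        (k 1) (-k 0 - k 1 - k 2 - n - 1) (-k 2)) ∧
      (0 ≤ k 1 →
        IsIrreducibleIso
          (TwistedO (-1, 1) (Equiv.swap 1 2) (n - t₁ - t₃) (even_sub hn h₁ h₃)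
        (k 0 + k 1 + (n + 1) / 2) (-k 1 - k 2 - (n + 1) / 2) (-((n + 1) / 2)))
          (OMod (n - t₁ - t₃) (even_sub hn h₁ h₃)
        (-k 0 - k 1 - (n + 1) / 2) ((n + 1) / 2) (-k 1 - k 2 - (n + 1) / 2)) ∧
        IsIrreducibleIso
          (TwistedO (1, -1) (Equiv.swap 1 2) (t₃ - 1) (even_of_tval h₃)
        (k 1) (-k 0 - k 1 - k 2 - n - 1) (-k 0))
          (OMod (t₃ - 1) (even_of_tval h₃) (k 1) (k 0) (k 0 + k 1 + k 2 + n + 1)) ∧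
        IsIrreducibleIso
          (TwistedO (1, -1) (finRotate 3) (t₁ - 1) (even_of_tval h₁)
        (k 1) (-k 0 - k 1 - k 2 - n - 1) (-k 2))
          (OMod (t₁ - 1) (even_of_tval h₁) (k 0 + k 1 + k 2 + n + 1) (k 2) (k 1)))) ∧
    (∀ (t₁ t₂ : ℕ) (h₁ : tval (k 0) = t₁) (h₂ : tval (k 1) = t₂),
      t₁ + t₂ ≤ n → (n : ℕ∞) < tval (k 2) →
      HasStructure (monogenicSub k n 0) (monogenicSub k n 1)
        (TwistedO (-1, 1) (Equiv.swap 0 1) (n - t₁ - t₂) (even_sub hn h₁ h₂)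
        (k 1 + k 2 + (n + 1) / 2) (-k 0 - k 2 - (n + 1) / 2) (-((n + 1) / 2)))
        (TwistedO (1, -1) 1 (t₂ - 1) (even_of_tval h₂)
        (k 2) (-k 0 - k 1 - k 2 - n - 1) (-k 0))
        (TwistedO (1, -1) (Equiv.swap 0 1) (t₁ - 1) (even_of_tval h₁)
        (k 2) (-k 0 - k 1 - k 2 - n - 1) (-k 1)) ∧
      (0 ≤ k 2 →
        IsIrreducibleIso
          (TwistedO (-1, 1) (Equiv.swap 0 1) (n - t₁ - t₂) (even_sub hn h₁ h₂)
        (k 1 + k 2 + (n + 1) / 2) (-k 0 - k 2 - (n + 1) / 2) (-((n + 1) / 2)))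
          (OMod (n - t₁ - t₂) (even_sub hn h₁ h₂)
        (-k 0 - k 2 - (n + 1) / 2) (-k 1 - k 2 - (n + 1) / 2) ((n + 1) / 2)) ∧
        IsIrreducibleIso
          (TwistedO (1, -1) 1 (t₂ - 1) (even_of_tval h₂)
        (k 2) (-k 0 - k 1 - k 2 - n - 1) (-k 0))
          (OMod (t₂ - 1) (even_of_tval h₂) (k 2) (k 0 + k 1 + k 2 + n + 1) (k 0)) ∧
        IsIrreducibleIso
          (TwistedO (1, -1) (Equiv.swap 0 1) (t₁ - 1) (even_of_tval h₁)
        (k 2) (-k 0 - k 1 - k 2 - n - 1) (-k 1))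
          (OMod (t₁ - 1) (even_of_tval h₁) (k 0 + k 1 + k 2 + n + 1) (k 2) (k 1)))) ∧
    (∀ (t₂ t₃ : ℕ) (h₂ : tval (k 1) = t₂) (h₃ : tval (k 2) = t₃),
      t₂ + t₃ ≤ n → (n : ℕ∞) < tval (k 0) →
      HasStructure (monogenicSub k n 1) (monogenicSub k n 2)
        (TwistedO (-1, 1) (Equiv.swap 0 2) (n - t₂ - t₃) (even_sub hn h₂ h₃)
        (k 0 + k 2 + (n + 1) / 2) (-k 0 - k 1 - (n + 1) / 2) (-((n + 1) / 2)))
        (TwistedO (1, -1) (finRotate 3)⁻¹ (t₃ - 1) (even_of_tval h₃)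
        (k 0) (-k 0 - k 1 - k 2 - n - 1) (-k 1))
        (TwistedO (1, -1) (Equiv.swap 0 2) (t₂ - 1) (even_of_tval h₂)
        (k 0) (-k 0 - k 1 - k 2 - n - 1) (-k 2)) ∧
      (0 ≤ k 0 →
        IsIrreducibleIso
          (TwistedO (-1, 1) (Equiv.swap 0 2) (n - t₂ - t₃) (even_sub hn h₂ h₃)
        (k 0 + k 2 + (n + 1) / 2) (-k 0 - k 1 - (n + 1) / 2) (-((n + 1) / 2)))
          (OMod (n - t₂ - t₃) (even_sub hn h₂ h₃)
        ((n + 1) / 2) (-k 0 - k 1 - (n + 1) / 2) (-k 0 - k 2 - (n + 1) / 2)) ∧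
        IsIrreducibleIso
          (TwistedO (1, -1) (finRotate 3)⁻¹ (t₃ - 1) (even_of_tval h₃)
        (k 0) (-k 0 - k 1 - k 2 - n - 1) (-k 1))
          (OMod (t₃ - 1) (even_of_tval h₃) (k 1) (k 0) (k 0 + k 1 + k 2 + n + 1)) ∧
        IsIrreducibleIso
          (TwistedO (1, -1) (Equiv.swap 0 2) (t₂ - 1) (even_of_tval h₂)
        (k 0) (-k 0 - k 1 - k 2 - n - 1) (-k 2))
          (OMod (t₂ - 1) (even_of_tval h₂) (k 2) (k 0 + k 1 + k 2 + n + 1) (k 0)))) := by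
  refine ⟨fun t₁ t₃ h₁ h₃ hle hm => ?_, fun t₁ t₂ h₁ h₂ hle hm => ?_, fun t₂ t₃ h₂ h₃ hle hm => ?_⟩
  · have p₁ := (tval_eq_coe h₁).1.pos
    have p₂ := (tval_eq_coe h₃).1.pos
    refine ⟨?_, fun hk => ⟨?_, ?_, ?_⟩⟩
    · exact hasStructure_monogenicSub (j := 0) hn hm _ _ _ h₁ h₃ (by omega) (by omega) (by omega)
        (by decide) (by decide) rfl rfl rfl rfl rfl rfl rfl
    · refine (isGeneric_inf (n := n) (tval_eq_coe h₁).2 (tval_eq_coe h₃).2 (by omega)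
        (tval_eq_coe h₁).1 hk).isIrreducibleIso _ _ _
        (by push_cast; ring) (by push_cast; ring) (by push_cast; ring) (eq_twistFam_of ?_ ?_ ?_) <;>
      simp [twistFam, signOf, Equiv.swap_apply_def] <;> ring
    · refine (isGeneric_quotient (n := n) (tval_eq_coe h₁).2 (tval_eq_coe h₃).2 (by omega) (by omega)
        hk).isIrreducibleIso _ _ _
        rfl (by push_cast; ring) (by push_cast; ring) (eq_twistFam_of ?_ ?_ ?_) <;>
      simp [twistFam, signOf, Equiv.swap_apply_def] <;> ring
    -- The other quotient has `c = -k 2` and `d = t₁ - 1`, so the two outer variables exchange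
    -- roles.
    · refine (isGeneric_quotient (n := n) (tval_eq_coe h₃).2 (tval_eq_coe h₁).2 (by omega) (by omega)
        hk).isIrreducibleIso _ _ _
        rfl (by push_cast; ring) (by push_cast; ring) (eq_twistFam_of ?_ ?_ ?_) <;>
      simp [twistFam, signOf, show finRotate 3 0 = 1 from rfl, show finRotate 3 1 = 2 from rfl,
        show finRotate 3 2 = 0 from rfl] <;> ring
  · have p₁ := (tval_eq_coe h₁).1.pos
    have p₂ := (tval_eq_coe h₂).1.pos
    refine ⟨?_, fun hk => ⟨?_, ?_, ?_⟩⟩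
    -- Taking `j = 1` makes `x_2` (counted from `0`) the variable with large `t`. The cyclic order
    -- then lists the two submodules as those of `x_1, x_0`, hence the `symm`.
    · refine (hasStructure_monogenicSub (j := 1) hn hm _ _ _ h₂ h₁ (by omega) (by omega) (by omega)
        (by decide) (by decide) ?_ ?_ rfl rfl ?_ rfl rfl).symm <;>
      simp only [Fin.isValue, Fin.reduceAdd] <;> ring
    · refine (isGeneric_inf (n := n) (tval_eq_coe h₂).2 (tval_eq_coe h₁).2 (by omega)
        (tval_eq_coe h₂).1 hk).isIrreducibleIso _ _ _
        (by push_cast; ring) (by push_cast; ring) (by push_cast; ring) (eq_twistFam_of ?_ ?_ ?_) <;>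
      simp [twistFam, signOf, Equiv.swap_apply_def] <;> ring
    · refine (isGeneric_quotient (n := n) (tval_eq_coe h₁).2 (tval_eq_coe h₂).2 (by omega) (by omega)
        hk).isIrreducibleIso _ _ _
        rfl (by push_cast; ring) (by push_cast; ring) (eq_twistFam_of ?_ ?_ ?_) <;>
      simp [twistFam, signOf] <;> ring
    · refine (isGeneric_quotient (n := n) (tval_eq_coe h₂).2 (tval_eq_coe h₁).2 (by omega) (by omega)
        hk).isIrreducibleIso _ _ _
        rfl (by push_cast; ring) (by push_cast; ring) (eq_twistFam_of ?_ ?_ ?_) <;>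
      simp [twistFam, signOf, Equiv.swap_apply_def] <;> ring
  · have p₁ := (tval_eq_coe h₂).1.pos
    have p₂ := (tval_eq_coe h₃).1.pos
    refine ⟨?_, fun hk => ⟨?_, ?_, ?_⟩⟩
    · refine (hasStructure_monogenicSub (j := 2) hn hm _ _ _ h₃ h₂ (by omega) (by omega) (by omega)
        (by decide) (by decide) ?_ ?_ rfl rfl ?_ rfl rfl).symm <;>
      simp only [Fin.isValue, Fin.reduceAdd] <;> ring
    · refine (isGeneric_inf (n := n) (tval_eq_coe h₃).2 (tval_eq_coe h₂).2 (by omega)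
        (tval_eq_coe h₃).1 hk).isIrreducibleIso _ _ _
        (by push_cast; ring) (by push_cast; ring) (by push_cast; ring) (eq_twistFam_of ?_ ?_ ?_) <;>
      simp [twistFam, signOf, Equiv.swap_apply_def] <;> ring
    · refine (isGeneric_quotient (n := n) (tval_eq_coe h₂).2 (tval_eq_coe h₃).2 (by omega) (by omega)
        hk).isIrreducibleIso _ _ _
        rfl (by push_cast; ring) (by push_cast; ring) (eq_twistFam_of ?_ ?_ ?_) <;>
      simp [twistFam, signOf, show (finRotate 3)⁻¹ 0 = 2 from rfl,
        show (finRotate 3)⁻¹ 1 = 0 from rfl, show (finRotate 3)⁻¹ 2 = 1 from rfl] <;> ring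
    · refine (isGeneric_quotient (n := n) (tval_eq_coe h₃).2 (tval_eq_coe h₂).2 (by omega) (by omega)
        hk).isIrreducibleIso _ _ _
        rfl (by push_cast; ring) (by push_cast; ring) (eq_twistFam_of ?_ ?_ ?_) <;>
      simp [twistFam, signOf, Equiv.swap_apply_def] <;> ring
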